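/- **Setting.** Let $m<n$. On the space $\mathcal S^n$ of real symmetric $n\times n$ matrices put $\langle B,X\rangle=\mathrm{Tr}(BX)$; let $\mathcal S^n_{+}$, $\mathcal S^n_{++}$ be the positive semidefinite and positive definite matrices. Given $A_1,\dots,A_m,C\in\mathcal S^n$ and $b\in\mathbb R^m$, let $\mathcal AX=(\langle A_i,X\rangle)_{i}$, $\mathcal A^*y=\sum_i y_iA_i$, let $A$ be the $m\times n^2$ matrix whose rows are the vectorized $A_i$, and consider $$(P)\ \min\{\langle C,X\rangle:\ \mathcal AX=b,\ X\in\mathcal S^n_+\},\qquad (D)\ \max\{b^\top y:\ \mathcal A^*y+Z=C,\ Z\in\mathcal S^n_+\}.$$ $\|\cdot\|_2$ of a tuple of vectors and matrices is the Euclidean (Frobenius) norm of the stacked vector, and $\|(r,R)\|_{\mathcal S}=\min\{\|(X,Z)\|_2:\ \mathcal AX=r,\ \mathcal A^*y+Z=R \text{ for some } y\}$. **Assumption 1.** $(P)$ and $(D)$ are strictly feasible, and there is an optimal solution $(X^*,y^*,Z^*)$ of the pair with $\|(X^*,y^*,Z^*)\|_2\le K_*\sqrt n$. **Assumption 2.**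 $\mathrm{rank}(A)=m$, the singular values of $A$ lie in $[K_{A,1},K_{A,2}]$, $\|b\|_\infty\le K_{r,1}$, and the spectral norm of $C$ is at most $K_{r,2}\sqrt n$. **Algorithm (inexact IP-PMM).** Parameters: $0<\sigma_{\min}\le\sigma_{\max}\le\frac12$, $K_N>0$, $\gamma_{\mathcal S},\gamma_\mu\in(0,1)$. Starting point: $X_0=Z_0=\Xi_0=\rho I_n$ with $\rho>0$, $\lambda_0=y_0\in\mathbb R^m$, $\bar b=\mathcal AX_0-b$, $\bar C=\mathcal A^*y_0+Z_0-C$. Throughout $\mu_k=\langle X_k,Z_k\rangle/n$; so $\mu_0=\rho^2$. The neighbourhood $\mathscr N_\mu(\Xi,\lambda)$ is the set of $(X,y,Z)$ with $X,Z\in\mathcal S^n_{++}$, $\|Z^{1/2}XZ^{1/2}-\mu I_n\|_F\le\gamma_\mu\mu$, and $$\mathcal AX+\mu(y-\lambda)=b+\tfrac{\mu}{\mu_0}(\bar b+\tilde b),\qquad \mathcal A^*y+Z-\mu(X-\Xi)=C+\tfrac{\mu}{\mu_0}(\bar C+\tilde C)$$ for some $(\tilde b,\tilde C)$ with $\|(\tilde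 b,\tilde C)\|_2\le K_N$, $\|(\tilde b,\tilde C)\|_{\mathcal S}\le\gamma_{\mathcal S}\rho$. Iteration $k$: choose $\sigma_k\in[\sigma_{\min},\sigma_{\max}]$ and find $\Delta X_k,\Delta Z_k\in\mathcal S^n$, $\Delta y_k\in\mathbb R^m$ with $$\begin{aligned}-\mu_k\Delta X_k+\mathcal A^*\Delta y_k+\Delta Z_k&=C+\tfrac{\sigma_k\mu_k}{\mu_0}\bar C-\mathcal A^*y_k-Z_k+\sigma_k\mu_k(X_k-\Xi_k)+\mathsf E_{d,k},\\ \mathcal A\Delta X_k+\mu_k\Delta y_k&=-\mathcal AX_k-\sigma_k\mu_k(y_k-\lambda_k)+b+\tfrac{\sigma_k\mu_k}{\mu_0}\bar b+\epsilon_{p,k},\\ Z_k^{\frac12}\Delta X_kZ_k^{\frac12}+\tfrac12\big(Z_k^{-\frac12}\Delta Z_kX_kZ_k^{\frac12}+Z_k^{\frac12}X_k\Delta Z_kZ_k^{-\frac12}\big)&=-Z_k^{\frac12}X_kZ_k^{\frac12}+\sigma_k\mu_kI_n,\end{aligned}$$ where the errors satisfy $\|(\epsilon_{p,k},\mathsf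 E_{d,k})\|_2\le\frac{\sigma_{\min}}{4\mu_0}K_N\mu_k$ and $\|(\epsilon_{p,k},\mathsf E_{d,k})\|_{\mathcal S}\le\frac{\sigma_{\min}}{4\mu_0}\gamma_{\mathcal S}\rho\mu_k$. Let $\alpha_k$ be the largest $\alpha\in(0,1]$ such that, with $(X,y,Z)=(X_k,y_k,Z_k)+\alpha(\Delta X_k,\Delta y_k,\Delta Z_k)$ and $\mu=\langle X,Z\rangle/n$, one has $\mu\le(1-0.01\alpha)\mu_k$ and $(X,y,Z)\in\mathscr N_\mu(\Xi_k,\lambda_k)$; take $(X_{k+1},y_{k+1},Z_{k+1})$ to be that point for $\alpha=\alpha_k$. With $r_p=\mathcal AX_{k+1}-b-\frac{\mu_{k+1}}{\mu_0}\bar b$ and $R_d=C+\frac{\mu_{k+1}}{\mu_0}\bar C-\mathcal A^*y_{k+1}-Z_{k+1}$, set $(\Xi_{k+1},\lambda_{k+1})=(X_{k+1},y_{k+1})$ if $\|(r_p,R_d)\|_2\le K_N\frac{\mu_{k+1}}{\mu_0}$ and $\|(r_p,R_d)\|_{\mathcal S}\le\gamma_{\mathcal S}\rho\frac{\mu_{k+1}}{\mu_0}$,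 and $(\Xi_{k+1},\lambda_{k+1})=(\Xi_k,\lambda_k)$ otherwise. **Theorem 4.2.** Let the algorithm parameters $\sigma_{\min},\sigma_{\max},K_N,\gamma_{\mathcal S},\gamma_\mu$, the scale $\rho>0$ of the starting point, and positive constants $K_*,K_{A,1},K_{A,2},K_{r,1},K_{r,2},K_y,K,\omega$ be given. Then for every $\varepsilon_0\in(0,1)$ there is a constant $c>0$, depending only on these data and $\varepsilon_0$ (and on neither $m$, $n$, the problem, $y_0$, $\varepsilon$, nor the choices made during the run), such that the following holds. For all $m<n$, every problem pair satisfying Assumptions 1 and 2 with these constants, every $y_0$ with $\|y_0\|_2\le K_y\sqrt n$, every $\varepsilon\in(0,\varepsilon_0]$ with $\mu_0\le K/\varepsilon^{\omega}$, and every run of the algorithm (finite or infinite), there is an index $k_0\ge0$ with $$k_0\le c\,n^4\,\Big|\log\frac1\varepsilon\Big|$$ such that $\mu_k\le\varepsilon$ for all $k\ge k_0$ for which the $k$-th iterate exists. -/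

import Mathlib

open scoped Matrix MatrixOrder

noncomputable section

namespace IPPMM

/-- Data of a linear SDP pair in standard form:
`(P)  min ⟨C, X⟩  s.t. ⟨A i, X⟩ = b i (i < m), X ⪰ 0`  and
`(D)  max bᵀy  s.t. ∑ i, y i • A i + Z = C, Z ⪰ 0`. -/
structure SDP (m n : ℕ) where
  A : Fin m → Matrix (Fin n) (Fin n) ℝ
  A_symm : ∀ i, (A i).IsSymm
  b : Fin m → ℝ
  C : Matrix (Fin n) (Fin n) ℝ
  C_symm : C.IsSymm

variable {m n : ℕ}

/-- The operator `𝒜 X = (⟨A i, X⟩)_i`, with `⟨B, X⟩ = Tr (B X)`. -/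
def SDP.op (P : SDP m n) (X : Matrix (Fin n) (Fin n) ℝ) : Fin m → ℝ :=
  fun i => (P.A i * X).trace

/-- The adjoint `𝒜* y = ∑ i, y i • A i`. -/
def SDP.adj (P : SDP m n) (y : Fin m → ℝ) : Matrix (Fin n) (Fin n) ℝ :=
  ∑ i, y i • P.A i

/-- The vectorized constraint matrix, an `m × n²` matrix whose rows are the vectors `vec (A i)`. -/
def SDP.mat (P : SDP m n) : Matrix (Fin m) (Fin n × Fin n) ℝ :=
  Matrix.of fun i => Matrix.vec (P.A i)

/-- Euclidean norm of a vector. -/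
def vnorm (r : Fin m → ℝ) : ℝ := √(∑ i, r i ^ 2)

/-- Frobenius norm of a matrix. -/
def fnorm (R : Matrix (Fin n) (Fin n) ℝ) : ℝ := √(∑ i, ∑ j, R i j ^ 2)

/-- Euclidean norm of the stacked vector `(r, vec R)`. -/
def pnorm (r : Fin m → ℝ) (R : Matrix (Fin n) (Fin n) ℝ) : ℝ :=
  √(vnorm r ^ 2 + fnorm R ^ 2)

/-- The semi-norm
`‖(r, R)‖_S = min {‖(X, Z)‖_F : 𝒜 X = r and 𝒜* y + Z = R for some y}`. -/
def SDP.snorm (P : SDP m n) (r : Fin m → ℝ) (R : Matrix (Fin n) (Fin n) ℝ) : ℝ :=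
  sInf {s : ℝ | ∃ (X : Matrix (Fin n) (Fin n) ℝ) (y : Fin m → ℝ) (Z : Matrix (Fin n) (Fin n) ℝ),
    P.op X = r ∧ P.adj y + Z = R ∧ s = √(fnorm X ^ 2 + fnorm Z ^ 2)}

/-! ### Feasibility, optimality, assumptions -/

def SDP.PrimalFeasible (P : SDP m n) (X : Matrix (Fin n) (Fin n) ℝ) : Prop :=
  X.PosSemidef ∧ P.op X = P.b

def SDP.DualFeasible (P : SDP m n) (y : Fin m → ℝ) (Z : Matrix (Fin n) (Fin n) ℝ) : Prop :=
  Z.PosSemidef ∧ P.adj y + Z = P.C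

/-- Slater's condition for both problems. -/
def SDP.StrictlyFeasible (P : SDP m n) : Prop :=
  (∃ X : Matrix (Fin n) (Fin n) ℝ, X.PosDef ∧ P.op X = P.b) ∧
  (∃ (y : Fin m → ℝ) (Z : Matrix (Fin n) (Fin n) ℝ), Z.PosDef ∧ P.adj y + Z = P.C)

/-- `X` solves the primal problem and `(y, Z)` solves the dual problem. -/
def SDP.IsOptimal (P : SDP m n) (X : Matrix (Fin n) (Fin n) ℝ) (y : Fin m → ℝ)
    (Z : Matrix (Fin n) (Fin n) ℝ) : Prop :=
  (P.PrimalFeasible X ∧ ∀ X', P.PrimalFeasible X' → (P.C * X).trace ≤ (P.C * X').trace) ∧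
  (P.DualFeasible y Z ∧ ∀ y' Z', P.DualFeasible y' Z' → P.b ⬝ᵥ y' ≤ P.b ⬝ᵥ y)

/-- Strict feasibility, and an optimal triple of norm at most `K √n`. -/
def SDP.Assumption1 (P : SDP m n) (Kstar : ℝ) : Prop :=
  P.StrictlyFeasible ∧
  ∃ (X : Matrix (Fin n) (Fin n) ℝ) (y : Fin m → ℝ) (Z : Matrix (Fin n) (Fin n) ℝ),
    P.IsOptimal X y Z ∧
    √(fnorm X ^ 2 + vnorm y ^ 2 + fnorm Z ^ 2) ≤ Kstar * √(n : ℝ)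

/-- Full row rank, all the `m` singular values of the vectorized constraint matrix in
`[KA1, KA2]` (Mathlib lists singular values in decreasing order from index `0`, followed by
zeros), `‖b‖_∞ ≤ Kr1`, and spectral norm of `C` at most `Kr2 √n`. -/
def SDP.Assumption2 (P : SDP m n) (KA1 KA2 Kr1 Kr2 : ℝ) : Prop :=
  P.mat.rank = m ∧
  (∀ i < m, KA1 ≤ (Matrix.toEuclideanLin P.mat).singularValues i ∧
    (Matrix.toEuclideanLin P.mat).singularValues i ≤ KA2) ∧
  (∀ i, |P.b i| ≤ Kr1) ∧
  ‖Matrix.toEuclideanCLM (𝕜 := ℝ) P.C‖ ≤ Kr2 * √(n : ℝ)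

/-! ### The algorithm -/

/-- Parameters of the method. -/
structure Params where
  σmin : ℝ
  σmax : ℝ
  KN : ℝ
  γS : ℝ
  γμ : ℝ
  σmin_pos : 0 < σmin
  σmin_le : σmin ≤ σmax
  σmax_le : σmax ≤ 1 / 2
  KN_pos : 0 < KN
  γS_pos : 0 < γS
  γS_lt : γS < 1
  γμ_pos : 0 < γμ
  γμ_lt : γμ < 1

/-- The barrier parameter `⟨X, Z⟩ / n` of a pair. -/
def mu (X Z : Matrix (Fin n) (Fin n) ℝ) : ℝ := (X * Z).trace / n

/-- `μ₀ = ⟨ρ I, ρ I⟩ / n`, the barrier parameter of the starting point. -/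
def mu0 (n : ℕ) (ρ : ℝ) : ℝ :=
  mu (ρ • (1 : Matrix (Fin n) (Fin n) ℝ)) (ρ • (1 : Matrix (Fin n) (Fin n) ℝ))

/-- `b̄ = 𝒜 X₀ - b`, with `X₀ = ρ I`. -/
def SDP.bbar (P : SDP m n) (ρ : ℝ) : Fin m → ℝ :=
  P.op (ρ • (1 : Matrix (Fin n) (Fin n) ℝ)) - P.b

/-- `C̄ = 𝒜* y₀ + Z₀ - C`, with `Z₀ = ρ I`. -/
def SDP.Cbar (P : SDP m n) (ρ : ℝ) (y₀ : Fin m → ℝ) : Matrix (Fin n) (Fin n) ℝ :=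
  P.adj y₀ + ρ • (1 : Matrix (Fin n) (Fin n) ℝ) - P.C

/-- The symmetrization operator `H_Q(B) = (Q B Q⁻¹ + (Q B Q⁻¹)ᵀ) / 2`. -/
def symmOp (Q B : Matrix (Fin n) (Fin n) ℝ) : Matrix (Fin n) (Fin n) ℝ :=
  (1 / 2 : ℝ) • (Q * B * Q⁻¹ + (Q * B * Q⁻¹)ᵀ)

/-- The neighbourhood `𝒩_μ(Ξ, lam)`; the symmetrization is taken with respect to `Z^{1/2}`. -/
def SDP.Nbhd (P : SDP m n) (par : Params) (ρ : ℝ) (y₀ : Fin m → ℝ) (μ : ℝ)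
    (Ξ : Matrix (Fin n) (Fin n) ℝ) (lam : Fin m → ℝ)
    (X : Matrix (Fin n) (Fin n) ℝ) (y : Fin m → ℝ) (Z : Matrix (Fin n) (Fin n) ℝ) : Prop :=
  (∃ (bt : Fin m → ℝ) (Ct : Matrix (Fin n) (Fin n) ℝ),
    P.op X + μ • (y - lam) = P.b + (μ / mu0 n ρ) • (P.bbar ρ + bt) ∧
    P.adj y + Z - μ • (X - Ξ) = P.C + (μ / mu0 n ρ) • (P.Cbar ρ y₀ + Ct) ∧
    pnorm bt Ct ≤ par.KN ∧ P.snorm bt Ct ≤ par.γS * ρ) ∧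
  X.PosDef ∧ Z.PosDef ∧
  fnorm (symmOp (CFC.sqrt Z) (X * Z) - μ • (1 : Matrix (Fin n) (Fin n) ℝ)) ≤ par.γμ * μ

/-- An iterate `(X, y, Z)` together with the proximal estimates `(Ξ, lam)`. -/
structure State (m n : ℕ) where
  X : Matrix (Fin n) (Fin n) ℝ
  y : Fin m → ℝ
  Z : Matrix (Fin n) (Fin n) ℝ
  Ξ : Matrix (Fin n) (Fin n) ℝ
  lam : Fin m → ℝ

/-- The barrier parameter of the current iterate. -/
def State.μ (s : State m n) : ℝ := mu s.X s.Z

/-- The starting point: `X₀ = Z₀ = ρ I`, `Ξ₀ = X₀`, `λ₀ = y₀`. -/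
def start (n : ℕ) (ρ : ℝ) (y₀ : Fin m → ℝ) : State m n where
  X := ρ • 1
  y := y₀
  Z := ρ • 1
  Ξ := ρ • 1
  lam := y₀

/-- `(dX, dy, dZ)` solves the symmetrized Newton system at `s` with centering parameter `σ` and
errors `(Ed, εp, Eμ)`. The third equation is written with matrices: with
`E = Z^{1/2} ⊗ Z^{1/2}` and `F = (Z^{1/2}X ⊗ Z^{-1/2} + Z^{-1/2} ⊗ Z^{1/2}X) / 2`, one has
`E vec(dX) = vec(Z^{1/2} dX Z^{1/2})` and
`F vec(dZ) = vec((Z^{-1/2} dZ X Z^{1/2} + Z^{1/2} X dZ Z^{-1/2}) / 2)`. -/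
def SDP.Newton (P : SDP m n) (ρ : ℝ) (y₀ : Fin m → ℝ) (s : State m n) (σ : ℝ)
    (Ed : Matrix (Fin n) (Fin n) ℝ) (εp : Fin m → ℝ) (Eμ : Matrix (Fin n) (Fin n) ℝ)
    (dX : Matrix (Fin n) (Fin n) ℝ) (dy : Fin m → ℝ) (dZ : Matrix (Fin n) (Fin n) ℝ) : Prop :=
  -(s.μ • dX) + P.adj dy + dZ =
    (P.C + (σ * s.μ / mu0 n ρ) • P.Cbar ρ y₀) - P.adj s.y - s.Z + (σ * s.μ) • (s.X - s.Ξ) + Ed ∧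
  P.op dX + s.μ • dy =
    -P.op s.X - (σ * s.μ) • (s.y - s.lam) + (P.b + (σ * s.μ / mu0 n ρ) • P.bbar ρ) + εp ∧
  CFC.sqrt s.Z * dX * CFC.sqrt s.Z +
      (1 / 2 : ℝ) • ((CFC.sqrt s.Z)⁻¹ * dZ * s.X * CFC.sqrt s.Z +
        CFC.sqrt s.Z * s.X * dZ * (CFC.sqrt s.Z)⁻¹) =
    -(CFC.sqrt s.Z * s.X * CFC.sqrt s.Z) + (σ * s.μ) • (1 : Matrix (Fin n) (Fin n) ℝ) + Eμ

/-- The accuracy conditions on the errors, at the barrier parameter `μ`. -/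
def SDP.Accurate (P : SDP m n) (par : Params) (ρ μ : ℝ)
    (Ed : Matrix (Fin n) (Fin n) ℝ) (εp : Fin m → ℝ) (Eμ : Matrix (Fin n) (Fin n) ℝ) : Prop :=
  fnorm Eμ = 0 ∧
  pnorm εp Ed ≤ par.σmin / (4 * mu0 n ρ) * par.KN * μ ∧
  P.snorm εp Ed ≤ par.σmin / (4 * mu0 n ρ) * par.γS * ρ * μ

/-- The step-lengths that are admissible at `s` along `(dX, dy, dZ)`. -/
def SDP.admissible (P : SDP m n) (par : Params) (ρ : ℝ) (y₀ : Fin m → ℝ) (s : State m n)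
    (dX : Matrix (Fin n) (Fin n) ℝ) (dy : Fin m → ℝ) (dZ : Matrix (Fin n) (Fin n) ℝ) : Set ℝ :=
  {α | 0 < α ∧ α ≤ 1 ∧
    mu (s.X + α • dX) (s.Z + α • dZ) ≤ (1 - 1 / 100 * α) * s.μ ∧
    P.Nbhd par ρ y₀ (mu (s.X + α • dX) (s.Z + α • dZ)) s.Ξ s.lam
      (s.X + α • dX) (s.y + α • dy) (s.Z + α • dZ)}

/-- The test that decides whether the proximal estimates are replaced by `(X, y)`. -/
def SDP.UpdateTest (P : SDP m n) (par : Params) (ρ : ℝ) (y₀ : Fin m → ℝ)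
    (X : Matrix (Fin n) (Fin n) ℝ) (y : Fin m → ℝ) (Z : Matrix (Fin n) (Fin n) ℝ) : Prop :=
  pnorm (P.op X - (P.b + (mu X Z / mu0 n ρ) • P.bbar ρ))
      ((P.C + (mu X Z / mu0 n ρ) • P.Cbar ρ y₀) - P.adj y - Z) ≤
    par.KN * (mu X Z / mu0 n ρ) ∧
  P.snorm (P.op X - (P.b + (mu X Z / mu0 n ρ) • P.bbar ρ))
      ((P.C + (mu X Z / mu0 n ρ) • P.Cbar ρ y₀) - P.adj y - Z) ≤
    par.γS * ρ * (mu X Z / mu0 n ρ)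

/-- One iteration of the method leads from `s` to `s'`: some `σ ∈ [σmin, σmax]` is chosen, the
Newton system is solved with the required accuracy, the largest admissible step is taken, and the
proximal estimates are updated. -/
def SDP.Step (P : SDP m n) (par : Params) (ρ : ℝ) (y₀ : Fin m → ℝ) (s s' : State m n) : Prop :=
  ∃ (σ α : ℝ) (Ed : Matrix (Fin n) (Fin n) ℝ) (εp : Fin m → ℝ) (Eμ : Matrix (Fin n) (Fin n) ℝ)
    (dX : Matrix (Fin n) (Fin n) ℝ) (dy : Fin m → ℝ) (dZ : Matrix (Fin n) (Fin n) ℝ),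
    par.σmin ≤ σ ∧ σ ≤ par.σmax ∧
    dX.IsSymm ∧ dZ.IsSymm ∧
    P.Newton ρ y₀ s σ Ed εp Eμ dX dy dZ ∧
    P.Accurate par ρ s.μ Ed εp Eμ ∧
    IsGreatest (P.admissible par ρ y₀ s dX dy dZ) α ∧
    s'.X = s.X + α • dX ∧ s'.y = s.y + α • dy ∧ s'.Z = s.Z + α • dZ ∧
    (P.UpdateTest par ρ y₀ s'.X s'.y s'.Z → s'.Ξ = s'.X ∧ s'.lam = s'.y) ∧
    (¬ P.UpdateTest par ρ y₀ s'.X s'.y s'.Z → s'.Ξ = s.Ξ ∧ s'.lam = s.lam)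

/-- `w 0, w 1, …` are the iterates of a run of the method that performs `N` iterations, where
`N = ⊤` means that the run goes on forever. The stopping test of the method only decides the
value of `N`, which is arbitrary here; the values `w k` with `k > N` carry no information. -/
def SDP.IsRun (P : SDP m n) (par : Params) (ρ : ℝ) (y₀ : Fin m → ℝ) (N : ℕ∞)
    (w : ℕ → State m n) : Prop :=
  w 0 = start n ρ y₀ ∧ ∀ k : ℕ, (k : ℕ∞) < N → P.Step par ρ y₀ (w k) (w (k + 1))

end IPPMM

end

/-! Write `θ = μ/μ₀`. One iteration multiplies `μ` by at most `1 - κ/(100 n⁴)` for a constant `κ >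
0` (`exists_step_decrease`), so `O(n⁴ (log (1/ε) + |log μ₀|))` iterations suffice; since `ε ≤ ε₀ <
1`, the term in `μ₀ = ρ²` is absorbed into the constant. The step-length taken is the largest
admissible one, so it is enough that `κ/n⁴` be admissible (`exists_admissible`).

Let `A = Z^{1/2} dX Z^{1/2}` and `D = Z^{-1/2} dZ Z^{-1/2}`. To first order in the step-length `α`
the Newton equations pull the point towards the central path and shrink the residuals; what they
miss is of order `α²`. With `‖A‖ = O(n² μ)` and `‖D‖ = O(n²)` (`exists_newton_bound`) the missed
terms are `O(α² n⁴ μ)`, while the available slack is of order `α σ μ`. This is the origin of `n⁴`.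

The bounds rest on one monotonicity inequality, `ip_sub_sub_ge`: because of the proximal terms, two
solutions of the regularized linear equations have differences whose pairing is bounded below by
`μ/2` times a squared distance, minus a term measuring how far the second one is from the proximal
estimate. It is used twice. For points, an iterate is compared with a convex combination, of weights
`1 - θ` and `θ`, of an optimal triple and a perturbed starting point. Complementarity `⟨X*, Z*⟩ = 0`
makes the pairing of the two matrices of that combination `O(θ n)`, and `γ_S < 1` keeps the
perturbed starting matrices above a positive multiple of the identity. Hence iterates are `O(n)`,
traces `O(n²)`, and `⟨X*, Z⟩ + ⟨X, Z*⟩ = O(n² μ)` (`exists_iterate_bound`). For directions, the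
Newton direction is compared with `1 - σ` times the displacement towards the optimal triple, plus a
small correction. Near the central path the third Newton equation controls `A + μ D` up to a
relative error `γ_μ < 1`, and almost nonnegativity of the pairing separates the two summands.

These constants do not grow along the run: a new proximal estimate lies in its own neighbourhood,
where the proximal terms vanish, so its bound does not involve the previous estimate
(`exists_proximal_bound`). Complementarity comes from strong duality under Slater's condition,
proved by separating convex sets. -/

namespace IPPMM

variable {m n : ℕ}

/-! ### Norms of vectors and matrices -/

section Norms

open scoped Matrix.Norms.Frobenius in
theorem fnorm_eq_norm (R : Matrix (Fin n) (Fin n) ℝ) : fnorm R = ‖R‖ := by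
  rw [Matrix.frobenius_norm_def, fnorm, Real.sqrt_eq_rpow]
  simp

theorem fnorm_nonneg (R : Matrix (Fin n) (Fin n) ℝ) : 0 ≤ fnorm R := Real.sqrt_nonneg _

open scoped Matrix.Norms.Frobenius in
theorem fnorm_add_le (R S : Matrix (Fin n) (Fin n) ℝ) : fnorm (R + S) ≤ fnorm R + fnorm S := by
  simpa only [fnorm_eq_norm] using norm_add_le R S

open scoped Matrix.Norms.Frobenius in
theorem fnorm_sub_le (R S : Matrix (Fin n) (Fin n) ℝ) : fnorm (R - S) ≤ fnorm R + fnorm S := by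
  simpa only [fnorm_eq_norm] using norm_sub_le R S

open scoped Matrix.Norms.Frobenius in
theorem fnorm_neg (R : Matrix (Fin n) (Fin n) ℝ) : fnorm (-R) = fnorm R := by
  simpa only [fnorm_eq_norm] using norm_neg R

open scoped Matrix.Norms.Frobenius in
theorem fnorm_smul (t : ℝ) (R : Matrix (Fin n) (Fin n) ℝ) : fnorm (t • R) = |t| * fnorm R := by
  simpa only [fnorm_eq_norm] using! norm_smul t R

theorem fnorm_smul_of_nonneg {t : ℝ} (ht : 0 ≤ t) (R : Matrix (Fin n) (Fin n) ℝ) :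
    fnorm (t • R) = t * fnorm R := by
  rw [fnorm_smul, abs_of_nonneg ht]

open scoped Matrix.Norms.Frobenius in
theorem fnorm_mul_le (R S : Matrix (Fin n) (Fin n) ℝ) : fnorm (R * S) ≤ fnorm R * fnorm S := by
  simpa only [fnorm_eq_norm] using Matrix.frobenius_norm_mul R S

open scoped Matrix.Norms.Frobenius in
theorem fnorm_transpose (R : Matrix (Fin n) (Fin n) ℝ) : fnorm Rᵀ = fnorm R := by
  simpa only [fnorm_eq_norm] using Matrix.frobenius_norm_transpose R

open scoped Matrix.Norms.Frobenius in
theorem fnorm_eq_zero {R : Matrix (Fin n) (Fin n) ℝ} : fnorm R = 0 ↔ R = 0 := by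
  simpa only [fnorm_eq_norm] using norm_eq_zero (a := R)

theorem fnorm_sq (R : Matrix (Fin n) (Fin n) ℝ) : fnorm R ^ 2 = (Rᵀ * R).trace := by
  rw [fnorm, Real.sq_sqrt (by positivity), Matrix.trace, Finset.sum_comm]
  simp [Matrix.mul_apply, sq]

theorem fnorm_one : fnorm (1 : Matrix (Fin n) (Fin n) ℝ) = √(n : ℝ) := by
  rw [← Real.sqrt_sq (fnorm_nonneg _), fnorm_sq]
  simp

theorem vnorm_eq_norm (r : Fin m → ℝ) : vnorm r = ‖WithLp.toLp 2 r‖ := by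
  rw [vnorm, EuclideanSpace.norm_eq]
  simp

theorem vnorm_nonneg (r : Fin m → ℝ) : 0 ≤ vnorm r := Real.sqrt_nonneg _

theorem vnorm_add_le (r s : Fin m → ℝ) : vnorm (r + s) ≤ vnorm r + vnorm s := by
  simpa only [vnorm_eq_norm, WithLp.toLp_add] using norm_add_le (WithLp.toLp 2 r) (WithLp.toLp 2 s)

theorem vnorm_sub_le (r s : Fin m → ℝ) : vnorm (r - s) ≤ vnorm r + vnorm s := by
  simpa only [vnorm_eq_norm, WithLp.toLp_sub] using norm_sub_le (WithLp.toLp 2 r) (WithLp.toLp 2 s)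

theorem vnorm_smul (t : ℝ) (r : Fin m → ℝ) : vnorm (t • r) = |t| * vnorm r := by
  simpa only [vnorm_eq_norm, WithLp.toLp_smul] using! norm_smul t (WithLp.toLp 2 r)

theorem vnorm_smul_of_nonneg {t : ℝ} (ht : 0 ≤ t) (r : Fin m → ℝ) :
    vnorm (t • r) = t * vnorm r := by
  rw [vnorm_smul, abs_of_nonneg ht]

theorem vnorm_eq_zero {r : Fin m → ℝ} : vnorm r = 0 ↔ r = 0 := by
  rw [vnorm_eq_norm, norm_eq_zero, WithLp.toLp_eq_zero]

theorem dotProduct_self_eq_vnorm_sq (r : Fin m → ℝ) : r ⬝ᵥ r = vnorm r ^ 2 := by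
  rw [vnorm, Real.sq_sqrt (by positivity)]
  simp [dotProduct, sq]

theorem abs_dotProduct_le (r s : Fin m → ℝ) : |r ⬝ᵥ s| ≤ vnorm r * vnorm s := by
  rw [vnorm, vnorm, ← Real.sqrt_mul (by positivity)]
  exact Real.abs_le_sqrt (Finset.sum_mul_sq_le_sq_mul_sq _ _ _)

/-- The triangle inequality for the Euclidean combination of two norms. -/
theorem sqrt_sq_add_sq_triangle {a b c d e f : ℝ} (ha : 0 ≤ a) (hb : 0 ≤ b) (hac : a ≤ c + e)
    (hbd : b ≤ d + f) : √(a ^ 2 + b ^ 2) ≤ √(c ^ 2 + d ^ 2) + √(e ^ 2 + f ^ 2) := by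
  have h1 : √(a ^ 2 + b ^ 2) ≤ √((c + e) ^ 2 + (d + f) ^ 2) :=
    Real.sqrt_le_sqrt (by gcongr)
  refine h1.trans ?_
  have h := norm_add_le (!₂[c, d] : EuclideanSpace ℝ (Fin 2)) !₂[e, f]
  simpa [EuclideanSpace.norm_eq] using h

theorem pnorm_add_le (r s : Fin m → ℝ) (R S : Matrix (Fin n) (Fin n) ℝ) :
    pnorm (r + s) (R + S) ≤ pnorm r R + pnorm s S :=
  sqrt_sq_add_sq_triangle (vnorm_nonneg _) (fnorm_nonneg _) (vnorm_add_le _ _) (fnorm_add_le _ _)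

theorem pnorm_smul (t : ℝ) (r : Fin m → ℝ) (R : Matrix (Fin n) (Fin n) ℝ) :
    pnorm (t • r) (t • R) = |t| * pnorm r R := by
  rw [pnorm, pnorm, vnorm_smul, fnorm_smul, mul_pow, mul_pow, ← mul_add, Real.sqrt_mul (by positivity),
    Real.sqrt_sq (abs_nonneg t)]

theorem pnorm_neg_right (r : Fin m → ℝ) (R : Matrix (Fin n) (Fin n) ℝ) :
    pnorm r (-R) = pnorm r R := by
  rw [pnorm, pnorm, fnorm_neg]

theorem vnorm_le_pnorm (r : Fin m → ℝ) (R : Matrix (Fin n) (Fin n) ℝ) : vnorm r ≤ pnorm r R :=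
  Real.le_sqrt_of_sq_le (by nlinarith [sq_nonneg (fnorm R)])

theorem fnorm_le_pnorm (r : Fin m → ℝ) (R : Matrix (Fin n) (Fin n) ℝ) : fnorm R ≤ pnorm r R :=
  Real.le_sqrt_of_sq_le (by nlinarith [sq_nonneg (vnorm r)])

theorem sqrt_sq_add_sq_le {a b : ℝ} (ha : 0 ≤ a) (hb : 0 ≤ b) : √(a ^ 2 + b ^ 2) ≤ a + b :=
  Real.sqrt_le_iff.2 ⟨by positivity, by nlinarith⟩

theorem pnorm_le_add (r : Fin m → ℝ) (R : Matrix (Fin n) (Fin n) ℝ) :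
    pnorm r R ≤ vnorm r + fnorm R :=
  sqrt_sq_add_sq_le (vnorm_nonneg r) (fnorm_nonneg R)

end Norms

/-! ### The trace pairing -/

section Trace

/-- The pairing `⟨X, Y⟩ = Tr (X Y)`. -/
def ip (X Y : Matrix (Fin n) (Fin n) ℝ) : ℝ := (X * Y).trace

theorem ip_comm (X Y : Matrix (Fin n) (Fin n) ℝ) : ip X Y = ip Y X := Matrix.trace_mul_comm _ _

theorem ip_add_left (X Y W : Matrix (Fin n) (Fin n) ℝ) : ip (X + Y) W = ip X W + ip Y W := by
  simp [ip, add_mul]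

theorem ip_add_right (X Y W : Matrix (Fin n) (Fin n) ℝ) : ip W (X + Y) = ip W X + ip W Y := by
  simp [ip, mul_add]

theorem ip_sub_left (X Y W : Matrix (Fin n) (Fin n) ℝ) : ip (X - Y) W = ip X W - ip Y W := by
  simp [ip, sub_mul]

theorem ip_sub_right (X Y W : Matrix (Fin n) (Fin n) ℝ) : ip W (X - Y) = ip W X - ip W Y := by
  simp [ip, mul_sub]

theorem ip_smul_left (t : ℝ) (X Y : Matrix (Fin n) (Fin n) ℝ) : ip (t • X) Y = t * ip X Y := by
  simp [ip]

theorem ip_smul_right (t : ℝ) (X Y : Matrix (Fin n) (Fin n) ℝ) : ip X (t • Y) = t * ip X Y := by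
  simp [ip]

theorem ip_one_left (X : Matrix (Fin n) (Fin n) ℝ) : ip 1 X = X.trace := by
  simp [ip]

theorem ip_one_right (X : Matrix (Fin n) (Fin n) ℝ) : ip X 1 = X.trace := by
  simp [ip]

theorem ip_transpose_left {X Y : Matrix (Fin n) (Fin n) ℝ} (hY : Y.IsSymm) :
    ip Xᵀ Y = ip X Y := by
  rw [ip, ← Matrix.trace_transpose, Matrix.transpose_mul, Matrix.transpose_transpose, hY.eq]
  exact ip_comm _ _

theorem ip_self {X : Matrix (Fin n) (Fin n) ℝ} (hX : X.IsSymm) : ip X X = fnorm X ^ 2 := by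
  rw [fnorm_sq, hX.eq, ip]

theorem abs_ip_le (X Y : Matrix (Fin n) (Fin n) ℝ) : |ip X Y| ≤ fnorm X * fnorm Y := by
  rw [← fnorm_transpose Y, fnorm, fnorm, ← Real.sqrt_mul (by positivity)]
  refine Real.abs_le_sqrt ?_
  have h : ip X Y = ∑ p : Fin n × Fin n, X p.1 p.2 * Yᵀ p.1 p.2 := by
    simp [ip, Matrix.trace, Matrix.mul_apply, Fintype.sum_prod_type]
  rw [h]
  simpa [Fintype.sum_prod_type] using
    Finset.sum_mul_sq_le_sq_mul_sq Finset.univ (fun p : Fin n × Fin n => X p.1 p.2)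
      (fun p => Yᵀ p.1 p.2)

theorem ip_le (X Y : Matrix (Fin n) (Fin n) ℝ) : ip X Y ≤ fnorm X * fnorm Y :=
  (le_abs_self _).trans (abs_ip_le X Y)

theorem neg_le_ip (X Y : Matrix (Fin n) (Fin n) ℝ) : -(fnorm X * fnorm Y) ≤ ip X Y :=
  (abs_le.1 (abs_ip_le X Y)).1

theorem isSymm_of_posSemidef {X : Matrix (Fin n) (Fin n) ℝ} (hX : X.PosSemidef) : X.IsSymm := by
  have := hX.isHermitian.eq
  rwa [Matrix.conjTranspose_eq_transpose_of_trivial] at this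

theorem isSymm_of_posDef {X : Matrix (Fin n) (Fin n) ℝ} (hX : X.PosDef) : X.IsSymm :=
  isSymm_of_posSemidef hX.posSemidef

theorem exists_transpose_mul_self_of_posSemidef {X : Matrix (Fin n) (Fin n) ℝ}
    (hX : X.PosSemidef) : ∃ B : Matrix (Fin n) (Fin n) ℝ, X = Bᵀ * B := by
  refine ⟨CFC.sqrt X, ?_⟩
  have h := isSymm_of_posSemidef (Matrix.nonneg_iff_posSemidef.1 (CFC.sqrt_nonneg X))
  rw [h.eq, CFC.sqrt_mul_sqrt_self X hX.nonneg]

theorem ip_nonneg {X Y : Matrix (Fin n) (Fin n) ℝ} (hX : X.PosSemidef) (hY : Y.PosSemidef) :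
    0 ≤ ip X Y := by
  obtain ⟨B, rfl⟩ := exists_transpose_mul_self_of_posSemidef hX
  have h : ip (Bᵀ * B) Y = (B * Y * Bᴴ).trace := by
    rw [ip, Matrix.mul_assoc, Matrix.trace_mul_comm, Matrix.conjTranspose_eq_transpose_of_trivial]
  rw [h]
  exact (hY.mul_mul_conjTranspose_same B).trace_nonneg

/-- Submultiplicativity applied to `X = Bᵀ B`, since the trace of `Bᵀ B` is the squared norm of `B`.
-/
theorem fnorm_le_trace {X : Matrix (Fin n) (Fin n) ℝ} (hX : X.PosSemidef) :
    fnorm X ≤ X.trace := by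
  obtain ⟨B, rfl⟩ := exists_transpose_mul_self_of_posSemidef hX
  calc fnorm (Bᵀ * B) ≤ fnorm Bᵀ * fnorm B := fnorm_mul_le _ _
    _ = (Bᵀ * B).trace := by rw [fnorm_transpose, ← fnorm_sq, sq]

theorem dotProduct_mulVec_le (M : Matrix (Fin n) (Fin n) ℝ) (x : Fin n → ℝ) :
    |x ⬝ᵥ M *ᵥ x| ≤ fnorm M * vnorm x ^ 2 := by
  have h : x ⬝ᵥ M *ᵥ x = ip M (Matrix.vecMulVec x x) := by
    rw [ip, Matrix.mul_vecMulVec, Matrix.trace_vecMulVec, dotProduct_comm]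
  have h2 : fnorm (Matrix.vecMulVec x x) = vnorm x ^ 2 := by
    rw [← Real.sqrt_sq (fnorm_nonneg _), fnorm_sq, Matrix.transpose_vecMulVec,
      Matrix.vecMulVec_mul_vecMulVec, Matrix.trace_vecMulVec, dotProduct_smul,
      dotProduct_self_eq_vnorm_sq, smul_eq_mul, ← sq, Real.sqrt_sq (by positivity)]
  rw [h, ← h2]
  exact abs_ip_le _ _

/-- A symmetric matrix within Frobenius distance `t` of `μ I` dominates `(μ - t) I`. -/
theorem posSemidef_sub_smul_one {M : Matrix (Fin n) (Fin n) ℝ} (hM : M.IsSymm) {μ t : ℝ}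
    (h : fnorm (M - μ • (1 : Matrix (Fin n) (Fin n) ℝ)) ≤ t) :
    (M - (μ - t) • (1 : Matrix (Fin n) (Fin n) ℝ)).PosSemidef := by
  refine Matrix.PosSemidef.of_dotProduct_mulVec_nonneg ?_ fun x => ?_
  · rw [Matrix.IsHermitian, Matrix.conjTranspose_eq_transpose_of_trivial]
    simp [hM.eq]
  · have h1 := (abs_le.1 (dotProduct_mulVec_le (M - μ • (1 : Matrix (Fin n) (Fin n) ℝ)) x)).1
    have h2 : M - (μ - t) • (1 : Matrix (Fin n) (Fin n) ℝ) =
        (M - μ • (1 : Matrix (Fin n) (Fin n) ℝ)) + t • (1 : Matrix (Fin n) (Fin n) ℝ) := by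
      module
    rw [h2, Matrix.add_mulVec, Matrix.smul_mulVec, Matrix.one_mulVec, dotProduct_add,
      dotProduct_smul, star_trivial, dotProduct_self_eq_vnorm_sq, smul_eq_mul]
    nlinarith [sq_nonneg (vnorm x)]

theorem posDef_of_fnorm_sub_lt {M : Matrix (Fin n) (Fin n) ℝ} (hM : M.IsSymm) {μ : ℝ}
    (h : fnorm (M - μ • (1 : Matrix (Fin n) (Fin n) ℝ)) < μ) : M.PosDef := by
  set t := fnorm (M - μ • (1 : Matrix (Fin n) (Fin n) ℝ))
  have h1 := posSemidef_sub_smul_one hM (le_refl t)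
  have h2 : ((μ - t) • (1 : Matrix (Fin n) (Fin n) ℝ)).PosDef :=
    Matrix.PosDef.one.smul (sub_pos.2 h)
  simpa using Matrix.PosDef.posSemidef_add h1 h2

end Trace

/-! ### Square roots of positive definite matrices -/

section Sqrt

variable {Z : Matrix (Fin n) (Fin n) ℝ}

theorem sqrt_mul_sqrt (hZ : Z.PosDef) : CFC.sqrt Z * CFC.sqrt Z = Z :=
  CFC.sqrt_mul_sqrt_self Z hZ.posSemidef.nonneg

theorem isSymm_sqrt (Z : Matrix (Fin n) (Fin n) ℝ) : (CFC.sqrt Z).IsSymm :=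
  isSymm_of_posSemidef (Matrix.nonneg_iff_posSemidef.1 (CFC.sqrt_nonneg Z))

theorem isUnit_det_sqrt (hZ : Z.PosDef) : IsUnit (CFC.sqrt Z).det := by
  have h : (CFC.sqrt Z).det * (CFC.sqrt Z).det = Z.det := by
    rw [← Matrix.det_mul, sqrt_mul_sqrt hZ]
  rw [isUnit_iff_ne_zero]
  intro h0
  rw [h0, zero_mul] at h
  exact hZ.det_pos.ne h

end Sqrt

/-! ### Singular values -/

section SingularValues

open Module

variable {E F : Type*} [NormedAddCommGroup E] [InnerProductSpace ℝ E] [FiniteDimensional ℝ E]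
  [NormedAddCommGroup F] [InnerProductSpace ℝ F] [FiniteDimensional ℝ F]

/-- Bounds on the nonzero singular values of `T` bound the adjoint of `T` on the range of `T`. -/
theorem norm_adjoint_bounds (T : E →ₗ[ℝ] F) {a b : ℝ} (ha : 0 ≤ a) (hb : 0 ≤ b)
    (h : ∀ i < finrank ℝ T.range, a ≤ T.singularValues i ∧ T.singularValues i ≤ b) (x : E) :
    a * ‖T x‖ ≤ ‖T.adjoint (T x)‖ ∧ ‖T.adjoint (T x)‖ ≤ b * ‖T x‖ := by
  -- In an eigenbasis of `T* T` with eigenvalues `l i`, the squared norms of `T* T x` and `T x` are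
  -- `∑ l i² x i²` and `∑ l i x i²`, so a termwise comparison is enough.
  set S := T.isSymmetric_adjoint_comp_self
  set e := S.eigenvectorBasis rfl
  set l := S.eigenvalues rfl
  have hl (i) : l i = T.singularValues i ^ 2 := (T.sq_singularValues_fin rfl i).symm
  have hrep (i) : e.repr ((T.adjoint ∘ₗ T) x) i = l i * e.repr x i :=
    S.eigenvectorBasis_apply_self_apply rfl x i
  have h1 : ‖T.adjoint (T x)‖ ^ 2 = ∑ i, l i ^ 2 * (e.repr x i) ^ 2 := by
    rw [← e.repr.norm_map, EuclideanSpace.norm_sq_eq]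
    refine Finset.sum_congr rfl fun i _ => ?_
    have := hrep i
    rw [LinearMap.comp_apply] at this
    rw [this, Real.norm_eq_abs, sq_abs, mul_pow]
  have h2 : ‖T x‖ ^ 2 = ∑ i, l i * (e.repr x i) ^ 2 := by
    rw [← real_inner_self_eq_norm_sq, ← LinearMap.adjoint_inner_right,
      ← e.repr.inner_map_map, PiLp.inner_apply]
    refine Finset.sum_congr rfl fun i _ => ?_
    have := hrep i
    rw [LinearMap.comp_apply] at this
    rw [this]
    simp
    ring
  -- Indices beyond the rank satisfy no lower bound, but there `l i = 0` and both inequalities are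
  -- trivial.
  have h3 (i) : a ^ 2 * l i ≤ l i ^ 2 ∧ l i ^ 2 ≤ b ^ 2 * l i := by
    by_cases hi : (i : ℕ) < finrank ℝ T.range
    · have h0 : 0 ≤ l i := by rw [hl]; positivity
      have h4 : a ^ 2 ≤ l i := by rw [hl]; gcongr; exact (h i hi).1
      have h5 : l i ≤ b ^ 2 := by
        rw [hl]; exact pow_le_pow_left₀ (T.singularValues_nonneg i) (h i hi).2 2
      constructor <;> nlinarith
    · have h0 : l i = 0 := by
        rw [hl, T.singularValues_eq_zero_iff_le_finrank_range.2 (not_lt.1 hi)]; simp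
      simp [h0]
  constructor
  · refine le_of_sq_le_sq ?_ (norm_nonneg _)
    rw [mul_pow, h1, h2, Finset.mul_sum]
    refine Finset.sum_le_sum fun i _ => ?_
    nlinarith [(h3 i).1, sq_nonneg (e.repr x i)]
  · refine le_of_sq_le_sq ?_ (by positivity)
    rw [mul_pow, h1, h2, Finset.mul_sum]
    refine Finset.sum_le_sum fun i _ => ?_
    nlinarith [(h3 i).2, sq_nonneg (e.repr x i)]

end SingularValues

/-! ### The constraint operator and its adjoint -/

section Operator

variable (P : SDP m n)

theorem op_add (X Y : Matrix (Fin n) (Fin n) ℝ) : P.op (X + Y) = P.op X + P.op Y := by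
  ext i; simp [SDP.op, mul_add]

theorem op_smul (t : ℝ) (X : Matrix (Fin n) (Fin n) ℝ) : P.op (t • X) = t • P.op X := by
  ext i; simp [SDP.op]

theorem op_sub (X Y : Matrix (Fin n) (Fin n) ℝ) : P.op (X - Y) = P.op X - P.op Y := by
  ext i; simp [SDP.op, mul_sub]

theorem adj_add (y z : Fin m → ℝ) : P.adj (y + z) = P.adj y + P.adj z := by
  simp [SDP.adj, add_smul, Finset.sum_add_distrib]

theorem adj_smul (t : ℝ) (y : Fin m → ℝ) : P.adj (t • y) = t • P.adj y := by
  simp [SDP.adj, Finset.smul_sum, mul_smul]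

theorem adj_neg (y : Fin m → ℝ) : P.adj (-y) = -P.adj y := by
  simp [SDP.adj]

theorem adj_sub (y z : Fin m → ℝ) : P.adj (y - z) = P.adj y - P.adj z := by
  simp [SDP.adj, sub_smul]

theorem adj_zero : P.adj 0 = 0 := by
  simp [SDP.adj]

theorem isSymm_adj (y : Fin m → ℝ) : (P.adj y).IsSymm := by
  simp only [Matrix.IsSymm, SDP.adj, Matrix.transpose_sum, Matrix.transpose_smul, (P.A_symm _).eq]

theorem dotProduct_op (y : Fin m → ℝ) (X : Matrix (Fin n) (Fin n) ℝ) :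
    y ⬝ᵥ P.op X = ip (P.adj y) X := by
  simp [dotProduct, SDP.op, ip, SDP.adj, Finset.sum_mul, Matrix.trace_sum]

theorem op_transpose (X : Matrix (Fin n) (Fin n) ℝ) : P.op Xᵀ = P.op X := by
  ext i
  have := ip_transpose_left (X := X) (P.A_symm i)
  rw [ip_comm, ip_comm X] at this
  exact this

/-- The bounds `K₁ ‖y‖ ≤ ‖𝒜* y‖ ≤ K₂ ‖y‖`. -/
structure AdjBounds (K₁ K₂ : ℝ) : Prop where
  pos : 0 < K₁
  le : 0 ≤ K₂
  lower : ∀ y, K₁ * vnorm y ≤ fnorm (P.adj y)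
  upper : ∀ y, fnorm (P.adj y) ≤ K₂ * vnorm y

variable {P}

/-- Full row rank makes the constraint matrix surjective, so bounds for its adjoint on its range are
bounds for every `y`. -/
theorem adjBounds_of_assumption2 {KA1 KA2 Kr1 Kr2 : ℝ} (h1 : 0 < KA1) (h2 : 0 < KA2)
    (h : P.Assumption2 KA1 KA2 Kr1 Kr2) : AdjBounds P KA1 KA2 := by
  set T := Matrix.toEuclideanLin P.mat with hT
  have hrank : Module.finrank ℝ T.range = m := by
    refine Eq.trans ?_ h.1
    rw [Matrix.rank_eq_finrank_range_toLin P.mat (EuclideanSpace.basisFun _ ℝ).toBasis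
      (EuclideanSpace.basisFun _ ℝ).toBasis, hT, Matrix.toEuclideanLin_eq_toLin_orthonormal]
  have hsurj : T.range = ⊤ := by
    refine Submodule.eq_top_of_finrank_eq ?_
    rw [hrank, finrank_euclideanSpace_fin]
  have hadj (y : Fin m → ℝ) : ‖T.adjoint (WithLp.toLp 2 y)‖ = fnorm (P.adj y) := by
    rw [hT, ← Matrix.toEuclideanLin_conjTranspose_eq_adjoint, EuclideanSpace.norm_eq, fnorm]
    congr 1
    -- `Matrix.vec` stacks columns, so its index pair is transposed.
    rw [Fintype.sum_prod_type, Finset.sum_comm]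
    refine Finset.sum_congr rfl fun i _ => Finset.sum_congr rfl fun j _ => ?_
    rw [Real.norm_eq_abs, sq_abs]
    congr 1
    simp [SDP.adj, SDP.mat, Matrix.mulVec, dotProduct, Matrix.vec, Matrix.sum_apply, mul_comm]
  have key (y : Fin m → ℝ) : KA1 * vnorm y ≤ fnorm (P.adj y) ∧ fnorm (P.adj y) ≤ KA2 * vnorm y := by
    have hy : WithLp.toLp 2 y ∈ T.range := hsurj ▸ Submodule.mem_top
    obtain ⟨x, hx⟩ := hy
    have := norm_adjoint_bounds T h1.le h2.le (by rw [hrank]; exact h.2.1) x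
    rwa [hx, hadj, ← vnorm_eq_norm] at this
  exact ⟨h1, h2.le, fun y => (key y).1, fun y => (key y).2⟩

variable {K₁ K₂ : ℝ}

theorem AdjBounds.vnorm_le (h : AdjBounds P K₁ K₂) (y : Fin m → ℝ) :
    vnorm y ≤ fnorm (P.adj y) / K₁ := by
  rw [le_div_iff₀ h.pos, mul_comm]; exact h.lower y

theorem AdjBounds.vnorm_op_le (h : AdjBounds P K₁ K₂) (X : Matrix (Fin n) (Fin n) ℝ) :
    vnorm (P.op X) ≤ K₂ * fnorm X := by
  have h1 : vnorm (P.op X) ^ 2 ≤ K₂ * vnorm (P.op X) * fnorm X := by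
    rw [← dotProduct_self_eq_vnorm_sq, dotProduct_op]
    refine (ip_le _ _).trans ?_
    have := h.upper (P.op X)
    have := fnorm_nonneg X
    gcongr
  rcases (vnorm_nonneg (P.op X)).eq_or_lt with h0 | h0
  · rw [← h0]; have := h.le; have := fnorm_nonneg X; positivity
  · exact le_of_mul_le_mul_left (by nlinarith) h0

/-- The least-norm solution has the form `𝒜* z`. The lower bound on `𝒜*` makes `𝒜 𝒜*` injective,
hence bijective, and `‖𝒜* z‖² = z ⬝ r ≤ ‖𝒜* z‖ ‖r‖ / K₁`. -/
theorem AdjBounds.exists_op_eq (h : AdjBounds P K₁ K₂) (r : Fin m → ℝ) :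
    ∃ X : Matrix (Fin n) (Fin n) ℝ, P.op X = r ∧ fnorm X ≤ vnorm r / K₁ := by
  let L : (Fin m → ℝ) →ₗ[ℝ] (Fin m → ℝ) :=
    { toFun := fun z => P.op (P.adj z)
      map_add' := fun z w => by rw [adj_add, op_add]
      map_smul' := fun t z => by rw [adj_smul, op_smul]; rfl }
  have hsq (z) : z ⬝ᵥ L z = fnorm (P.adj z) ^ 2 := by
    rw [← ip_self (isSymm_adj P z), ← dotProduct_op]; rfl
  have hinj : Function.Injective L := by
    rw [← LinearMap.ker_eq_bot, LinearMap.ker_eq_bot']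
    intro z hz
    have h1 := hsq z
    rw [hz, dotProduct_zero] at h1
    have h2 := h.lower z
    rw [pow_eq_zero_iff two_ne_zero |>.1 h1.symm] at h2
    have h3 := h.pos
    refine vnorm_eq_zero.1 (le_antisymm ?_ (vnorm_nonneg z))
    by_contra! h4
    nlinarith [mul_pos h3 h4]
  obtain ⟨z, hz⟩ := LinearMap.injective_iff_surjective.1 hinj r
  refine ⟨P.adj z, hz, ?_⟩
  have h1 := hsq z
  rw [hz] at h1
  have h2 := (le_abs_self _).trans (abs_dotProduct_le z r)
  have h3 := h.vnorm_le z
  have h4 := vnorm_nonneg r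
  have h5 : fnorm (P.adj z) ^ 2 ≤ fnorm (P.adj z) * (vnorm r / K₁) := by
    rw [← h1]
    refine h2.trans ((mul_le_mul_of_nonneg_right h3 h4).trans (le_of_eq ?_))
    ring
  rcases (fnorm_nonneg (P.adj z)).eq_or_lt with h0 | h0
  · rw [← h0]; have := h.pos; positivity
  · exact le_of_mul_le_mul_left (by nlinarith) h0

end Operator

/-! ### The semi-norm `‖·‖_S` -/

section SNorm

variable {P : SDP m n} {K₁ K₂ : ℝ}

theorem snorm_le_of_witness {r : Fin m → ℝ} {R X Z : Matrix (Fin n) (Fin n) ℝ} {y : Fin m → ℝ}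
    (hX : P.op X = r) (hZ : P.adj y + Z = R) :
    P.snorm r R ≤ √(fnorm X ^ 2 + fnorm Z ^ 2) :=
  csInf_le ⟨0, by rintro _ ⟨_, _, _, _, _, rfl⟩; positivity⟩ ⟨X, y, Z, hX, hZ, rfl⟩

/-- Surjectivity of `𝒜` matters here: it excludes the empty set, whose `sInf` is the default value
`0`. The strict inequality avoids proving that the infimum is attained. -/
theorem AdjBounds.exists_of_snorm_lt (h : AdjBounds P K₁ K₂) {r : Fin m → ℝ}
    {R : Matrix (Fin n) (Fin n) ℝ} {s : ℝ} (hs : P.snorm r R < s) :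
    ∃ (X : Matrix (Fin n) (Fin n) ℝ) (y : Fin m → ℝ) (Z : Matrix (Fin n) (Fin n) ℝ),
      P.op X = r ∧ P.adj y + Z = R ∧ √(fnorm X ^ 2 + fnorm Z ^ 2) < s := by
  obtain ⟨X, hX, -⟩ := h.exists_op_eq r
  obtain ⟨_, ⟨X, y, Z, hX, hZ, rfl⟩, hlt⟩ :=
    exists_lt_of_csInf_lt (by exact ⟨_, X, 0, R, hX, by rw [adj_zero, zero_add], rfl⟩) hs
  exact ⟨X, y, Z, hX, hZ, hlt⟩

theorem AdjBounds.snorm_add_le (h : AdjBounds P K₁ K₂) (r s : Fin m → ℝ)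
    (R S : Matrix (Fin n) (Fin n) ℝ) :
    P.snorm (r + s) (R + S) ≤ P.snorm r R + P.snorm s S := by
  refine le_of_forall_pos_le_add fun ε hε => ?_
  obtain ⟨X, y, Z, h1, h2, h3⟩ := h.exists_of_snorm_lt (lt_add_of_pos_right (P.snorm r R) (half_pos hε))
  obtain ⟨X', y', Z', h1', h2', h3'⟩ :=
    h.exists_of_snorm_lt (lt_add_of_pos_right (P.snorm s S) (half_pos hε))
  have hw : P.snorm (r + s) (R + S) ≤ √(fnorm (X + X') ^ 2 + fnorm (Z + Z') ^ 2) := by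
    refine snorm_le_of_witness (y := y + y') ?_ ?_
    · rw [op_add, h1, h1']
    · rw [adj_add, ← h2, ← h2']; abel
  have := sqrt_sq_add_sq_triangle (fnorm_nonneg _) (fnorm_nonneg _) (fnorm_add_le X X')
    (fnorm_add_le Z Z')
  linarith

theorem AdjBounds.snorm_smul_le (h : AdjBounds P K₁ K₂) {t : ℝ} (ht : 0 ≤ t) (r : Fin m → ℝ)
    (R : Matrix (Fin n) (Fin n) ℝ) : P.snorm (t • r) (t • R) ≤ t * P.snorm r R := by
  refine le_of_forall_pos_le_add fun ε hε => ?_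
  -- The `+ 1` covers `t = 0`.
  have hd : 0 < ε / (t + 1) := by positivity
  obtain ⟨X, y, Z, h1, h2, h3⟩ := h.exists_of_snorm_lt (lt_add_of_pos_right (P.snorm r R) hd)
  have hw : P.snorm (t • r) (t • R) ≤ √(fnorm (t • X) ^ 2 + fnorm (t • Z) ^ 2) := by
    refine snorm_le_of_witness (y := t • y) ?_ ?_
    · rw [op_smul, h1]
    · rw [adj_smul, ← h2, smul_add]
  rw [fnorm_smul_of_nonneg ht, fnorm_smul_of_nonneg ht, mul_pow, mul_pow, ← mul_add,
    Real.sqrt_mul (by positivity), Real.sqrt_sq ht] at hw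
  have h4 : t * (ε / (t + 1)) ≤ ε := by
    rw [mul_div_assoc', div_le_iff₀ (by positivity)]; nlinarith
  nlinarith [mul_le_mul_of_nonneg_left h3.le ht]

theorem AdjBounds.snorm_neg_right_le (h : AdjBounds P K₁ K₂) (r : Fin m → ℝ)
    (R : Matrix (Fin n) (Fin n) ℝ) : P.snorm r (-R) ≤ P.snorm r R := by
  refine le_of_forall_pos_le_add fun ε hε => ?_
  obtain ⟨X, y, Z, h1, h2, h3⟩ := h.exists_of_snorm_lt (lt_add_of_pos_right (P.snorm r R) hε)
  have hw : P.snorm r (-R) ≤ √(fnorm X ^ 2 + fnorm (-Z) ^ 2) := by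
    refine snorm_le_of_witness (y := -y) h1 ?_
    rw [adj_neg, ← h2]; abel
  rw [fnorm_neg] at hw
  linarith

theorem AdjBounds.snorm_le_pnorm (h : AdjBounds P K₁ K₂) (r : Fin m → ℝ)
    (R : Matrix (Fin n) (Fin n) ℝ) : P.snorm r R ≤ (1 / K₁ + 1) * pnorm r R := by
  obtain ⟨X, hX, hle⟩ := h.exists_op_eq r
  have hw : P.snorm r R ≤ √(fnorm X ^ 2 + fnorm R ^ 2) :=
    snorm_le_of_witness (y := 0) hX (by rw [adj_zero, zero_add])
  have h1 := sqrt_sq_add_sq_le (fnorm_nonneg X) (fnorm_nonneg R)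
  have h2 := vnorm_le_pnorm r R
  have h3 := fnorm_le_pnorm r R
  have h4 : vnorm r / K₁ ≤ pnorm r R / K₁ := by have := h.pos; gcongr
  calc P.snorm r R ≤ pnorm r R / K₁ + pnorm r R := by linarith
    _ = _ := by ring

/-- Errors that are small in both norms come from symmetric matrices of small norm. -/
theorem AdjBounds.exists_symm_of_snorm_lt (h : AdjBounds P K₁ K₂) {r : Fin m → ℝ}
    {R : Matrix (Fin n) (Fin n) ℝ} (hR : R.IsSymm) {s p : ℝ} (hs : P.snorm r R < s)
    (hp : pnorm r R ≤ p) :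
    ∃ (X : Matrix (Fin n) (Fin n) ℝ) (y : Fin m → ℝ) (Z : Matrix (Fin n) (Fin n) ℝ),
      X.IsSymm ∧ Z.IsSymm ∧ P.op X = r ∧ P.adj y + Z = R ∧ fnorm X ≤ s ∧ fnorm Z ≤ s ∧
        vnorm y ≤ (p + s) / K₁ := by
  obtain ⟨X, y, Z, h1, h2, h3⟩ := h.exists_of_snorm_lt hs
  have hX : fnorm X ≤ s :=
    (Real.le_sqrt_of_sq_le (by nlinarith [sq_nonneg (fnorm Z)])).trans h3.le
  have hZ : fnorm Z ≤ s :=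
    (Real.le_sqrt_of_sq_le (by nlinarith [sq_nonneg (fnorm X)])).trans h3.le
  have hZ' : Z = R - P.adj y := by rw [← h2]; abel
  -- As the `A i` are symmetric, symmetrizing `X` keeps `𝒜 X` and does not increase the norm. `Z = R
  -- - 𝒜* y` is symmetric already, and `y` is controlled by `𝒜* y = R - Z`.
  refine ⟨(1 / 2 : ℝ) • (X + Xᵀ), y, Z, ?_, ?_, ?_, h2, ?_, hZ, ?_⟩
  · simp [Matrix.IsSymm, add_comm]
  · rw [hZ']; exact hR.sub (isSymm_adj P y)
  · rw [op_smul, op_add, op_transpose, h1]; module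
  · rw [fnorm_smul_of_nonneg (by norm_num)]
    have := fnorm_add_le X Xᵀ
    rw [fnorm_transpose] at this
    linarith
  · refine (h.vnorm_le y).trans ?_
    have h4 : P.adj y = R - Z := by rw [← h2]; abel
    have := fnorm_sub_le R Z
    have := fnorm_le_pnorm r R
    have := h.pos
    rw [h4]
    gcongr
    linarith

end SNorm

/-! ### Strong duality -/

section Duality

theorem posDef_conj {B M : Matrix (Fin n) (Fin n) ℝ} (hB : B.IsSymm) (hdet : IsUnit B.det)
    (hM : M.PosDef) : (B * M * B).PosDef := by
  have h := hM.conjTranspose_mul_mul_same (B := B)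
    (Matrix.mulVec_injective_iff_isUnit.2 ((Matrix.isUnit_iff_isUnit_det B).2 hdet))
  rwa [Matrix.conjTranspose_eq_transpose_of_trivial, hB.eq] at h

theorem posSemidef_conj {B M : Matrix (Fin n) (Fin n) ℝ} (hB : B.IsSymm)
    (hM : M.PosSemidef) : (B * M * B).PosSemidef := by
  have h := hM.conjTranspose_mul_mul_same B
  rwa [Matrix.conjTranspose_eq_transpose_of_trivial, hB.eq] at h

theorem continuous_fnorm : Continuous (fnorm : Matrix (Fin n) (Fin n) ℝ → ℝ) := by
  unfold fnorm
  refine Real.continuous_sqrt.comp ?_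
  refine continuous_finsetSum _ fun i _ => continuous_finsetSum _ fun j _ => ?_
  exact (continuous_id.matrix_elem i j).pow 2

/-- Separation takes place in the space of all matrices, where the positive definite ones are not
open in general; imposing positivity on the symmetric part only repairs this. Conjugation by the
inverse root of `M` moves the symmetric part to the identity, and symmetric matrices at distance
less than `1` from the identity are positive definite. -/
theorem isOpen_posDef_symmPart :
    IsOpen {X : Matrix (Fin n) (Fin n) ℝ | ((1 / 2 : ℝ) • (X + Xᵀ)).PosDef} := by
  rw [isOpen_iff_mem_nhds]
  intro X hX
  set M := (1 / 2 : ℝ) • (X + Xᵀ)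
  set S := CFC.sqrt M
  have hS : S * S = M := sqrt_mul_sqrt hX
  have hdet : IsUnit S.det := isUnit_det_sqrt hX
  have hST : S * S⁻¹ = 1 := Matrix.mul_nonsing_inv S hdet
  have hTS : S⁻¹ * S = 1 := Matrix.nonsing_inv_mul S hdet
  have hsymS : S.IsSymm := isSymm_sqrt M
  have hsymT : (S⁻¹).IsSymm := hsymS.inv
  let φ : Matrix (Fin n) (Fin n) ℝ → ℝ :=
    fun Y => fnorm (S⁻¹ * ((1 / 2 : ℝ) • (Y + Yᵀ)) * S⁻¹ - (1 : ℝ) • (1 : Matrix (Fin n) (Fin n) ℝ))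
  have hψ : Continuous fun Y : Matrix (Fin n) (Fin n) ℝ =>
      S⁻¹ * ((1 / 2 : ℝ) • (Y + Yᵀ)) * S⁻¹ - (1 : ℝ) • (1 : Matrix (Fin n) (Fin n) ℝ) := by
    generalize S⁻¹ = T
    fun_prop
  have hφ : Continuous φ := continuous_fnorm.comp hψ
  have hφX : φ X < 1 := by
    have h : S⁻¹ * M * S⁻¹ = 1 := by
      rw [← hS, ← mul_assoc, hTS, one_mul, hST]
    simp only [φ]
    change fnorm (S⁻¹ * M * S⁻¹ - _) < 1
    rw [h, one_smul, sub_self, fnorm_eq_zero.2 rfl]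
    exact one_pos
  refine Filter.mem_of_superset ((isOpen_lt hφ continuous_const).mem_nhds hφX) fun Y hY => ?_
  have hsym : (S⁻¹ * ((1 / 2 : ℝ) • (Y + Yᵀ)) * S⁻¹).IsSymm := by
    rw [Matrix.IsSymm, Matrix.transpose_mul, Matrix.transpose_mul, hsymT.eq, Matrix.transpose_smul,
      Matrix.transpose_add, Matrix.transpose_transpose, add_comm Yᵀ, mul_assoc]
  have hpd := posDef_conj hsymS hdet (posDef_of_fnorm_sub_lt hsym hY)
  have h : S * (S⁻¹ * ((1 / 2 : ℝ) • (Y + Yᵀ)) * S⁻¹) * S = (1 / 2 : ℝ) • (Y + Yᵀ) := by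
    rw [mul_assoc S⁻¹, ← mul_assoc S, hST, one_mul, mul_assoc, hTS, mul_one]
  rwa [h] at hpd

theorem convex_posDef_symmPart :
    Convex ℝ {X : Matrix (Fin n) (Fin n) ℝ | ((1 / 2 : ℝ) • (X + Xᵀ)).PosDef} := by
  rw [convex_iff_forall_pos]
  intro X hX Y hY a b ha hb _
  have h : (1 / 2 : ℝ) • ((a • X + b • Y) + (a • X + b • Y)ᵀ) =
      a • ((1 / 2 : ℝ) • (X + Xᵀ)) + b • ((1 / 2 : ℝ) • (Y + Yᵀ)) := by
    rw [Matrix.transpose_add, Matrix.transpose_smul, Matrix.transpose_smul]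
    module
  simp only [Set.mem_ofPred_eq, h]
  exact (hX.smul ha).add (hY.smul hb)

variable {P : SDP m n}

/-- A linear functional that vanishes on the kernel of `𝒜` lies in the range of `𝒜*`. -/
theorem exists_eq_ip_adj (f : Matrix (Fin n) (Fin n) ℝ →ₗ[ℝ] ℝ)
    (hf : ∀ X, P.op X = 0 → f X = 0) : ∃ y, ∀ X, f X = ip (P.adj y) X := by
  let L : Fin m → Matrix (Fin n) (Fin n) ℝ →ₗ[ℝ] ℝ := fun i =>
    { toFun := fun X => ip (P.A i) X
      map_add' := fun X Y => ip_add_right _ _ _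
      map_smul' := fun t X => ip_smul_right _ _ _ }
  have h : f ∈ Submodule.span ℝ (Set.range L) := by
    refine mem_span_of_iInf_ker_le_ker fun X hX => hf X ?_
    rw [Submodule.mem_iInf] at hX
    ext i
    exact hX i
  obtain ⟨c, hc⟩ := (Submodule.mem_span_range_iff_exists_fun ℝ).1 h
  refine ⟨c, fun X => ?_⟩
  rw [← dotProduct_op, ← hc]
  simp [dotProduct, SDP.op, L, ip]

theorem eq_zero_of_forall_le_add_mul {u a b : ℝ} (h : ∀ t : ℝ, u ≤ a + t * b) : b = 0 := by
  by_contra hb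
  have := h ((u - a - 1) / b)
  rw [div_mul_cancel₀ _ hb] at this
  linarith

/-- The quadratic form at `x` is the pairing with `x xᵀ`, a limit of the positive definite matrices
`x xᵀ + δ I`. -/
theorem posSemidef_of_ip_nonneg {Z : Matrix (Fin n) (Fin n) ℝ} (hZ : Z.IsSymm)
    (h : ∀ X : Matrix (Fin n) (Fin n) ℝ, X.PosDef → 0 ≤ ip Z X) : Z.PosSemidef := by
  refine Matrix.PosSemidef.of_dotProduct_mulVec_nonneg ?_ fun x => ?_
  · rw [Matrix.IsHermitian, Matrix.conjTranspose_eq_transpose_of_trivial, hZ.eq]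
  · have hx : star x ⬝ᵥ Z *ᵥ x = ip Z (Matrix.vecMulVec x x) := by
      rw [ip, Matrix.mul_vecMulVec, Matrix.trace_vecMulVec, dotProduct_comm, star_trivial]
    rw [hx]
    refine le_of_forall_pos_le_add fun ε hε => ?_
    set δ := ε / (|Z.trace| + 1)
    have hδ : 0 < δ := by positivity
    have hpd : (Matrix.vecMulVec x x + δ • (1 : Matrix (Fin n) (Fin n) ℝ)).PosDef := by
      have := Matrix.posSemidef_vecMulVec_self_star x
      rw [star_trivial] at this
      exact Matrix.PosDef.posSemidef_add this (Matrix.PosDef.one.smul hδ)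
    have h1 := h _ hpd
    rw [ip_add_right, ip_smul_right, ip_one_right] at h1
    have h2 : δ * Z.trace ≤ ε := by
      have h3 : δ * (|Z.trace| + 1) = ε := div_mul_cancel₀ _ (by positivity)
      nlinarith [le_abs_self Z.trace]
    linarith

/-- If the primal problem satisfies Slater's condition and is solved by `X`, then some dual
feasible point has at least the same objective value. -/
theorem exists_dualFeasible_of_primalOptimal {Xs Xh : Matrix (Fin n) (Fin n) ℝ}
    (hXh : Xh.PosDef) (hXh' : P.op Xh = P.b) (hXs : P.PrimalFeasible Xs)
    (hopt : ∀ X', P.PrimalFeasible X' → (P.C * Xs).trace ≤ (P.C * X').trace) :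
    ∃ y Z, P.DualFeasible y Z ∧ ip P.C Xs ≤ P.b ⬝ᵥ y := by
  let fC : Matrix (Fin n) (Fin n) ℝ →ₗ[ℝ] ℝ :=
    { toFun := fun X => ip P.C X
      map_add' := fun X Y => ip_add_right _ _ _
      map_smul' := fun t X => ip_smul_right _ _ _ }
  have hfC (X) : fC X = ip P.C X := rfl
  -- Separation needs some solution of the linear equations to have a smaller objective value than
  -- `Xs`. If there is none, the objective is constant on the affine space and `C` acts as some `𝒜*
  -- y`.
  by_cases hF : ∃ X1, P.op X1 = P.b ∧ ip P.C X1 < ip P.C Xs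
  · obtain ⟨X1, hX1, hlt⟩ := hF
    set F : Set (Matrix (Fin n) (Fin n) ℝ) := {X | P.op X = P.b ∧ ip P.C X < ip P.C Xs} with hFdef
    have hFconv : Convex ℝ F := by
      intro X hX Y hY a b ha hb hab
      refine ⟨?_, ?_⟩
      · rw [op_add, op_smul, op_smul, hX.1, hY.1, ← add_smul, hab, one_smul]
      · rw [ip_add_right, ip_smul_right, ip_smul_right]
        have h1 := hX.2
        have h2 := hY.2
        rcases ha.eq_or_lt with h0 | h0
        · have : b = 1 := by linarith
          rw [← h0, this]; linarith
        · have hb' : b = 1 - a := by linarith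
          have := mul_lt_mul_of_pos_left h1 h0
          have := mul_le_mul_of_nonneg_left h2.le hb
          subst hb'
          linarith
    have hdisj : Disjoint {X : Matrix (Fin n) (Fin n) ℝ | ((1 / 2 : ℝ) • (X + Xᵀ)).PosDef} F := by
      rw [Set.disjoint_left]
      intro X hX hXF
      have h1 : P.op ((1 / 2 : ℝ) • (X + Xᵀ)) = P.b := by
        rw [op_smul, op_add, op_transpose, hXF.1]; module
      have h2 := hopt _ ⟨Matrix.PosDef.posSemidef hX, h1⟩
      have h3 : ip P.C ((1 / 2 : ℝ) • (X + Xᵀ)) = ip P.C X := by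
        rw [ip_smul_right, ip_add_right, ip_comm P.C Xᵀ, ip_transpose_left P.C_symm, ip_comm X]
        ring
      change ip P.C Xs ≤ ip P.C _ at h2
      rw [h3] at h2
      exact absurd hXF.2 (not_lt.2 h2)
    -- By optimality, no positive definite matrix lies in `F`. Scaling along the cone then yields `u
    -- ≥ 0` and `f ≤ 0` on the positive definite matrices.
    obtain ⟨f, u, hfG, hfF⟩ :=
      geometric_hahn_banach_open convex_posDef_symmPart isOpen_posDef_symmPart hFconv hdisj
    have hfPD (X : Matrix (Fin n) (Fin n) ℝ) (hX : X.PosDef) : f X < u := by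
      refine hfG X ?_
      have h : (1 / 2 : ℝ) • (X + Xᵀ) = X := by rw [(isSymm_of_posDef hX).eq]; module
      simpa only [Set.mem_ofPred_eq, h] using hX
    have hu : 0 ≤ u := by
      by_contra! hneg
      have h1 := hfPD Xh hXh
      have h2 := hfPD ((u / f Xh) • Xh) (hXh.smul (div_pos_of_neg_of_neg hneg (h1.trans hneg)))
      rw [map_smul, smul_eq_mul, div_mul_cancel₀ _ (h1.trans hneg).ne] at h2
      exact lt_irrefl _ h2
    have hfle (X : Matrix (Fin n) (Fin n) ℝ) (hX : X.PosDef) : f X ≤ 0 := by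
      by_contra! hpos
      have h2 := hfPD (((u + 1) / f X) • X) (hX.smul (by positivity))
      rw [map_smul, smul_eq_mul, div_mul_cancel₀ _ hpos.ne'] at h2
      linarith
    set D1 := X1 - Xs
    have hD1 : P.op D1 = 0 := by rw [op_sub, hX1, hXs.2, sub_self]
    have hCD1 : ip P.C D1 < 0 := by rw [ip_sub_right]; linarith
    set τ := f D1 / ip P.C D1
    -- The set `F` is invariant under translations that preserve both `𝒜` and the objective. On such
    -- a line `f` is bounded below, so it is constant; `D - s • D1` is such a direction.
    have hker : ∀ D, P.op D = 0 → ((f : Matrix (Fin n) (Fin n) ℝ →ₗ[ℝ] ℝ) - τ • fC) D = 0 := by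
      intro D hD
      set s := ip P.C D / ip P.C D1
      have h0 : f (D - s • D1) = 0 := by
        refine eq_zero_of_forall_le_add_mul (u := u) (a := f X1) fun t => ?_
        have h := hfF (X1 + t • (D - s • D1)) ⟨?_, ?_⟩
        · simpa using h
        · simp [op_add, op_smul, op_sub, hX1, hD, hD1]
        · rw [ip_add_right, ip_smul_right, ip_sub_right, ip_smul_right,
            div_mul_cancel₀ _ hCD1.ne, sub_self, mul_zero, add_zero]
          exact hlt
      rw [map_sub, map_smul, smul_eq_mul, sub_eq_zero] at h0
      have h1 : τ * ip P.C D1 = f D1 := div_mul_cancel₀ _ hCD1.ne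
      have h2 : s * ip P.C D1 = ip P.C D := div_mul_cancel₀ _ hCD1.ne
      have h3 : f D = τ * ip P.C D := by
        rw [h0, ← h1, ← h2]; ring
      simp [hfC, h3]
    obtain ⟨c, hc⟩ := exists_eq_ip_adj _ hker
    have hfeq (X) : f X = ip (P.adj c) X + τ * ip P.C X := by
      have := hc X
      simp only [LinearMap.sub_apply, LinearMap.smul_apply, hfC, smul_eq_mul,
        ContinuousLinearMap.coe_coe] at this
      linarith
    -- This is where Slater's condition enters. `Xh` and `X1` have the same image under `𝒜`, so `f`
    -- tells them apart only through the objective, which is larger at `Xh`, whereas `f` is smaller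
    -- there.
    have hτ : τ < 0 := by
      have h1 : f Xh < f X1 := (hfPD Xh hXh).trans_le (hfF X1 ⟨hX1, hlt⟩)
      rw [hfeq, hfeq, ← dotProduct_op, ← dotProduct_op, hXh', hX1] at h1
      have h2 : ip P.C Xs ≤ ip P.C Xh := hopt Xh ⟨hXh.posSemidef, hXh'⟩
      by_contra! h3
      nlinarith
    -- `Xs` is a limit of points `Xs + t • D1` of `F`, where `f ≥ u ≥ 0`.
    have hfXs : 0 ≤ f Xs := by
      refine le_of_forall_pos_le_add fun ε hε => ?_
      set t := min 1 (ε / (|f D1| + 1))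
      have ht : 0 < t := by positivity
      have h := hfF (Xs + t • D1) ⟨?_, ?_⟩
      · rw [map_add, map_smul, smul_eq_mul] at h
        have h1 : t * (|f D1| + 1) ≤ ε := by
          rw [← le_div_iff₀ (by positivity)]; exact min_le_right _ _
        nlinarith [le_abs_self (f D1)]
      · simp [op_add, op_smul, hXs.2, hD1]
      · rw [ip_add_right, ip_smul_right]; nlinarith
    have hZ (X) : ip (P.C - P.adj ((-1 / τ) • c)) X = f X / τ := by
      have hτ0 := hτ.ne
      rw [ip_sub_left, adj_smul, ip_smul_left, hfeq]
      field_simp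
      ring
    refine ⟨(-1 / τ) • c, P.C - P.adj ((-1 / τ) • c), ⟨?_, by abel⟩, ?_⟩
    · refine posSemidef_of_ip_nonneg (P.C_symm.sub (isSymm_adj P _)) fun X hX => ?_
      rw [hZ]
      exact div_nonneg_of_nonpos (hfle X hX) hτ.le
    · have h1 := hZ Xs
      have h2 : f Xs / τ ≤ 0 := div_nonpos_of_nonneg_of_nonpos hfXs hτ.le
      rw [ip_sub_left, ← dotProduct_op, hXs.2] at h1
      rw [dotProduct_comm]
      linarith
  · push Not at hF
    obtain ⟨y, hy⟩ := exists_eq_ip_adj (P := P) fC fun D hD => by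
      refine eq_zero_of_forall_le_add_mul (u := ip P.C Xs) (a := ip P.C Xs) fun t => ?_
      have h := hF (Xs + t • D) (by rw [op_add, op_smul, hD, hXs.2]; simp)
      rwa [ip_add_right, ip_smul_right] at h
    refine ⟨y, P.C - P.adj y, ⟨?_, by abel⟩, ?_⟩
    · refine posSemidef_of_ip_nonneg (P.C_symm.sub (isSymm_adj P _)) fun X _ => ?_
      rw [ip_sub_left, ← hy, hfC, sub_self]
    · rw [dotProduct_comm, ← hXs.2, dotProduct_op, ← hy, hfC]

/-- The pairing `⟨X, Z⟩` is the duality gap. It is nonnegative, and dual optimality of `y` together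
with strong duality makes it nonpositive. -/
theorem ip_eq_zero_of_isOptimal (hS : P.StrictlyFeasible) {X Z : Matrix (Fin n) (Fin n) ℝ}
    {y : Fin m → ℝ} (hO : P.IsOptimal X y Z) : ip X Z = 0 := by
  obtain ⟨⟨⟨Xh, hXh, hXh'⟩, -⟩, ⟨hX, hXo⟩, ⟨hZ, hZo⟩⟩ := And.intro hS hO
  obtain ⟨y', Z', hf, hle⟩ := exists_dualFeasible_of_primalOptimal hXh hXh' hX hXo
  have h1 := hZo y' Z' hf
  have h2 : P.b ⬝ᵥ y + ip X Z = ip P.C X := by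
    rw [dotProduct_comm, ← hX.2, dotProduct_op, ip_comm X Z, ← ip_add_left, hZ.2]
  have h3 := ip_nonneg hX.1 hZ.1
  linarith

end Duality

/-! ### A priori bounds on the iterates -/

section Bounds

/-- The properties of a problem instance and of one of its optimal triples that are used in the
complexity analysis. -/
structure Instance (P : SDP m n) (ρ Kstar Ky K₁ K₂ : ℝ) (y₀ : Fin m → ℝ)
    (Xs : Matrix (Fin n) (Fin n) ℝ) (ys : Fin m → ℝ) (Zs : Matrix (Fin n) (Fin n) ℝ) : Prop where
  n_pos : 0 < n
  adjBounds : AdjBounds P K₁ K₂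
  Xs_psd : Xs.PosSemidef
  Zs_psd : Zs.PosSemidef
  op_Xs : P.op Xs = P.b
  adj_ys : P.adj ys + Zs = P.C
  compl : ip Xs Zs = 0
  Xs_le : fnorm Xs ≤ Kstar * √(n : ℝ)
  ys_le : vnorm ys ≤ Kstar * √(n : ℝ)
  Zs_le : fnorm Zs ≤ Kstar * √(n : ℝ)
  y₀_le : vnorm y₀ ≤ Ky * √(n : ℝ)

variable {P : SDP m n} {ρ Kstar Ky K₁ K₂ : ℝ} {y₀ : Fin m → ℝ}
  {Xs : Matrix (Fin n) (Fin n) ℝ} {ys : Fin m → ℝ} {Zs : Matrix (Fin n) (Fin n) ℝ}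

theorem mu0_eq (hn : 0 < n) (ρ : ℝ) : mu0 n ρ = ρ ^ 2 := by
  have : (n : ℝ) ≠ 0 := by positivity
  simp [mu0, mu]
  field_simp

theorem mu_eq_ip (X Z : Matrix (Fin n) (Fin n) ℝ) : mu X Z = ip X Z / n := rfl

theorem ip_eq_mul_mu (hn : 0 < n) (X Z : Matrix (Fin n) (Fin n) ℝ) : ip X Z = n * mu X Z := by
  rw [mu_eq_ip]; field_simp

theorem fnorm_sub_comm (X Y : Matrix (Fin n) (Fin n) ℝ) : fnorm (X - Y) = fnorm (Y - X) := by
  rw [← fnorm_neg, neg_sub]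

theorem vnorm_neg (y : Fin m → ℝ) : vnorm (-y) = vnorm y := by
  rw [← neg_one_smul ℝ, vnorm_smul]; simp

theorem vnorm_sub_comm (y z : Fin m → ℝ) : vnorm (y - z) = vnorm (z - y) := by
  rw [← vnorm_neg, neg_sub]

theorem one_le_sqrt_natCast (hn : 0 < n) : 1 ≤ √(n : ℝ) :=
  Real.one_le_sqrt.2 (by exact_mod_cast hn)

theorem sqrt_natCast_le (hn : 0 < n) : √(n : ℝ) ≤ n := by
  have h1 := one_le_sqrt_natCast hn
  have h2 : √(n : ℝ) ^ 2 = n := Real.sq_sqrt (by positivity)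
  nlinarith

/-- The radius, intermediate between `γ_S ρ` and `ρ`, of the perturbations of the reference
points. -/
noncomputable def pertRadius (par : Params) (ρ : ℝ) : ℝ := (1 + par.γS) / 2 * ρ

/-- A bound for the `y`-part of a perturbation. -/
noncomputable def pertDual (par : Params) (ρ K₁ : ℝ) : ℝ := (par.KN + pertRadius par ρ) / K₁

theorem pertRadius_pos (par : Params) (hρ : 0 < ρ) : 0 < pertRadius par ρ := by
  have := par.γS_pos
  unfold pertRadius
  positivity

theorem pertRadius_lt (par : Params) (hρ : 0 < ρ) : pertRadius par ρ < ρ := by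
  have := par.γS_lt
  unfold pertRadius
  nlinarith

theorem lt_pertRadius (par : Params) (hρ : 0 < ρ) : par.γS * ρ < pertRadius par ρ := by
  have := par.γS_lt
  unfold pertRadius
  nlinarith

theorem pertDual_pos (par : Params) (hρ : 0 < ρ) (hK₁ : 0 < K₁) : 0 < pertDual par ρ K₁ := by
  have := pertRadius_pos par hρ
  have := par.KN_pos
  unfold pertDual
  positivity

/-- A bound, up to the factor `√n`, for the norms of the reference points. -/
noncomputable def refConst (par : Params) (ρ Kstar Ky K₁ : ℝ) : ℝ :=
  Kstar + 2 * ρ + Ky + pertDual par ρ K₁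

/-- The reference point `(1 - θ) (X*, y*, Z*) + θ (X₀ + X̂, y₀ + ŷ, Z₀ + Ẑ)`. -/
theorem Instance.exists_reference (par : Params) (hρ : 0 < ρ) (hKstar : 0 < Kstar) (hKy : 0 < Ky)
    (I : Instance P ρ Kstar Ky K₁ K₂ y₀ Xs ys Zs) {bt : Fin m → ℝ}
    {Ct : Matrix (Fin n) (Fin n) ℝ} (hCt : Ct.IsSymm) (hp : pnorm bt Ct ≤ par.KN)
    (hs : P.snorm bt Ct ≤ par.γS * ρ) {θ : ℝ} (hθ : 0 ≤ θ) (hθ1 : θ ≤ 1) :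
    ∃ (X : Matrix (Fin n) (Fin n) ℝ) (y : Fin m → ℝ) (Z : Matrix (Fin n) (Fin n) ℝ),
      X.IsSymm ∧ Z.IsSymm ∧
      P.op X = P.b + θ • (P.bbar ρ + bt) ∧ P.adj y + Z = P.C + θ • (P.Cbar ρ y₀ + Ct) ∧
      fnorm X ≤ refConst par ρ Kstar Ky K₁ * √(n : ℝ) ∧
      vnorm y ≤ refConst par ρ Kstar Ky K₁ * √(n : ℝ) ∧
      fnorm Z ≤ refConst par ρ Kstar Ky K₁ * √(n : ℝ) ∧
      ip X Z ≤ 2 * θ * refConst par ρ Kstar Ky K₁ ^ 2 * n ∧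
      (∀ W : Matrix (Fin n) (Fin n) ℝ, W.PosSemidef →
        (1 - θ) * ip Xs W + θ * (ρ - pertRadius par ρ) * W.trace ≤ ip X W) ∧
      (∀ W : Matrix (Fin n) (Fin n) ℝ, W.PosSemidef →
        (1 - θ) * ip W Zs + θ * (ρ - pertRadius par ρ) * W.trace ≤ ip W Z) := by
  set g := pertRadius par ρ with hg
  have hgpos : 0 < g := pertRadius_pos par hρ
  have hgρ : g < ρ := pertRadius_lt par hρ
  -- The room between `γ_S ρ` and `g` provides a witness although the infimum may not be attained,
  -- and `g < ρ` keeps `ρ I + X̂` and `ρ I + Ẑ` above `(ρ - g) I`.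
  obtain ⟨Xh, yh, Zh, hXh, hZh, hop, hadj, hXn, hZn, hyn⟩ :=
    I.adjBounds.exists_symm_of_snorm_lt hCt (hs.trans_lt (lt_pertRadius par hρ)) hp
  rw [← hg] at hXn hZn
  have hyn' : vnorm yh ≤ pertDual par ρ K₁ := hyn
  have hdpos : 0 < pertDual par ρ K₁ := pertDual_pos par hρ I.adjBounds.pos
  set a := refConst par ρ Kstar Ky K₁ with ha
  set s := √(n : ℝ) with hs'
  have hs1 : 1 ≤ s := one_le_sqrt_natCast I.n_pos
  have hss : s * s = n := Real.mul_self_sqrt (by positivity)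
  have hρI : fnorm (ρ • (1 : Matrix (Fin n) (Fin n) ℝ)) = ρ * s := by
    rw [fnorm_smul_of_nonneg hρ.le, fnorm_one]
  have hX0 : fnorm (ρ • (1 : Matrix (Fin n) (Fin n) ℝ) + Xh) ≤ 2 * ρ * s := by
    refine (fnorm_add_le _ _).trans ?_
    rw [hρI]; nlinarith
  have hZ0 : fnorm (ρ • (1 : Matrix (Fin n) (Fin n) ℝ) + Zh) ≤ 2 * ρ * s := by
    refine (fnorm_add_le _ _).trans ?_
    rw [hρI]; nlinarith
  have hy0 : vnorm (y₀ + yh) ≤ (Ky + pertDual par ρ K₁) * s := by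
    refine (vnorm_add_le _ _).trans ?_
    have := I.y₀_le
    nlinarith
  have hθ' : 0 ≤ 1 - θ := by linarith
  have hcomb : ∀ {x z u v : ℝ}, x ≤ u → z ≤ v → 0 ≤ u → 0 ≤ v → (1 - θ) * x + θ * z ≤ u + v := by
    intro x z u v h1 h2 h3 h4
    nlinarith [mul_le_mul_of_nonneg_left h1 hθ', mul_le_mul_of_nonneg_left h2 hθ]
  have hKs : 0 ≤ Kstar * s := by positivity
  have hρs : 0 ≤ 2 * ρ * s := by positivity
  have hys : 0 ≤ (Ky + pertDual par ρ K₁) * s := by positivity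
  have key (W V : Matrix (Fin n) (Fin n) ℝ) (hW : W.PosSemidef) (hV : fnorm V ≤ g) :
      (ρ - g) * W.trace ≤ ip (ρ • (1 : Matrix (Fin n) (Fin n) ℝ) + V) W := by
    rw [ip_add_left, ip_smul_left, ip_one_left]
    have h1 := neg_le_ip V W
    have h2 := fnorm_le_trace hW
    have h3 : fnorm V * fnorm W ≤ g * W.trace :=
      mul_le_mul hV h2 (fnorm_nonneg _) hgpos.le
    linarith
  refine ⟨(1 - θ) • Xs + θ • (ρ • 1 + Xh), (1 - θ) • ys + θ • (y₀ + yh),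
    (1 - θ) • Zs + θ • (ρ • 1 + Zh), ?_, ?_, ?_, ?_, ?_, ?_, ?_, ?_, ?_, ?_⟩
  · exact ((isSymm_of_posSemidef I.Xs_psd).smul _).add
      (((Matrix.isSymm_one.smul _).add hXh).smul _)
  · exact ((isSymm_of_posSemidef I.Zs_psd).smul _).add
      (((Matrix.isSymm_one.smul _).add hZh).smul _)
  · rw [op_add, op_smul, op_smul, op_add, I.op_Xs, hop, SDP.bbar]
    module
  · rw [adj_add, adj_smul, adj_smul, adj_add, SDP.Cbar, ← I.adj_ys, ← hadj]
    module
  · refine (fnorm_add_le _ _).trans ?_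
    rw [fnorm_smul_of_nonneg hθ', fnorm_smul_of_nonneg hθ]
    refine (hcomb I.Xs_le hX0 hKs hρs).trans ?_
    rw [ha, refConst]; nlinarith
  · refine (vnorm_add_le _ _).trans ?_
    rw [vnorm_smul_of_nonneg hθ', vnorm_smul_of_nonneg hθ]
    refine (hcomb I.ys_le hy0 hKs hys).trans ?_
    rw [ha, refConst]; nlinarith
  · refine (fnorm_add_le _ _).trans ?_
    rw [fnorm_smul_of_nonneg hθ', fnorm_smul_of_nonneg hθ]
    refine (hcomb I.Zs_le hZ0 hKs hρs).trans ?_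
    rw [ha, refConst]; nlinarith
  -- Complementarity removes the term with factor `(1 - θ)²`; every remaining term carries a factor
  -- `θ`.
  · rw [ip_add_left, ip_smul_left, ip_smul_left, ip_add_right, ip_smul_right, ip_smul_right,
      ip_add_right _ _ (_ + _), ip_smul_right, ip_smul_right, I.compl]
    set V := ρ • (1 : Matrix (Fin n) (Fin n) ℝ) + Xh
    set U := ρ • (1 : Matrix (Fin n) (Fin n) ℝ) + Zh
    have e1 : ip Xs U ≤ (Kstar * s) * (2 * ρ * s) :=
      (ip_le _ _).trans (mul_le_mul I.Xs_le hZ0 (fnorm_nonneg _) hKs)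
    have e2 : ip V Zs ≤ (2 * ρ * s) * (Kstar * s) :=
      (ip_le _ _).trans (mul_le_mul hX0 I.Zs_le (fnorm_nonneg _) hρs)
    have e3 : ip V U ≤ (2 * ρ * s) * (2 * ρ * s) :=
      (ip_le _ _).trans (mul_le_mul hX0 hZ0 (fnorm_nonneg _) hρs)
    have hc : ∀ {t x u : ℝ}, 0 ≤ t → t ≤ 1 → x ≤ u → 0 ≤ u → t * x ≤ u := fun h1 h2 h3 h4 =>
      (mul_le_mul_of_nonneg_left h3 h1).trans (mul_le_of_le_one_left h4 h2)
    have hθ1' : 1 - θ ≤ 1 := by linarith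
    have e4 := hc hθ' hθ1' e1 (mul_nonneg hKs hρs)
    have e5 := hc hθ' hθ1' e2 (mul_nonneg hρs hKs)
    have e6 := hc hθ hθ1 e3 (mul_nonneg hρs hρs)
    have e7 : (Kstar + 2 * ρ) ^ 2 ≤ a ^ 2 := by
      have : Kstar + 2 * ρ ≤ a := by rw [ha, refConst]; linarith
      gcongr
    have e8 : 4 * (Kstar * ρ) + 4 * ρ ^ 2 ≤ 2 * a ^ 2 := by
      nlinarith [sq_nonneg Kstar, sq_nonneg ρ, mul_pos hKstar hρ]
    have e9 : (1 - θ) * ip Xs U + (1 - θ) * ip V Zs + θ * ip V U ≤ 2 * a ^ 2 * n := by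
      calc _ ≤ (4 * (Kstar * ρ) + 4 * ρ ^ 2) * (s * s) := by linarith
        _ ≤ 2 * a ^ 2 * (s * s) := mul_le_mul_of_nonneg_right e8 (mul_self_nonneg s)
        _ = _ := by rw [hss]
    have := mul_le_mul_of_nonneg_left e9 hθ
    linarith
  · intro W hW
    rw [ip_add_left, ip_smul_left, ip_smul_left]
    have := mul_le_mul_of_nonneg_left (key W Xh hW hXn) hθ
    linarith
  · intro W hW
    rw [ip_comm, ip_comm W, ip_add_left, ip_smul_left, ip_smul_left]
    have := mul_le_mul_of_nonneg_left (key W Zh hW hZn) hθ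
    linarith

/-- The dual equations express `Z - Zt` through `𝒜* (y - yt)`; moving `𝒜*` across the pairing
produces `𝒜 (X - Xt)`, which the primal equations turn into the proximal term in `y`. -/
theorem ip_sub_sub_eq {X Xt Z Zt Ξ : Matrix (Fin n) (Fin n) ℝ} {y yt lam : Fin m → ℝ} {μ : ℝ}
    (h1 : P.op X + μ • (y - lam) = P.op Xt)
    (h2 : P.adj y + Z - μ • (X - Ξ) = P.adj yt + Zt) :
    ip (X - Xt) (Z - Zt) = μ * ip (X - Xt) (X - Ξ) + μ * ((y - yt) ⬝ᵥ (y - lam)) := by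
  have e1 : Z - Zt = μ • (X - Ξ) - P.adj (y - yt) := by
    rw [adj_sub, sub_eq_sub_iff_add_eq_add]
    rw [sub_eq_iff_eq_add] at h2
    rw [← sub_eq_zero] at h2 ⊢
    rw [← h2]
    abel
  have e2 : P.op (X - Xt) = -(μ • (y - lam)) := by
    rw [op_sub, ← h1]; abel
  rw [e1, ip_sub_right, ip_smul_right, ip_comm _ (P.adj _), ← dotProduct_op, e2, dotProduct_neg,
    dotProduct_smul, smul_eq_mul, sub_neg_eq_add]

/-- The proximal terms make the pairing of the differences almost nonnegative. -/
theorem ip_sub_sub_ge {X Xt Z Zt Ξ : Matrix (Fin n) (Fin n) ℝ} {y yt lam : Fin m → ℝ} {μ : ℝ}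
    (hμ : 0 ≤ μ) (hX : X.IsSymm) (hXt : Xt.IsSymm)
    (h1 : P.op X + μ • (y - lam) = P.op Xt)
    (h2 : P.adj y + Z - μ • (X - Ξ) = P.adj yt + Zt) :
    μ / 2 * (fnorm (X - Xt) ^ 2 + vnorm (y - yt) ^ 2) -
      μ / 2 * (fnorm (Xt - Ξ) ^ 2 + vnorm (yt - lam) ^ 2) ≤ ip (X - Xt) (Z - Zt) := by
  rw [ip_sub_sub_eq h1 h2]
  -- Splitting the proximal differences at the reference point gives a full square plus a cross
  -- term, and the cross term costs half of each square.
  have e1 : X - Ξ = (X - Xt) + (Xt - Ξ) := by abel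
  have e2 : y - lam = (y - yt) + (yt - lam) := by abel
  rw [e1, e2, ip_add_right, dotProduct_add, ip_self (hX.sub hXt), dotProduct_self_eq_vnorm_sq]
  have h3 := neg_le_ip (X - Xt) (Xt - Ξ)
  have h4 := (abs_le.1 (abs_dotProduct_le (y - yt) (yt - lam))).1
  have h5 : 1 / 2 * (fnorm (X - Xt) ^ 2 - fnorm (Xt - Ξ) ^ 2) ≤
      fnorm (X - Xt) ^ 2 + ip (X - Xt) (Xt - Ξ) := by
    nlinarith [sq_nonneg (fnorm (X - Xt) - fnorm (Xt - Ξ))]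
  have h6 : 1 / 2 * (vnorm (y - yt) ^ 2 - vnorm (yt - lam) ^ 2) ≤
      vnorm (y - yt) ^ 2 + (y - yt) ⬝ᵥ (yt - lam) := by
    nlinarith [sq_nonneg (vnorm (y - yt) - vnorm (yt - lam))]
  nlinarith [mul_le_mul_of_nonneg_left h5 hμ, mul_le_mul_of_nonneg_left h6 hμ]

/-- The neighbourhood does not ask `Ct` to be symmetric, but the dual equation expresses it through
symmetric matrices. -/
theorem isSymm_perturbation {P : SDP m n} {ρ θ μ : ℝ} {y₀ y : Fin m → ℝ}
    {X Z Ξ Ct : Matrix (Fin n) (Fin n) ℝ} (hθ : θ ≠ 0) (hX : X.IsSymm) (hZ : Z.IsSymm)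
    (hΞ : Ξ.IsSymm) (h : P.adj y + Z - μ • (X - Ξ) = P.C + θ • (P.Cbar ρ y₀ + Ct)) :
    Ct.IsSymm := by
  have hCb : (P.Cbar ρ y₀).IsSymm :=
    ((isSymm_adj P y₀).add (Matrix.isSymm_one.smul _)).sub P.C_symm
  have h1 : Ct = θ⁻¹ • (P.adj y + Z - μ • (X - Ξ) - P.C) - P.Cbar ρ y₀ := by
    rw [h, add_sub_cancel_left, inv_smul_smul₀ hθ, add_sub_cancel_left]
  rw [h1]
  exact (((((isSymm_adj P y).add hZ).sub ((hX.sub hΞ).smul _)).sub P.C_symm).smul _).sub hCb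

/-- The energy estimate for a point of the neighbourhood, relative to a reference point. -/
theorem Instance.exists_energy (par : Params) (hρ : 0 < ρ) (hKstar : 0 < Kstar) (hKy : 0 < Ky)
    (I : Instance P ρ Kstar Ky K₁ K₂ y₀ Xs ys Zs) {X Z Ξ : Matrix (Fin n) (Fin n) ℝ}
    {y lam : Fin m → ℝ} {μ : ℝ} (hμ : 0 < μ) (hμ1 : μ ≤ ρ ^ 2) (hmu : mu X Z = μ)
    (hΞ : Ξ.IsSymm) (hN : P.Nbhd par ρ y₀ μ Ξ lam X y Z) :
    ∃ (Xt : Matrix (Fin n) (Fin n) ℝ) (yt : Fin m → ℝ) (Zt : Matrix (Fin n) (Fin n) ℝ),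
      P.adj (y - yt) + (Z - Zt) = μ • (X - Ξ) ∧
      fnorm Xt ≤ refConst par ρ Kstar Ky K₁ * √(n : ℝ) ∧
      vnorm yt ≤ refConst par ρ Kstar Ky K₁ * √(n : ℝ) ∧
      fnorm Zt ≤ refConst par ρ Kstar Ky K₁ * √(n : ℝ) ∧
      (1 - μ / ρ ^ 2) * (ip Xs Z + ip X Zs) +
        μ / ρ ^ 2 * (ρ - pertRadius par ρ) * (X.trace + Z.trace) +
        μ / 2 * (fnorm (X - Xt) ^ 2 + vnorm (y - yt) ^ 2) ≤
      μ / ρ ^ 2 * (ρ ^ 2 + 2 * refConst par ρ Kstar Ky K₁ ^ 2) * n +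
        μ / 2 * (fnorm (Xt - Ξ) ^ 2 + vnorm (yt - lam) ^ 2) := by
  obtain ⟨⟨bt, Ct, h1, h2, h3, h4⟩, hX, hZ, -⟩ := hN
  rw [mu0_eq I.n_pos] at h1 h2
  have hθ : 0 < μ / ρ ^ 2 := by positivity
  have hθ1 : μ / ρ ^ 2 ≤ 1 := by rw [div_le_one (by positivity)]; exact hμ1
  have hCt := isSymm_perturbation hθ.ne' (isSymm_of_posDef hX) (isSymm_of_posDef hZ) hΞ h2
  obtain ⟨Xt, yt, Zt, hXt, -, hop, hadj, hXn, hyn, hZn, hip, hl, hr⟩ :=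
    I.exists_reference par hρ hKstar hKy hCt h3 h4 hθ.le hθ1
  rw [← hop] at h1
  rw [← hadj] at h2
  refine ⟨Xt, yt, Zt, ?_, hXn, hyn, hZn, ?_⟩
  · rw [adj_sub]
    rw [sub_eq_iff_eq_add] at h2
    rw [← sub_eq_zero] at h2 ⊢
    rw [← h2]
    abel
  -- In the expanded pairing `⟨X, Z⟩ = n μ`, the product of the two reference matrices is `O(θ n)`,
  -- and the mixed terms are bounded below by the last two properties of the reference point.
  · have e1 := ip_sub_sub_ge hμ.le (isSymm_of_posDef hX) hXt h1 h2
    rw [ip_sub_left, ip_sub_right, ip_sub_right, ip_eq_mul_mu I.n_pos X Z, hmu] at e1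
    have e2 := hl Z hZ.posSemidef
    have e3 := hr X hX.posSemidef
    have e4 : μ / ρ ^ 2 * ρ ^ 2 = μ := div_mul_cancel₀ _ (by positivity)
    nlinarith

end Bounds

/-! ### Uniform bounds for proximal estimates and iterates -/

section IterateBounds

/-- A point that lies in the neighbourhood defined by itself, such as a new proximal estimate, has
norm `O(n)`. -/
theorem exists_proximal_bound (par : Params) {ρ Kstar Ky K₁ : ℝ} (K₂ : ℝ) (hρ : 0 < ρ)
    (hKstar : 0 < Kstar) (hKy : 0 < Ky) (hK₁ : 0 < K₁) :
    ∃ c : ℝ, 0 < c ∧ ∀ {m n : ℕ} {P : SDP m n} {y₀ ys : Fin m → ℝ}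
      {Xs Zs : Matrix (Fin n) (Fin n) ℝ}, Instance P ρ Kstar Ky K₁ K₂ y₀ Xs ys Zs →
      ∀ {X Z : Matrix (Fin n) (Fin n) ℝ} {y : Fin m → ℝ} {μ : ℝ}, 0 < μ → μ ≤ ρ ^ 2 →
      mu X Z = μ → P.Nbhd par ρ y₀ μ X y X y Z → fnorm X ≤ c * n ∧ vnorm y ≤ c * n := by
  set a := refConst par ρ Kstar Ky K₁ with ha
  set g := pertRadius par ρ with hg
  have hgρ : 0 < ρ - g := sub_pos.2 (pertRadius_lt par hρ)
  have hdpos := pertDual_pos par hρ hK₁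
  have hapos : 0 < a := by rw [ha, refConst]; positivity
  set c₁ := (ρ ^ 2 + 2 * a ^ 2) / (ρ - g) with hc₁
  have hc₁pos : 0 < c₁ := by positivity
  refine ⟨c₁ + a + (c₁ + a) / K₁, by positivity, ?_⟩
  intro m n P y₀ ys Xs Zs I X Z y μ hμ hμ1 hmu hN
  have hX := hN.2.1
  have hZ := hN.2.2.1
  obtain ⟨Xt, yt, Zt, heq, hXn, hyn, hZn, he⟩ :=
    I.exists_energy par hρ hKstar hKy hμ hμ1 hmu (isSymm_of_posDef hX) hN
  rw [← ha] at hXn hyn hZn he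
  rw [← hg] at he
  clear_value c₁ a g
  have hn1 : (1 : ℝ) ≤ n := by exact_mod_cast I.n_pos
  have hsn := mul_le_mul_of_nonneg_left (sqrt_natCast_le I.n_pos) hapos.le
  -- With `Ξ = X` and `lam = y` the proximal squares on the two sides coincide and cancel, leaving a
  -- bound on the traces that is independent of earlier estimates.
  rw [fnorm_sub_comm Xt X, vnorm_sub_comm yt y, add_le_add_iff_right] at he
  have hθ : 0 < μ / ρ ^ 2 := by positivity
  have hθ1 : μ / ρ ^ 2 ≤ 1 := by rw [div_le_one (by positivity)]; exact hμ1
  have h0 : 0 ≤ (1 - μ / ρ ^ 2) * (ip Xs Z + ip X Zs) :=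
    mul_nonneg (sub_nonneg.2 hθ1) (add_nonneg (ip_nonneg I.Xs_psd hZ.posSemidef)
      (ip_nonneg hX.posSemidef I.Zs_psd))
  have htr : X.trace + Z.trace ≤ c₁ * n := by
    rw [hc₁, div_mul_eq_mul_div, le_div_iff₀ hgρ]
    refine le_of_mul_le_mul_left ?_ hθ
    linarith
  have hXtr := fnorm_le_trace hX.posSemidef
  have hZtr := fnorm_le_trace hZ.posSemidef
  have hX0 := fnorm_nonneg X
  have hZ0 := fnorm_nonneg Z
  have hdiff : vnorm (y - yt) ≤ (c₁ + a) / K₁ * n := by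
    refine (I.adjBounds.vnorm_le _).trans ?_
    rw [div_mul_eq_mul_div]
    refine div_le_div_of_nonneg_right ?_ hK₁.le
    have h1 : P.adj (y - yt) = Zt - Z := by
      rw [sub_self, smul_zero] at heq
      rw [eq_sub_iff_add_eq, ← sub_eq_zero, ← heq]; abel
    rw [h1]
    have := fnorm_sub_le Zt Z
    linarith
  have hpos : 0 ≤ (c₁ + a) / K₁ * n := by positivity
  have hpos' : 0 ≤ c₁ * n := by positivity
  have hpos'' : 0 ≤ a * n := by positivity
  constructor
  · linarith
  · have h1 : y = yt + (y - yt) := by abel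
    rw [h1]
    have := vnorm_add_le yt (y - yt)
    linarith

/-- If the proximal estimates have norm `O(n)`, then so do the iterates, and their pairings with
the optimal solution are `O(n² μ)`. -/
theorem exists_iterate_bound (par : Params) {ρ Kstar Ky K₁ K₂ c₀ : ℝ} (hρ : 0 < ρ)
    (hKstar : 0 < Kstar) (hKy : 0 < Ky) (hK₁ : 0 < K₁) (hK₂ : 0 < K₂) (hc₀ : 0 < c₀) :
    ∃ c : ℝ, 0 < c ∧ ∀ {m n : ℕ} {P : SDP m n} {y₀ ys : Fin m → ℝ}
      {Xs Zs : Matrix (Fin n) (Fin n) ℝ}, Instance P ρ Kstar Ky K₁ K₂ y₀ Xs ys Zs →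
      ∀ {X Z Ξ : Matrix (Fin n) (Fin n) ℝ} {y lam : Fin m → ℝ} {μ : ℝ}, 0 < μ → μ ≤ ρ ^ 2 →
      mu X Z = μ → Ξ.IsSymm → fnorm Ξ ≤ c₀ * n → vnorm lam ≤ c₀ * n →
      P.Nbhd par ρ y₀ μ Ξ lam X y Z →
      fnorm X ≤ c * n ∧ vnorm y ≤ c * n ∧ fnorm Z ≤ c * n ∧
      X.trace + Z.trace ≤ c * (n : ℝ) ^ 2 ∧ ip Xs Z + ip X Zs ≤ c * (n : ℝ) ^ 2 * μ := by
  set a := refConst par ρ Kstar Ky K₁ with ha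
  set g := pertRadius par ρ with hg
  have hgρ : 0 < ρ - g := sub_pos.2 (pertRadius_lt par hρ)
  have hdpos := pertDual_pos par hρ hK₁
  have hapos : 0 < a := by rw [ha, refConst]; positivity
  set c₃ := ρ ^ 2 + 2 * a ^ 2 + ρ ^ 2 * (a + c₀) ^ 2 with hc₃
  have hc₃pos : 0 < c₃ := by positivity
  -- `q n` bounds the distance of `(X, y)` from the reference point; the `+ 1` gives `q - 1 ≤ q²`,
  -- so that no square root is needed.
  set q := 2 * c₃ / ρ ^ 2 + 1 with hq
  have hqpos : 0 < q := by positivity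
  set c₅ := a + K₂ * q + ρ ^ 2 * (a + q + c₀) with hc₅
  have hc₅pos : 0 < c₅ := by positivity
  set c₆ := 2 * (c₃ + Kstar * (a + q + c₅)) / ρ ^ 2 with hc₆
  have hc₆pos : 0 < c₆ := by positivity
  have hdp : 0 < c₃ / (ρ - g) := by positivity
  refine ⟨a + q + c₅ + c₃ / (ρ - g) + c₆, by positivity, ?_⟩
  intro m n P y₀ ys Xs Zs I X Z Ξ y lam μ hμ hμ1 hmu hΞ hΞn hlam hN
  have hX := hN.2.1
  have hZ := hN.2.2.1
  obtain ⟨Xt, yt, Zt, heq, hXn, hyn, hZn, he⟩ :=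
    I.exists_energy par hρ hKstar hKy hμ hμ1 hmu hΞ hN
  rw [← ha] at hXn hyn hZn he
  rw [← hg] at he
  clear_value c₆ c₅ q c₃ a g
  have hn1 : (1 : ℝ) ≤ n := by exact_mod_cast I.n_pos
  have hn2 : (n : ℝ) ≤ n ^ 2 := by nlinarith
  have hsn := mul_le_mul_of_nonneg_left (sqrt_natCast_le I.n_pos) hapos.le
  replace hXn := hXn.trans hsn
  replace hyn := hyn.trans hsn
  replace hZn := hZn.trans hsn
  set θ := μ / ρ ^ 2 with hθdef
  have hθ : 0 < θ := by positivity
  have hθ1 : θ ≤ 1 := by rw [hθdef, div_le_one (by positivity)]; exact hμ1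
  have hμθ : μ = θ * ρ ^ 2 := (div_mul_cancel₀ _ (by positivity)).symm
  clear_value θ
  have hI1 := ip_nonneg I.Xs_psd hZ.posSemidef
  have hI2 := ip_nonneg hX.posSemidef I.Zs_psd
  have hT1 := hX.posSemidef.trace_nonneg
  have hT2 := hZ.posSemidef.trace_nonneg
  have hD1 : fnorm (Xt - Ξ) ^ 2 ≤ ((a + c₀) * n) ^ 2 := by
    refine pow_le_pow_left₀ (fnorm_nonneg _) ?_ 2
    have := fnorm_sub_le Xt Ξ
    linarith
  have hD2 : vnorm (yt - lam) ^ 2 ≤ ((a + c₀) * n) ^ 2 := by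
    refine pow_le_pow_left₀ (vnorm_nonneg _) ?_ 2
    have := vnorm_sub_le yt lam
    linarith
  have hrhs : θ * (ρ ^ 2 + 2 * a ^ 2) * n + μ / 2 * (fnorm (Xt - Ξ) ^ 2 + vnorm (yt - lam) ^ 2) ≤
      θ * c₃ * n ^ 2 := by
    have h1 := mul_le_mul_of_nonneg_left (add_le_add hD1 hD2) (by positivity : 0 ≤ μ / 2)
    have h2 := mul_le_mul_of_nonneg_left hn2 (by positivity : 0 ≤ θ * (ρ ^ 2 + 2 * a ^ 2))
    have h3 : θ * c₃ * n ^ 2 = θ * (ρ ^ 2 + 2 * a ^ 2) * n ^ 2 +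
        μ / 2 * (((a + c₀) * n) ^ 2 + ((a + c₀) * n) ^ 2) := by
      rw [hc₃, hμθ]; ring
    linarith
  replace he := he.trans hrhs
  have hE1 : 0 ≤ (1 - θ) * (ip Xs Z + ip X Zs) :=
    mul_nonneg (sub_nonneg.2 hθ1) (add_nonneg hI1 hI2)
  have hE2 : 0 ≤ θ * (ρ - g) * (X.trace + Z.trace) := by positivity
  have hE3 : 0 ≤ μ / 2 * (fnorm (X - Xt) ^ 2 + vnorm (y - yt) ^ 2) := by positivity
  have hQ : fnorm (X - Xt) ^ 2 + vnorm (y - yt) ^ 2 ≤ (q * n) ^ 2 := by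
    have h1 : fnorm (X - Xt) ^ 2 + vnorm (y - yt) ^ 2 ≤ (q - 1) * n ^ 2 := by
      have h3 : θ * (ρ ^ 2 / 2) * ((q - 1) * n ^ 2) = θ * c₃ * n ^ 2 := by
        have h5 : (q - 1) * ρ ^ 2 = 2 * c₃ := by
          rw [hq, add_sub_cancel_right, div_mul_cancel₀ _ (by positivity)]
        linear_combination θ * n ^ 2 / 2 * h5
      have h2 : θ * (ρ ^ 2 / 2) * (fnorm (X - Xt) ^ 2 + vnorm (y - yt) ^ 2) ≤
          θ * (ρ ^ 2 / 2) * ((q - 1) * n ^ 2) := by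
        have h4 : θ * (ρ ^ 2 / 2) = μ / 2 := by rw [hμθ]; ring
        rw [h3, h4]
        linarith
      exact le_of_mul_le_mul_left h2 (by positivity)
    have hq1 : 1 ≤ q := by rw [hq, le_add_iff_nonneg_left]; positivity
    have h5 : q - 1 ≤ q ^ 2 := (sub_le_self q zero_le_one).trans (le_self_pow₀ hq1 two_ne_zero)
    calc _ ≤ (q - 1) * (n : ℝ) ^ 2 := h1
      _ ≤ q ^ 2 * (n : ℝ) ^ 2 := by gcongr
      _ = _ := by ring
  have hqn : 0 ≤ q * n := by positivity
  have hXd : fnorm (X - Xt) ≤ q * n :=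
    le_of_sq_le_sq ((le_add_of_nonneg_right (sq_nonneg _)).trans hQ) hqn
  have hyd : vnorm (y - yt) ≤ q * n :=
    le_of_sq_le_sq ((le_add_of_nonneg_left (sq_nonneg _)).trans hQ) hqn
  have hXb : fnorm X ≤ (a + q) * n := by
    have h1 : X = Xt + (X - Xt) := by abel
    rw [h1]
    have := fnorm_add_le Xt (X - Xt)
    linarith
  have hyb : vnorm y ≤ (a + q) * n := by
    have h1 : y = yt + (y - yt) := by abel
    rw [h1]
    have := vnorm_add_le yt (y - yt)
    linarith
  have hZb : fnorm Z ≤ c₅ * n := by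
    have h1 : Z = Zt - P.adj (y - yt) + μ • (X - Ξ) := by rw [← heq]; abel
    rw [h1]
    have h2 := fnorm_add_le (Zt - P.adj (y - yt)) (μ • (X - Ξ))
    have h3 := fnorm_sub_le Zt (P.adj (y - yt))
    have h4 := (I.adjBounds.upper (y - yt)).trans (mul_le_mul_of_nonneg_left hyd hK₂.le)
    have h5 : fnorm (μ • (X - Ξ)) ≤ ρ ^ 2 * ((a + q + c₀) * n) := by
      rw [fnorm_smul_of_nonneg hμ.le]
      refine mul_le_mul hμ1 ?_ (fnorm_nonneg _) (by positivity)
      have := fnorm_sub_le X Ξ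
      linarith
    rw [hc₅]
    linarith
  have hTb : X.trace + Z.trace ≤ c₃ / (ρ - g) * n ^ 2 := by
    rw [div_mul_eq_mul_div, le_div_iff₀ hgρ]
    refine le_of_mul_le_mul_left ?_ hθ
    linarith
  have hIb : ip Xs Z + ip X Zs ≤ c₆ * n ^ 2 * μ := by
    have h0 : c₆ * n ^ 2 * μ = 2 * θ * (c₃ + Kstar * (a + q + c₅)) * n ^ 2 := by
      rw [hc₆, hμθ]; field_simp
    rw [h0]
    have hsq := sqrt_natCast_le I.n_pos
    -- The weight `1 - θ` of the pairings degenerates as `θ → 1`. For `θ ≥ 1/2`, however, `μ` is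
    -- bounded below and the plain norm bounds suffice.
    rcases le_total θ (1 / 2) with h | h
    · have h1 : ip Xs Z + ip X Zs ≤ 2 * (θ * c₃ * n ^ 2) := by
        have h2 := mul_le_mul_of_nonneg_right h (add_nonneg hI1 hI2)
        linarith
      have h2 : 0 ≤ 2 * θ * (Kstar * (a + q + c₅)) * n ^ 2 := by positivity
      linarith
    · have h1 : ip Xs Z ≤ (Kstar * n) * (c₅ * n) := (ip_le _ _).trans
        (mul_le_mul (I.Xs_le.trans (by gcongr)) hZb (fnorm_nonneg _) (by positivity))
      have h2 : ip X Zs ≤ ((a + q) * n) * (Kstar * n) := (ip_le _ _).trans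
        (mul_le_mul hXb (I.Zs_le.trans (by gcongr)) (fnorm_nonneg _) (by positivity))
      have h3 : 0 ≤ 2 * θ * c₃ * n ^ 2 := by positivity
      have h4 : 0 ≤ Kstar * (a + q + c₅) * n ^ 2 := by positivity
      have h5 := mul_le_mul_of_nonneg_right h h4
      linarith
  have hA : ∀ {x y : ℝ} {N : ℝ}, 0 ≤ N → x ≤ y → x * N ≤ y * N :=
    fun h1 h2 => mul_le_mul_of_nonneg_right h2 h1
  have hn0 : (0 : ℝ) ≤ n := by positivity
  refine ⟨hXb.trans (hA hn0 ?_), hyb.trans (hA hn0 ?_), hZb.trans (hA hn0 ?_),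
    hTb.trans (hA (by positivity) ?_), hIb.trans (hA hμ.le (hA (by positivity) ?_))⟩ <;> linarith

end IterateBounds

/-! ### Bounds on the Newton direction -/

section Scaling

/-- `S` is a symmetric square root of `Z` with inverse `T`, and `S X S` is within relative
distance `γ` of `μ I`. -/
structure Scaling (S T X Z : Matrix (Fin n) (Fin n) ℝ) (μ γ : ℝ) : Prop where
  symmS : S.IsSymm
  symmT : T.IsSymm
  mul_inv : S * T = 1
  inv_mul : T * S = 1
  sq : S * S = Z
  symmX : X.IsSymm
  close : fnorm (S * X * S - μ • (1 : Matrix (Fin n) (Fin n) ℝ)) ≤ γ * μ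

theorem isSymm_conj {B M : Matrix (Fin n) (Fin n) ℝ} (hB : B.IsSymm) (hM : M.IsSymm) :
    (B * M * B).IsSymm := by
  rw [Matrix.IsSymm, Matrix.transpose_mul, Matrix.transpose_mul, hB.eq, hM.eq, mul_assoc]

theorem symmOp_eq {S T X Z : Matrix (Fin n) (Fin n) ℝ} (hS : S.IsSymm) (hX : X.IsSymm)
    (h1 : S * T = 1) (h2 : S * S = Z) (hT : S⁻¹ = T) : symmOp S (X * Z) = S * X * S := by
  have h3 : S * (X * Z) * S⁻¹ = S * X * S := by
    rw [hT, ← h2, mul_assoc, mul_assoc X, mul_assoc S S, h1, mul_one, ← mul_assoc]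
  rw [symmOp, h3, (isSymm_conj hS hX).eq]
  module

theorem SDP.Nbhd.scaling {P : SDP m n} {par : Params} {ρ μ : ℝ} {y₀ y lam : Fin m → ℝ}
    {X Z Ξ : Matrix (Fin n) (Fin n) ℝ} (h : P.Nbhd par ρ y₀ μ Ξ lam X y Z) :
    Scaling (CFC.sqrt Z) (CFC.sqrt Z)⁻¹ X Z μ par.γμ := by
  obtain ⟨-, hX, hZ, hc⟩ := h
  have hdet := isUnit_det_sqrt hZ
  have h1 := Matrix.mul_nonsing_inv _ hdet
  have h2 := sqrt_mul_sqrt hZ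
  rw [symmOp_eq (isSymm_sqrt Z) (isSymm_of_posDef hX) h1 h2 rfl] at hc
  exact ⟨isSymm_sqrt Z, (isSymm_sqrt Z).inv, h1, Matrix.nonsing_inv_mul _ hdet, h2,
    isSymm_of_posDef hX, hc⟩

theorem fnorm_conj_le {S : Matrix (Fin n) (Fin n) ℝ} (hS : S.IsSymm)
    (W : Matrix (Fin n) (Fin n) ℝ) : fnorm (S * W * S) ≤ (S * S).trace * fnorm W := by
  have h1 := fnorm_mul_le (S * W) S
  have h2 := mul_le_mul_of_nonneg_right (fnorm_mul_le S W) (fnorm_nonneg S)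
  have h3 : (S * S).trace = fnorm S ^ 2 := ip_self hS
  rw [h3]
  linarith

theorem fnorm_conj_le_ip {S W : Matrix (Fin n) (Fin n) ℝ} (hS : S.IsSymm) (hW : W.PosSemidef) :
    fnorm (S * W * S) ≤ ip W (S * S) := by
  refine (fnorm_le_trace (posSemidef_conj hS hW)).trans (le_of_eq ?_)
  rw [ip, mul_assoc, Matrix.trace_mul_comm, mul_assoc]

variable {S T X Z : Matrix (Fin n) (Fin n) ℝ} {μ γ : ℝ}

theorem Scaling.conj_cancel (h : Scaling S T X Z μ γ) (M : Matrix (Fin n) (Fin n) ℝ) :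
    T * (S * M * S) * T = M := by
  rw [mul_assoc S M S, ← mul_assoc T S, h.inv_mul, one_mul, mul_assoc, h.mul_inv, mul_one]

theorem Scaling.conj_cancel' (h : Scaling S T X Z μ γ) (M : Matrix (Fin n) (Fin n) ℝ) :
    S * (T * M * T) * S = M := by
  rw [mul_assoc T M T, ← mul_assoc S T, h.mul_inv, one_mul, mul_assoc, h.inv_mul, mul_one]

theorem Scaling.ip_conj (h : Scaling S T X Z μ γ) (U V : Matrix (Fin n) (Fin n) ℝ) :
    ip (S * U * S) (T * V * T) = ip U V := by
  have h1 : S * U * S * (T * V * T) = S * (U * V * T) := by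
    rw [mul_assoc (S * U), ← mul_assoc S, ← mul_assoc S, h.mul_inv, one_mul, mul_assoc S,
      ← mul_assoc U]
  rw [ip, h1, Matrix.trace_mul_comm, mul_assoc, h.inv_mul, mul_one, ip]

/-- Closeness gives `S X S ⪰ (1 - γ) μ I`; conjugation by `T` turns this into `X ⪰ (1 - γ) μ Z⁻¹`.
-/
theorem Scaling.inv_dominated (h : Scaling S T X Z μ γ) {W : Matrix (Fin n) (Fin n) ℝ}
    (hW : W.PosSemidef) : (1 - γ) * μ * ip W (T * T) ≤ ip X W := by
  have h1 := posSemidef_conj h.symmT (posSemidef_sub_smul_one (isSymm_conj h.symmS h.symmX) h.close)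
  rw [mul_sub, sub_mul, h.conj_cancel, Matrix.mul_smul, Matrix.smul_mul, mul_one] at h1
  have h2 := ip_nonneg h1 hW
  rw [ip_sub_left, ip_smul_left, ip_comm (T * T)] at h2
  linarith

theorem Scaling.fnorm_le (h : Scaling S T X Z μ γ) (hn : 0 < n) (hμ : 0 ≤ μ) (hγ : γ ≤ 1) :
    fnorm (S * X * S) ≤ 2 * n * μ := by
  have h1 : S * X * S = (S * X * S - μ • (1 : Matrix (Fin n) (Fin n) ℝ)) +
      μ • (1 : Matrix (Fin n) (Fin n) ℝ) := by abel
  rw [h1]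
  refine (fnorm_add_le _ _).trans ?_
  rw [fnorm_smul_of_nonneg hμ, fnorm_one]
  have h2 := mul_le_mul_of_nonneg_left (sqrt_natCast_le hn) hμ
  have h3 := h.close
  have h4 : (1 : ℝ) ≤ n := by exact_mod_cast hn
  have h5 := mul_le_mul_of_nonneg_right hγ hμ
  have h6 := mul_le_mul_of_nonneg_right h4 hμ
  linarith

/-- If `U + μ V` is at most `B + γ μ ‖V‖` and the pairing of `U` and `V` is almost nonnegative,
then `U` and `μ V` are both `O(B)`. -/
theorem fnorm_le_of_fnorm_add_le {U V : Matrix (Fin n) (Fin n) ℝ} {B : ℝ} (hU : U.IsSymm)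
    (hV : V.IsSymm) (hμ : 0 < μ) (hγ : 0 < γ) (hγ1 : γ < 1) (hB : 0 ≤ B)
    (h1 : fnorm (U + μ • V) ≤ B + γ * (μ * fnorm V)) (h2 : -B ^ 2 ≤ 2 * μ * ip U V) :
    fnorm U ≤ 2 * B / (1 - γ) ∧ μ * fnorm V ≤ 2 * B / (1 - γ) := by
  have hu := fnorm_nonneg U
  have hv : 0 ≤ μ * fnorm V := mul_nonneg hμ.le (fnorm_nonneg V)
  have h3 : fnorm (U + μ • V) ^ 2 = fnorm U ^ 2 + 2 * μ * ip U V + (μ * fnorm V) ^ 2 := by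
    rw [← ip_self (hU.add (hV.smul μ)), ip_add_left, ip_add_right, ip_add_right, ip_smul_right,
      ip_smul_left, ip_smul_left, ip_smul_right, ip_self hU, ip_self hV, ip_comm V U]
    ring
  have h4 := pow_le_pow_left₀ (fnorm_nonneg _) h1 2
  generalize fnorm U = u at *
  generalize μ * fnorm V = v at *
  -- The right-hand side is at most `(2 B + γ v)²`, and `γ < 1` allows `γ v` to be absorbed.
  have h5 : u ^ 2 + v ^ 2 ≤ (B + γ * v) ^ 2 + B ^ 2 := by linarith
  have hγv : 0 ≤ γ * v := mul_nonneg hγ.le hv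
  have h6 : (B + γ * v) ^ 2 + B ^ 2 ≤ (2 * B + γ * v) ^ 2 := by nlinarith
  have h7 : v ≤ 2 * B + γ * v := le_of_sq_le_sq (by nlinarith) (by positivity)
  have h8 : u ≤ 2 * B + γ * v := le_of_sq_le_sq (by nlinarith) (by positivity)
  have h9 : v ≤ 2 * B / (1 - γ) := by
    rw [le_div_iff₀ (by linarith)]; linarith
  refine ⟨h8.trans ?_, h9⟩
  rw [le_div_iff₀ (by linarith)] at h9 ⊢
  nlinarith

end Scaling

/-! ### A reference direction for the Newton system -/

section Newton

variable {P : SDP m n} {ρ Kstar Ky K₁ K₂ : ℝ} {y₀ : Fin m → ℝ}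
  {Xs : Matrix (Fin n) (Fin n) ℝ} {ys : Fin m → ℝ} {Zs : Matrix (Fin n) (Fin n) ℝ}

/-- A reference direction, with the same residuals as the Newton direction. -/
theorem Instance.exists_newton_reference (par : Params) (hρ : 0 < ρ)
    (I : Instance P ρ Kstar Ky K₁ K₂ y₀ Xs ys Zs) {s : State m n} (hμ : 0 < s.μ)
    (hΞ : s.Ξ.IsSymm) (hN : P.Nbhd par ρ y₀ s.μ s.Ξ s.lam s.X s.y s.Z) {σ : ℝ}
    (hσ : par.σmin ≤ σ) (hσ' : σ ≤ par.σmax) {Ed Eμ dX dZ : Matrix (Fin n) (Fin n) ℝ}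
    {εp dy : Fin m → ℝ} (hdX : dX.IsSymm) (hdZ : dZ.IsSymm)
    (hNew : P.Newton ρ y₀ s σ Ed εp Eμ dX dy dZ) (hacc : P.Accurate par ρ s.μ Ed εp Eμ) :
    ∃ (WX : Matrix (Fin n) (Fin n) ℝ) (wy : Fin m → ℝ) (WZ : Matrix (Fin n) (Fin n) ℝ),
      WX.IsSymm ∧ WZ.IsSymm ∧
      P.op dX + s.μ • dy = P.op ((1 - σ) • (Xs - s.X) + WX) ∧
      P.adj dy + dZ - s.μ • dX =
        P.adj ((1 - σ) • (ys - s.y) + wy) + ((1 - σ) • (Zs - s.Z) + WZ) ∧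
      fnorm WX ≤ 2 * pertRadius par ρ * (s.μ / ρ ^ 2) ∧
      vnorm wy ≤ 2 * pertDual par ρ K₁ * (s.μ / ρ ^ 2) ∧
      fnorm WZ ≤ 2 * pertRadius par ρ * (s.μ / ρ ^ 2) := by
  obtain ⟨⟨bt, Ct, h1, h2, h3, h4⟩, hX, hZ, -⟩ := hN
  obtain ⟨hN1, hN2, -⟩ := hNew
  obtain ⟨-, hA1, hA2⟩ := hacc
  rw [mu0_eq I.n_pos] at h1 h2 hN1 hN2 hA1 hA2
  set θ := s.μ / ρ ^ 2 with hθdef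
  have hθ : 0 < θ := by positivity
  have hsX := isSymm_of_posDef hX
  have hsZ := isSymm_of_posDef hZ
  have hCt := isSymm_perturbation hθ.ne' hsX hsZ hΞ h2
  have hσθ : σ * s.μ / ρ ^ 2 = σ * θ := by rw [hθdef]; ring
  rw [hσθ] at hN1 hN2
  have hgpos := pertRadius_pos par hρ
  have hdpos := pertDual_pos par hρ I.adjBounds.pos
  have hσ0 : 0 < σ := par.σmin_pos.trans_le hσ
  have hσ1 : σ ≤ 1 := by linarith [par.σmax_le]
  have hEd : Ed.IsSymm := by
    have e : Ed = (-(s.μ • dX) + P.adj dy + dZ) - ((P.C + (σ * θ) • P.Cbar ρ y₀) - P.adj s.y -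
        s.Z + (σ * s.μ) • (s.X - s.Ξ)) := by rw [hN1]; abel
    have hCb : (P.Cbar ρ y₀).IsSymm :=
      ((isSymm_adj P y₀).add (Matrix.isSymm_one.smul _)).sub P.C_symm
    rw [e]
    exact (((hdX.smul _).neg.add (isSymm_adj P _)).add hdZ).sub
      ((((P.C_symm.add (hCb.smul _)).sub (isSymm_adj P _)).sub hsZ).add ((hsX.sub hΞ).smul _))
  have hq : par.σmin / 4 ≤ 1 := by linarith
  have hs1 : P.snorm εp Ed < θ * pertRadius par ρ := by
    refine hA2.trans_lt ?_
    have e : par.σmin / (4 * ρ ^ 2) * par.γS * ρ * s.μ = par.σmin / 4 * (θ * (par.γS * ρ)) := by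
      rw [hθdef]; field_simp
    rw [e]
    have h5 : 0 < θ * (par.γS * ρ) := mul_pos hθ (mul_pos par.γS_pos hρ)
    have h6 := mul_lt_mul_of_pos_left (lt_pertRadius par hρ) hθ
    exact (mul_le_of_le_one_left h5.le hq).trans_lt h6
  have hp1 : pnorm εp Ed ≤ θ * par.KN := by
    refine hA1.trans ?_
    have e : par.σmin / (4 * ρ ^ 2) * par.KN * s.μ = par.σmin / 4 * (θ * par.KN) := by
      rw [hθdef]; field_simp
    rw [e]
    exact mul_le_of_le_one_left (mul_pos hθ par.KN_pos).le hq
  obtain ⟨Xh, yh, Zh, hXh, hZh, hop, hadj, hXn, hZn, hyn⟩ :=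
    I.adjBounds.exists_symm_of_snorm_lt hCt (h4.trans_lt (lt_pertRadius par hρ)) h3
  obtain ⟨Xe, ye, Ze, hXe, hZe, hope, hadje, hXen, hZen, hyen⟩ :=
    I.adjBounds.exists_symm_of_snorm_lt hEd hs1 hp1
  replace hyn : vnorm yh ≤ pertDual par ρ K₁ := hyn
  replace hyen : vnorm ye ≤ θ * pertDual par ρ K₁ := by
    rwa [← mul_add, mul_div_assoc] at hyen
  have hσθ0 : 0 ≤ σ * θ := by positivity
  have hσθ1 : σ * θ ≤ θ := mul_le_of_le_one_left hθ.le hσ1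
  -- Subtracting `σ` times the neighbourhood equations from the Newton equations cancels the
  -- proximal terms and the multiples of `b̄` and `C̄`. What remains is `1 - σ` times the
  -- infeasibility of the current point, the error, and `-σ θ` times the perturbation.
  refine ⟨Xe - (σ * θ) • Xh, ye - (σ * θ) • yh, Ze - (σ * θ) • Zh, hXe.sub (hXh.smul _),
    hZe.sub (hZh.smul _), ?_, ?_, ?_, ?_, ?_⟩
  · simp only [op_add, op_sub, op_smul, hop, hope, I.op_Xs]
    linear_combination (norm := module) hN2 - σ • h1
  · have e1 : P.adj yh = Ct - Zh := by rw [← hadj]; abel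
    have e2 : P.adj ye = Ed - Ze := by rw [← hadje]; abel
    have e3 : P.adj ys = P.C - Zs := by rw [← I.adj_ys]; abel
    simp only [adj_add, adj_sub, adj_smul, e1, e2, e3]
    linear_combination (norm := module) hN1 - σ • h2
  · refine (fnorm_sub_le _ _).trans ?_
    rw [fnorm_smul_of_nonneg hσθ0]
    have := mul_le_mul hσθ1 hXn (fnorm_nonneg _) hθ.le
    linarith
  · refine (vnorm_sub_le _ _).trans ?_
    rw [vnorm_smul_of_nonneg hσθ0]
    have := mul_le_mul hσθ1 hyn (vnorm_nonneg _) hθ.le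
    linarith
  · refine (fnorm_sub_le _ _).trans ?_
    rw [fnorm_smul_of_nonneg hσθ0]
    have := mul_le_mul hσθ1 hZn (fnorm_nonneg _) hθ.le
    linarith

end Newton

/-! ### Size of the Newton direction -/

section NewtonBound

theorem fnorm_half_anticomm_le (D E : Matrix (Fin n) (Fin n) ℝ) :
    fnorm ((1 / 2 : ℝ) • (D * E + E * D)) ≤ fnorm D * fnorm E := by
  rw [fnorm_smul_of_nonneg (by norm_num)]
  have h1 := fnorm_add_le (D * E) (E * D)
  have h2 := fnorm_mul_le D E
  have h3 := fnorm_mul_le E D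
  linarith

variable {S T X Z dX dZ dXr dZr : Matrix (Fin n) (Fin n) ℝ} {μ γ σ : ℝ}

theorem Scaling.complementarity_eq (h : Scaling S T X Z μ γ)
    (hN : S * dX * S + (1 / 2 : ℝ) • (T * dZ * X * S + S * X * dZ * T) =
      -(S * X * S) + (σ * μ) • (1 : Matrix (Fin n) (Fin n) ℝ)) :
    S * dX * S + (1 / 2 : ℝ) • ((T * dZ * T) * (S * X * S) + (S * X * S) * (T * dZ * T)) =
      -(S * X * S) + (σ * μ) • (1 : Matrix (Fin n) (Fin n) ℝ) := by
  rw [← hN]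
  have h1 : (T * dZ * T) * (S * X * S) = T * dZ * X * S := by
    rw [mul_assoc (T * dZ), mul_assoc S, ← mul_assoc T S, h.inv_mul, one_mul, mul_assoc (T * dZ)]
  have h2 : (S * X * S) * (T * dZ * T) = S * X * dZ * T := by
    rw [mul_assoc (S * X), mul_assoc T, ← mul_assoc S T, h.mul_inv, one_mul, mul_assoc (S * X)]
  rw [h1, h2]

/-- Write `S X S = μ I + E` with `‖E‖ ≤ γ μ`. For the differences `U`, `V` of the scaled directions,
the complementarity equation reads `U + μ V = (known terms) - (V E + E V)/2`, which is the situation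
of `fnorm_le_of_fnorm_add_le`. In `B`, the term `3 n μ` pays for `σ μ I` and `S X S`, and `2 q` for
the dual reference direction multiplied by `μ` and by `E`. -/
theorem Scaling.direction_bound (h : Scaling S T X Z μ γ) (hn : 0 < n) (hμ : 0 < μ) (hγ : 0 < γ)
    (hγ1 : γ < 1) (hσ : 0 ≤ σ) (hσ1 : σ ≤ 1) (hdX : dX.IsSymm) (hdZ : dZ.IsSymm)
    (hdXr : dXr.IsSymm) (hdZr : dZr.IsSymm)
    (hN : S * dX * S + (1 / 2 : ℝ) • (T * dZ * X * S + S * X * dZ * T) =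
      -(S * X * S) + (σ * μ) • (1 : Matrix (Fin n) (Fin n) ℝ))
    {B p q : ℝ} (hp : fnorm (S * dXr * S) ≤ p) (hq : μ * fnorm (T * dZr * T) ≤ q)
    (hB : 3 * n * μ + p + 2 * q ≤ B) (hip : -B ^ 2 ≤ 2 * μ * ip (dX - dXr) (dZ - dZr)) :
    fnorm (S * (dX - dXr) * S) ≤ 2 * B / (1 - γ) ∧
      μ * fnorm (T * (dZ - dZr) * T) ≤ 2 * B / (1 - γ) := by
  have hp0 := (fnorm_nonneg _).trans hp
  have hq0 := (mul_nonneg hμ.le (fnorm_nonneg _)).trans hq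
  have hnμ : 0 < 3 * n * μ := by positivity
  refine fnorm_le_of_fnorm_add_le (isSymm_conj h.symmS (hdX.sub hdXr))
    (isSymm_conj h.symmT (hdZ.sub hdZr)) hμ hγ hγ1 (by linarith) ?_ (by rwa [h.ip_conj])
  have hN' := h.complementarity_eq hN
  have hX' := h.fnorm_le hn hμ.le hγ1.le
  have hE := h.close
  have e1 : S * (dX - dXr) * S = S * dX * S - S * dXr * S := by rw [mul_sub, sub_mul]
  have e2 : T * (dZ - dZr) * T = T * dZ * T - T * dZr * T := by rw [mul_sub, sub_mul]
  rw [e1, e2]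
  generalize S * dX * S = A at *
  generalize S * dXr * S = R at *
  generalize T * dZ * T = D' at *
  generalize T * dZr * T = D at *
  generalize S * X * S = X' at *
  have e3 : A - R + μ • (D' - D) =
      (σ * μ) • (1 : Matrix (Fin n) (Fin n) ℝ) - X' - R -
        (1 / 2 : ℝ) • (D * (X' - μ • (1 : Matrix (Fin n) (Fin n) ℝ)) +
          (X' - μ • (1 : Matrix (Fin n) (Fin n) ℝ)) * D) - μ • D -
        (1 / 2 : ℝ) • ((D' - D) * (X' - μ • (1 : Matrix (Fin n) (Fin n) ℝ)) +
          (X' - μ • (1 : Matrix (Fin n) (Fin n) ℝ)) * (D' - D)) := by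
    simp only [mul_sub, sub_mul, Matrix.mul_smul, Matrix.smul_mul, mul_one, one_mul]
    linear_combination (norm := module) hN'
  rw [e3]
  set E := X' - μ • (1 : Matrix (Fin n) (Fin n) ℝ)
  have f1 := fnorm_half_anticomm_le D E
  have f2 := fnorm_half_anticomm_le (D' - D) E
  have f3 : fnorm ((σ * μ) • (1 : Matrix (Fin n) (Fin n) ℝ)) ≤ n * μ := by
    rw [fnorm_smul_of_nonneg (by positivity), fnorm_one]
    have h1 := mul_le_mul (mul_le_of_le_one_left hμ.le hσ1) (sqrt_natCast_le hn)
      (Real.sqrt_nonneg _) hμ.le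
    linarith
  have f4 : fnorm (μ • D) ≤ q := by rwa [fnorm_smul_of_nonneg hμ.le]
  have f5 : fnorm D * fnorm E ≤ q := by
    have h1 := mul_le_mul_of_nonneg_left hE (fnorm_nonneg D)
    have h2 : fnorm D * (γ * μ) ≤ μ * fnorm D := by
      have := mul_le_of_le_one_left (mul_nonneg hμ.le (fnorm_nonneg D)) hγ1.le
      linarith
    linarith
  have f6 : fnorm (D' - D) * fnorm E ≤ γ * (μ * fnorm (D' - D)) := by
    have h1 := mul_le_mul_of_nonneg_left hE (fnorm_nonneg (D' - D))
    linarith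
  refine (fnorm_sub_le _ _).trans (add_le_add ?_ (f2.trans f6))
  refine (fnorm_sub_le _ _).trans ?_
  refine (add_le_add_left (fnorm_sub_le _ _) _).trans ?_
  have g1 := fnorm_sub_le ((σ * μ) • (1 : Matrix (Fin n) (Fin n) ℝ) - X') R
  have g2 := fnorm_sub_le ((σ * μ) • (1 : Matrix (Fin n) (Fin n) ℝ)) X'
  linarith

/-- Bound for the scaled primal reference direction. -/
theorem Scaling.fnorm_primal_reference_le (h : Scaling S T X Z μ γ) (hn : 0 < n) (hμ : 0 ≤ μ)
    (hγ : γ ≤ 1) (hσ : 0 ≤ σ) (hσ1 : σ ≤ 1) {Xs W : Matrix (Fin n) (Fin n) ℝ}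
    (hXs : Xs.PosSemidef) :
    fnorm (S * ((1 - σ) • (Xs - X) + W) * S) ≤ ip Xs Z + 2 * n * μ + Z.trace * fnorm W := by
  have e : S * ((1 - σ) • (Xs - X) + W) * S =
      (1 - σ) • (S * Xs * S - S * X * S) + S * W * S := by
    simp only [mul_add, add_mul, mul_sub, sub_mul, Matrix.mul_smul, Matrix.smul_mul]
  rw [e]
  have h1 := fnorm_add_le ((1 - σ) • (S * Xs * S - S * X * S)) (S * W * S)
  have h2 := fnorm_conj_le h.symmS W
  have h3 := fnorm_conj_le_ip h.symmS hXs
  rw [h.sq] at h2 h3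
  have h4 := h.fnorm_le hn hμ hγ
  have h5 := fnorm_sub_le (S * Xs * S) (S * X * S)
  rw [fnorm_smul_of_nonneg (sub_nonneg.2 hσ1)] at h1
  have h6 := mul_le_of_le_one_left (fnorm_nonneg (S * Xs * S - S * X * S))
    (by linarith : 1 - σ ≤ 1)
  linarith

/-- Bound for the scaled dual reference direction. -/
theorem Scaling.fnorm_dual_reference_le (h : Scaling S T X Z μ γ) (hn : 0 < n) (hμ : 0 ≤ μ)
    (hγ : γ < 1) (hσ : 0 ≤ σ) (hσ1 : σ ≤ 1) {Zs W : Matrix (Fin n) (Fin n) ℝ}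
    (hZs : Zs.PosSemidef) :
    μ * fnorm (T * ((1 - σ) • (Zs - Z) + W) * T) ≤
      ip X Zs / (1 - γ) + n * μ + X.trace / (1 - γ) * fnorm W := by
  have e : T * ((1 - σ) • (Zs - Z) + W) * T =
      (1 - σ) • (T * Zs * T - 1) + T * W * T := by
    have hTZ : T * Z * T = 1 := by
      rw [← h.sq, ← mul_assoc, h.inv_mul, one_mul, h.mul_inv]
    simp only [mul_add, add_mul, mul_sub, sub_mul, Matrix.mul_smul, Matrix.smul_mul, hTZ]
  rw [e]
  have hγ' : 0 < 1 - γ := sub_pos.2 hγ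
  have h1 := fnorm_add_le ((1 - σ) • (T * Zs * T - 1)) (T * W * T)
  have h2 := fnorm_conj_le h.symmT W
  have h3 := fnorm_conj_le_ip h.symmT hZs
  have h5 := fnorm_sub_le (T * Zs * T) 1
  rw [fnorm_one] at h5
  rw [fnorm_smul_of_nonneg (sub_nonneg.2 hσ1)] at h1
  have h6 := mul_le_of_le_one_left (fnorm_nonneg (T * Zs * T - 1)) (by linarith : 1 - σ ≤ 1)
  -- `T T = Z⁻¹` has no bound of its own; `μ Z⁻¹` is dominated by `X / (1 - γ)`.
  have h7 : μ * ip Zs (T * T) ≤ ip X Zs / (1 - γ) := by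
    rw [le_div_iff₀ hγ']
    have := h.inv_dominated hZs
    linarith
  have h8 : μ * (T * T).trace ≤ X.trace / (1 - γ) := by
    rw [le_div_iff₀ hγ']
    have := h.inv_dominated Matrix.PosSemidef.one
    rw [ip_one_left, ip_one_right] at this
    linarith
  have h9 := mul_le_mul_of_nonneg_right h8 (fnorm_nonneg W)
  have h10 : fnorm ((1 - σ) • (T * Zs * T - 1) + T * W * T) ≤
      ip Zs (T * T) + n + (T * T).trace * fnorm W := by
    have := sqrt_natCast_le hn
    linarith
  have h11 := mul_le_mul_of_nonneg_left h10 hμ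
  linarith

/-- The Newton direction is `O(n²)`, in the original and in the scaled variables. -/
theorem exists_newton_bound (par : Params) {ρ Kstar K₁ c₁ : ℝ} (Ky K₂ : ℝ) (hρ : 0 < ρ)
    (hKstar : 0 < Kstar) (hK₁ : 0 < K₁) (hc₁ : 0 < c₁) :
    ∃ c : ℝ, 0 < c ∧ ∀ {m n : ℕ} {P : SDP m n} {y₀ ys : Fin m → ℝ}
      {Xs Zs : Matrix (Fin n) (Fin n) ℝ}, Instance P ρ Kstar Ky K₁ K₂ y₀ Xs ys Zs →
      ∀ {s : State m n}, 0 < s.μ → s.μ ≤ ρ ^ 2 → s.Ξ.IsSymm →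
      P.Nbhd par ρ y₀ s.μ s.Ξ s.lam s.X s.y s.Z →
      fnorm s.X ≤ c₁ * n → vnorm s.y ≤ c₁ * n →
      s.X.trace + s.Z.trace ≤ c₁ * (n : ℝ) ^ 2 →
      ip Xs s.Z + ip s.X Zs ≤ c₁ * (n : ℝ) ^ 2 * s.μ →
      ∀ {σ : ℝ}, par.σmin ≤ σ → σ ≤ par.σmax →
      ∀ {Ed Eμ dX dZ : Matrix (Fin n) (Fin n) ℝ} {εp dy : Fin m → ℝ}, dX.IsSymm → dZ.IsSymm →
      P.Newton ρ y₀ s σ Ed εp Eμ dX dy dZ → P.Accurate par ρ s.μ Ed εp Eμ →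
      fnorm (CFC.sqrt s.Z * dX * CFC.sqrt s.Z) ≤ c * (n : ℝ) ^ 2 * s.μ ∧
      fnorm ((CFC.sqrt s.Z)⁻¹ * dZ * (CFC.sqrt s.Z)⁻¹) ≤ c * (n : ℝ) ^ 2 ∧
      fnorm dX ≤ c * (n : ℝ) ^ 2 ∧ vnorm dy ≤ c * (n : ℝ) ^ 2 := by
  have hγ := par.γμ_pos
  have hγ1 := par.γμ_lt
  have hδ : 0 < 1 - par.γμ := sub_pos.2 hγ1
  obtain ⟨g, hg, hgpos⟩ : ∃ g, pertRadius par ρ = g ∧ 0 < g := ⟨_, rfl, pertRadius_pos par hρ⟩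
  obtain ⟨d, hd, hdpos⟩ : ∃ d, pertDual par ρ K₁ = d ∧ 0 < d := ⟨_, rfl, pertDual_pos par hρ hK₁⟩
  obtain ⟨δ, hδdef⟩ : ∃ δ, 1 - par.γμ = δ := ⟨_, rfl⟩
  rw [hδdef] at hδ
  -- `r n` bounds the reference direction, `p₀ n² μ` and `q₀ n² μ` its scaled parts, and `β n² μ`
  -- plays the role of `B` in `Scaling.direction_bound`.
  obtain ⟨r, hr⟩ : ∃ r, r = Kstar + c₁ + 2 * g + 2 * d := ⟨_, rfl⟩
  obtain ⟨p₀, hp₀⟩ : ∃ p₀, p₀ = c₁ + 2 + c₁ * (2 * g / ρ ^ 2) := ⟨_, rfl⟩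
  obtain ⟨q₀, hq₀⟩ : ∃ q₀, q₀ = c₁ / δ + 1 + c₁ / δ * (2 * g / ρ ^ 2) := ⟨_, rfl⟩
  obtain ⟨β, hβ⟩ : ∃ β, β = 3 + p₀ + 2 * q₀ + 2 * r := ⟨_, rfl⟩
  have hrpos : 0 < r := by rw [hr]; positivity
  have hp₀pos : 0 < p₀ := by rw [hp₀]; positivity
  have hq₀pos : 0 < q₀ := by rw [hq₀]; positivity
  have hβpos : 0 < β := by rw [hβ]; positivity
  refine ⟨2 * β / δ + β + 2 * (2 * β / δ + r) + r, by positivity, ?_⟩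
  intro m n P y₀ ys Xs Zs I s hμ hμ1 hΞ hN hXb hyb hTb hIb σ hσ hσ' Ed Eμ dX dZ εp dy hdX hdZ
    hNew hacc
  obtain ⟨WX, wy, WZ, hWX, hWZ, hop, hadj, hWXn, hwyn, hWZn⟩ :=
    I.exists_newton_reference par hρ hμ hΞ hN hσ hσ' hdX hdZ hNew hacc
  rw [hg] at hWXn hWZn
  rw [hd] at hwyn
  have hsc := hN.scaling
  have hn := I.n_pos
  have hσ0 : 0 ≤ σ := (par.σmin_pos.trans_le hσ).le
  have hσ1 : σ ≤ 1 := by linarith [par.σmax_le]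
  have hX := hN.2.1
  have hZ := hN.2.2.1
  have hnewt := hNew.2.2
  rw [fnorm_eq_zero.1 hacc.1, add_zero] at hnewt
  set S := CFC.sqrt s.Z
  set T := S⁻¹
  clear_value T S
  set μ := s.μ
  clear_value μ
  clear hN hNew hacc
  set dXr := (1 - σ) • (Xs - s.X) + WX with hdXr
  set dyr := (1 - σ) • (ys - s.y) + wy with hdyr
  set dZr := (1 - σ) • (Zs - s.Z) + WZ with hdZr
  have hn1 : (1 : ℝ) ≤ n := by exact_mod_cast hn
  have hn2 : (n : ℝ) ≤ n ^ 2 := by rw [sq]; exact le_mul_of_one_le_left (by positivity) hn1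
  have hsX := isSymm_of_posDef hX
  have hsZ := isSymm_of_posDef hZ
  have hdXrs : dXr.IsSymm := (((isSymm_of_posSemidef I.Xs_psd).sub hsX).smul _).add hWX
  have hdZrs : dZr.IsSymm := (((isSymm_of_posSemidef I.Zs_psd).sub hsZ).smul _).add hWZ
  have hθ1 : μ / ρ ^ 2 ≤ 1 := by rw [div_le_one (by positivity)]; exact hμ1
  have hT1 := hX.posSemidef.trace_nonneg
  have hT2 := hZ.posSemidef.trace_nonneg
  have hI1 := ip_nonneg I.Xs_psd hZ.posSemidef
  have hI2 := ip_nonneg hX.posSemidef I.Zs_psd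
  have hnμ : n * μ ≤ n ^ 2 * μ := mul_le_mul_of_nonneg_right hn2 hμ.le
  have hpn : fnorm (S * dXr * S) ≤ p₀ * (n ^ 2 * μ) := by
    refine (hsc.fnorm_primal_reference_le hn hμ.le hγ1.le hσ0 hσ1 I.Xs_psd).trans ?_
    have h1 : s.Z.trace * fnorm WX ≤ c₁ * n ^ 2 * (2 * g * (μ / ρ ^ 2)) :=
      mul_le_mul (by linarith) hWXn (fnorm_nonneg _) (by positivity)
    have h2 : p₀ * (n ^ 2 * μ) = c₁ * n ^ 2 * μ + 2 * (n ^ 2 * μ) +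
        c₁ * n ^ 2 * (2 * g * (μ / ρ ^ 2)) := by rw [hp₀]; ring
    rw [h2]
    linarith
  have hqn : μ * fnorm (T * dZr * T) ≤ q₀ * (n ^ 2 * μ) := by
    refine (hsc.fnorm_dual_reference_le hn hμ.le hγ1 hσ0 hσ1 I.Zs_psd).trans ?_
    rw [hδdef]
    have h0 : ip s.X Zs / δ ≤ c₁ * n ^ 2 * μ / δ := by gcongr; linarith
    have h1 : s.X.trace / δ * fnorm WZ ≤ c₁ * n ^ 2 / δ * (2 * g * (μ / ρ ^ 2)) := by
      refine mul_le_mul ?_ hWZn (fnorm_nonneg _) (by positivity)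
      gcongr; linarith
    have h2 : q₀ * (n ^ 2 * μ) = c₁ * n ^ 2 * μ / δ + n ^ 2 * μ +
        c₁ * n ^ 2 / δ * (2 * g * (μ / ρ ^ 2)) := by rw [hq₀]; ring
    rw [h2]
    linarith
  have hσc : 0 ≤ 1 - σ := sub_nonneg.2 hσ1
  have hσc1 : 1 - σ ≤ 1 := by linarith
  have hKs : Kstar * √(n : ℝ) ≤ Kstar * n := mul_le_mul_of_nonneg_left (sqrt_natCast_le hn) hKstar.le
  have hsm : ∀ {x : ℝ}, 0 ≤ x → 2 * x * (μ / ρ ^ 2) ≤ 2 * x * n := fun {x} hx =>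
    mul_le_mul_of_nonneg_left (hθ1.trans hn1) (by linarith)
  have hgn : 0 ≤ g * n := by positivity
  have hdn : 0 ≤ d * n := by positivity
  have hXrn : fnorm dXr ≤ r * n := by
    have h1 := fnorm_add_le ((1 - σ) • (Xs - s.X)) WX
    rw [fnorm_smul_of_nonneg hσc] at h1
    have h2 := mul_le_of_le_one_left (fnorm_nonneg (Xs - s.X)) hσc1
    have h3 := fnorm_sub_le Xs s.X
    have h4 := I.Xs_le
    have h5 := hsm hgpos.le
    rw [hr]
    linarith
  have hyrn : vnorm dyr ≤ r * n := by
    have h1 := vnorm_add_le ((1 - σ) • (ys - s.y)) wy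
    rw [vnorm_smul_of_nonneg hσc] at h1
    have h2 := mul_le_of_le_one_left (vnorm_nonneg (ys - s.y)) hσc1
    have h3 := vnorm_sub_le ys s.y
    have h4 := I.ys_le
    have h5 := hsm hdpos.le
    rw [hr]
    linarith
  -- Directions satisfy the regularized equations with proximal estimates `0`.
  have hge := ip_sub_sub_ge (Ξ := 0) (lam := 0) hμ.le hdX hdXrs (by rw [sub_zero]; exact hop)
    (by rw [sub_zero]; exact hadj)
  rw [sub_zero, sub_zero] at hge
  have hD1 := pow_le_pow_left₀ (fnorm_nonneg _) hXrn 2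
  have hD2 := pow_le_pow_left₀ (vnorm_nonneg _) hyrn 2
  have hD : μ / 2 * (fnorm dXr ^ 2 + vnorm dyr ^ 2) ≤ μ * (r * n) ^ 2 := by
    have := mul_le_mul_of_nonneg_left (add_le_add hD1 hD2) (by positivity : 0 ≤ μ / 2)
    linarith
  have hQ0 : 0 ≤ μ / 2 * (fnorm (dX - dXr) ^ 2 + vnorm (dy - dyr) ^ 2) := by positivity
  have hip : -(β * (n ^ 2 * μ)) ^ 2 ≤ 2 * μ * ip (dX - dXr) (dZ - dZr) := by
    have h1 : -(μ * (r * n) ^ 2) ≤ ip (dX - dXr) (dZ - dZr) := by linarith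
    have h2 := mul_le_mul_of_nonneg_left h1 (by positivity : 0 ≤ 2 * μ)
    have h3 : 2 * r * n * μ ≤ β * (n ^ 2 * μ) := by
      have h4 : 2 * r ≤ β := by rw [hβ]; linarith
      have := mul_le_mul h4 hnμ (by positivity) hβpos.le
      linarith
    have h4 := pow_le_pow_left₀ (by positivity) h3 2
    have h5 : 0 ≤ (r * n * μ) ^ 2 := by positivity
    linarith
  obtain ⟨hu, hv⟩ := hsc.direction_bound hn hμ hγ hγ1 hσ0 hσ1 hdX hdZ hdXrs hdZrs hnewt hpn hqn
    (B := β * (n ^ 2 * μ)) (by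
      rw [hβ]
      have : 0 ≤ r * (n ^ 2 * μ) := by positivity
      linarith) hip
  rw [hδdef] at hu hv
  have hu' : fnorm (S * (dX - dXr) * S) ≤ 2 * β / δ * n ^ 2 * μ :=
    hu.trans (le_of_eq (by ring))
  have hv' : fnorm (T * (dZ - dZr) * T) ≤ 2 * β / δ * n ^ 2 := by
    refine le_of_mul_le_mul_left (hv.trans (le_of_eq ?_)) hμ
    ring
  have hpβ : p₀ ≤ β := by rw [hβ]; linarith
  have hqβ : q₀ ≤ β := by rw [hβ]; linarith
  have hb0 : 0 < 2 * β / δ := by positivity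
  have hN0 : (0 : ℝ) ≤ n ^ 2 := by positivity
  have hMn : ∀ {x y : ℝ}, x ≤ y → x * (n : ℝ) ^ 2 ≤ y * n ^ 2 := fun h =>
    mul_le_mul_of_nonneg_right h hN0
  -- The scaled bounds limit the pairing from above, since it is invariant under scaling; the
  -- monotonicity inequality then bounds the unscaled differences.
  have hQ : fnorm (dX - dXr) ^ 2 + vnorm (dy - dyr) ^ 2 ≤ (2 * (2 * β / δ + r) * n ^ 2) ^ 2 := by
    have h1 : ip (dX - dXr) (dZ - dZr) ≤ μ * (2 * β / δ * n ^ 2) ^ 2 := by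
      rw [← hsc.ip_conj]
      refine (ip_le _ _).trans ((mul_le_mul hu' hv' (fnorm_nonneg _) (by positivity)).trans
        (le_of_eq ?_))
      ring
    have h2 : μ / 2 * (fnorm (dX - dXr) ^ 2 + vnorm (dy - dyr) ^ 2) ≤
        μ / 2 * (2 * ((2 * β / δ * n ^ 2) ^ 2 + (r * n) ^ 2)) := by linarith
    have h3 := le_of_mul_le_mul_left h2 (by positivity)
    have h4 : (r * n) ^ 2 ≤ (r * n ^ 2) ^ 2 :=
      pow_le_pow_left₀ (by positivity) (mul_le_mul_of_nonneg_left hn2 hrpos.le) 2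
    have h5 : 0 ≤ (2 * β / δ * n ^ 2) * (r * n ^ 2) := by positivity
    have h6 : 0 ≤ (2 * β / δ * n ^ 2) ^ 2 := by positivity
    have h7 : 0 ≤ (r * n ^ 2) ^ 2 := by positivity
    generalize 2 * β / δ = b at *
    nlinarith only [h3, h4, h5, h6, h7]
  have hR0 : 0 ≤ 2 * (2 * β / δ + r) * n ^ 2 := by positivity
  have hXd : fnorm (dX - dXr) ≤ 2 * (2 * β / δ + r) * n ^ 2 :=
    le_of_sq_le_sq ((le_add_of_nonneg_right (sq_nonneg _)).trans hQ) hR0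
  have hyd : vnorm (dy - dyr) ≤ 2 * (2 * β / δ + r) * n ^ 2 :=
    le_of_sq_le_sq ((le_add_of_nonneg_left (sq_nonneg _)).trans hQ) hR0
  have hrn := mul_le_mul_of_nonneg_left hn2 hrpos.le
  refine ⟨?_, ?_, ?_, ?_⟩
  · have h1 : S * dX * S = S * (dX - dXr) * S + S * dXr * S := by
      rw [mul_sub, sub_mul, sub_add_cancel]
    rw [h1]
    refine (fnorm_add_le _ _).trans ((add_le_add hu' (hpn.trans
      (mul_le_mul_of_nonneg_right hpβ (by positivity)))).trans ?_)
    have : 0 ≤ (2 * (2 * β / δ + r) + r) * n ^ 2 * μ := by positivity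
    linarith
  · have h1 : T * dZ * T = T * (dZ - dZr) * T + T * dZr * T := by
      rw [mul_sub, sub_mul, sub_add_cancel]
    rw [h1]
    have h2 : fnorm (T * dZr * T) ≤ q₀ * n ^ 2 := by
      refine le_of_mul_le_mul_left (hqn.trans (le_of_eq ?_)) hμ
      ring
    refine (fnorm_add_le _ _).trans ((add_le_add hv' (h2.trans (hMn hqβ))).trans ?_)
    have : 0 ≤ (2 * (2 * β / δ + r) + r) * n ^ 2 := by positivity
    linarith
  · have h1 : dX = (dX - dXr) + dXr := by abel
    rw [h1]
    refine (fnorm_add_le _ _).trans ((add_le_add hXd (hXrn.trans hrn)).trans ?_)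
    have : 0 ≤ (2 * β / δ + β) * n ^ 2 := by positivity
    linarith
  · have h1 : dy = (dy - dyr) + dyr := by abel
    rw [h1]
    refine (vnorm_add_le _ _).trans ((add_le_add hyd (hyrn.trans hrn)).trans ?_)
    have : 0 ≤ (2 * β / δ + β) * n ^ 2 := by positivity
    linarith

end NewtonBound

/-! ### The step-length -/

section StepLength

/-- The squared norm of the symmetric part is the average of `Tr W²` and `‖W‖²`, and `Tr W² ≤ ‖W‖²`.
-/
theorem trace_mul_self_le (W : Matrix (Fin n) (Fin n) ℝ) :
    (W * W).trace ≤ fnorm ((1 / 2 : ℝ) • (W + Wᵀ)) ^ 2 := by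
  have hs : ((1 / 2 : ℝ) • (W + Wᵀ)).IsSymm := by
    simp [Matrix.IsSymm, add_comm]
  have h1 : ip Wᵀ Wᵀ = ip W W := by
    rw [ip, ← Matrix.transpose_mul, Matrix.trace_transpose, ip]
  have h2 : ip Wᵀ W = fnorm W ^ 2 := (fnorm_sq W).symm
  have h3 : ip W W ≤ fnorm W ^ 2 := by rw [sq]; exact ip_le W W
  rw [← ip_self hs, ip_smul_left, ip_smul_right, ip_add_left, ip_add_right, ip_add_right, h1, h2,
    ip_comm W Wᵀ, h2]
  change ip W W ≤ _
  linarith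

theorem trace_conj_mul_self {Q R N : Matrix (Fin n) (Fin n) ℝ} (h : R * Q = 1) :
    ((Q * N * R) * (Q * N * R)).trace = (N * N).trace := by
  have h1 : (Q * N * R) * (Q * N * R) = Q * (N * N * R) := by
    rw [mul_assoc (Q * N), mul_assoc Q N R, ← mul_assoc R Q, h, one_mul, mul_assoc Q N, mul_assoc N]
  rw [h1, Matrix.trace_mul_comm, mul_assoc, h, mul_one]

/-- The proximity to the central path can be measured with any similarity transform. -/
theorem fnorm_symm_conj_le {Sa Ta S T X Z : Matrix (Fin n) (Fin n) ℝ} (hSa : Sa.IsSymm)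
    (hX : X.IsSymm) (h1 : Sa * Ta = 1) (h2 : Ta * Sa = 1) (h3 : Sa * Sa = Z) (h4 : S * T = 1)
    (h5 : T * S = 1) (t : ℝ) :
    fnorm (Sa * X * Sa - t • (1 : Matrix (Fin n) (Fin n) ℝ)) ≤
      fnorm ((1 / 2 : ℝ) • (S * X * Z * T + (S * X * Z * T)ᵀ) -
        t • (1 : Matrix (Fin n) (Fin n) ℝ)) := by
  refine le_of_sq_le_sq ?_ (fnorm_nonneg _)
  have hs : (Sa * X * Sa - t • (1 : Matrix (Fin n) (Fin n) ℝ)).IsSymm :=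
    (isSymm_conj hSa hX).sub (Matrix.isSymm_one.smul t)
  -- Both sides come from conjugates of `N`. The left one is symmetric, so its squared norm is `Tr
  -- N²`, a similarity invariant. Thus the root of the new `Z` can be replaced by the old one.
  set N := X * Z - t • (1 : Matrix (Fin n) (Fin n) ℝ) with hN
  have e1 : Sa * X * Sa - t • (1 : Matrix (Fin n) (Fin n) ℝ) = Sa * N * Ta := by
    rw [hN, mul_sub, sub_mul, Matrix.mul_smul, Matrix.smul_mul, mul_one, h1, ← h3]
    congr 1
    rw [← mul_assoc X, ← mul_assoc Sa, ← mul_assoc Sa, mul_assoc (Sa * X * Sa), h1, mul_one]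
  have e2 : S * X * Z * T - t • (1 : Matrix (Fin n) (Fin n) ℝ) = S * N * T := by
    rw [hN, mul_sub, sub_mul, Matrix.mul_smul, Matrix.smul_mul, mul_one, h4, ← mul_assoc S]
  have e3 : (1 / 2 : ℝ) • (S * X * Z * T + (S * X * Z * T)ᵀ) -
      t • (1 : Matrix (Fin n) (Fin n) ℝ) = (1 / 2 : ℝ) • (S * N * T + (S * N * T)ᵀ) := by
    rw [← e2, Matrix.transpose_sub, Matrix.transpose_smul, Matrix.transpose_one]
    module
  rw [← ip_self hs, e1, e3, ip, trace_conj_mul_self h2, ← trace_conj_mul_self h5]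
  exact trace_mul_self_le _

variable {S T X Z dX dZ : Matrix (Fin n) (Fin n) ℝ} {μ γ σ α : ℝ}

theorem Scaling.ip_add_ip_eq (h : Scaling S T X Z μ γ)
    (hN : S * dX * S + (1 / 2 : ℝ) • (T * dZ * X * S + S * X * dZ * T) =
      -(S * X * S) + (σ * μ) • (1 : Matrix (Fin n) (Fin n) ℝ)) :
    ip dX Z + ip X dZ = -ip X Z + σ * μ * n := by
  have hc := congrArg Matrix.trace (h.complementarity_eq hN)
  simp only [Matrix.trace_add, Matrix.trace_smul, Matrix.trace_neg, Matrix.trace_one,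
    Fintype.card_fin, smul_eq_mul] at hc
  have e1 (M : Matrix (Fin n) (Fin n) ℝ) : (S * M * S).trace = ip M Z := by
    rw [← h.sq, ip, mul_assoc, Matrix.trace_mul_comm, mul_assoc]
  have e2 := h.ip_conj X dZ
  have e3 := ip_comm (T * dZ * T) (S * X * S)
  rw [e1, e1] at hc
  rw [ip] at e2
  rw [ip, ip] at e3
  rw [e3, e2] at hc
  linarith

theorem Scaling.mu_step (h : Scaling S T X Z μ γ) (hn : 0 < n) (hmu : mu X Z = μ)
    (hN : S * dX * S + (1 / 2 : ℝ) • (T * dZ * X * S + S * X * dZ * T) =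
      -(S * X * S) + (σ * μ) • (1 : Matrix (Fin n) (Fin n) ℝ)) (α : ℝ) :
    mu (X + α • dX) (Z + α • dZ) = (1 - α * (1 - σ)) * μ + α ^ 2 * (ip dX dZ / n) := by
  have h1 := h.ip_add_ip_eq hN
  have h2 := ip_eq_mul_mu hn X Z
  rw [hmu] at h2
  have h3 : (n : ℝ) ≠ 0 := by positivity
  rw [mu_eq_ip, ip_add_left, ip_add_right, ip_add_right, ip_smul_left, ip_smul_left, ip_smul_right,
    ip_smul_right]
  rw [div_eq_iff h3]
  have h4 : ((1 - α * (1 - σ)) * μ + α ^ 2 * (ip dX dZ / n)) * n =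
      (1 - α * (1 - σ)) * μ * n + α ^ 2 * ip dX dZ := by field_simp
  rw [h4]
  linear_combination α * h1 + (1 - α) * h2

/-- The product equals `(S X S + α A)(I + α D)` with `A`, `D` the scaled directions. The Newton
equation evaluates the symmetrized linear part, and only the `α²` term is left over. -/
theorem Scaling.symm_part_step (h : Scaling S T X Z μ γ) (hdX : dX.IsSymm) (hdZ : dZ.IsSymm)
    (hN : S * dX * S + (1 / 2 : ℝ) • (T * dZ * X * S + S * X * dZ * T) =
      -(S * X * S) + (σ * μ) • (1 : Matrix (Fin n) (Fin n) ℝ)) (α : ℝ) :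
    (1 / 2 : ℝ) • (S * (X + α • dX) * (Z + α • dZ) * T +
        (S * (X + α • dX) * (Z + α • dZ) * T)ᵀ) =
      (1 - α) • (S * X * S) + (α * (σ * μ)) • (1 : Matrix (Fin n) (Fin n) ℝ) +
        α ^ 2 • ((1 / 2 : ℝ) • ((S * dX * S) * (T * dZ * T) + (T * dZ * T) * (S * dX * S))) := by
  have hc := h.complementarity_eq hN
  have hTZ : T * Z * T = 1 := by
    rw [← h.sq, ← mul_assoc, h.inv_mul, one_mul, h.mul_inv]
  have e1 : S * (X + α • dX) * (Z + α • dZ) * T =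
      (S * X * S + α • (S * dX * S)) * (1 + α • (T * dZ * T)) := by
    have f1 : S * X * S + α • (S * dX * S) = S * (X + α • dX) * S := by
      simp only [mul_add, add_mul, Matrix.mul_smul, Matrix.smul_mul]
    have f2 : 1 + α • (T * dZ * T) = T * (Z + α • dZ) * T := by
      simp only [mul_add, add_mul, Matrix.mul_smul, Matrix.smul_mul, hTZ]
    rw [f1, f2, mul_assoc (S * (X + α • dX)) S, mul_assoc T, ← mul_assoc S T, h.mul_inv, one_mul,
      mul_assoc (S * (X + α • dX))]
  have s1 := isSymm_conj h.symmS h.symmX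
  have s2 := isSymm_conj h.symmS hdX
  have s3 := isSymm_conj h.symmT hdZ
  rw [e1, Matrix.transpose_mul, Matrix.transpose_add, Matrix.transpose_add, Matrix.transpose_smul,
    Matrix.transpose_smul, Matrix.transpose_one, s1.eq, s2.eq, s3.eq]
  generalize S * X * S = X' at *
  generalize S * dX * S = A at *
  generalize T * dZ * T = D at *
  simp only [mul_add, add_mul, Matrix.mul_smul, Matrix.smul_mul, mul_one, one_mul]
  linear_combination (norm := module) α • hc

theorem Scaling.posDef_of_conj (h : Scaling S T X Z μ γ) {M : Matrix (Fin n) (Fin n) ℝ}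
    (hM : M.IsSymm) {t : ℝ} (hlt : fnorm (S * M * S - t • (1 : Matrix (Fin n) (Fin n) ℝ)) < t) :
    M.PosDef := by
  rw [← h.conj_cancel M]
  exact posDef_conj h.symmT (Matrix.isUnit_det_of_left_inverse h.mul_inv)
    (posDef_of_fnorm_sub_lt (isSymm_conj h.symmS hM) hlt)

theorem Scaling.posDef_of_conj' (h : Scaling S T X Z μ γ) {M : Matrix (Fin n) (Fin n) ℝ}
    (hM : M.IsSymm) {t : ℝ} (hlt : fnorm (T * M * T - t • (1 : Matrix (Fin n) (Fin n) ℝ)) < t) :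
    M.PosDef := by
  rw [← h.conj_cancel' M]
  exact posDef_conj h.symmS (Matrix.isUnit_det_of_left_inverse h.inv_mul)
    (posDef_of_fnorm_sub_lt (isSymm_conj h.symmT hM) hlt)

/-- A step of length `α` along a direction whose scaled parts have product at most `q` keeps the
iterates in the neighbourhood of the central path. -/
theorem Scaling.step_centrality (h : Scaling S T X Z μ γ) (hn : 0 < n)
    (hmu : mu X Z = μ) (hγ : 0 < γ) (hγ1 : γ < 1) (hdX : dX.IsSymm) (hdZ : dZ.IsSymm)
    (hN : S * dX * S + (1 / 2 : ℝ) • (T * dZ * X * S + S * X * dZ * T) =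
      -(S * X * S) + (σ * μ) • (1 : Matrix (Fin n) (Fin n) ℝ))
    (hα : 0 ≤ α) (hα1 : α ≤ 1)
    (h1 : α * fnorm (S * dX * S) < (1 - γ) * μ) (h2 : α * fnorm (T * dZ * T) < 1)
    (h3 : α * (3 * (fnorm (S * dX * S) * fnorm (T * dZ * T))) ≤ γ * (σ * μ)) :
    (X + α • dX).PosDef ∧ (Z + α • dZ).PosDef ∧
      fnorm (symmOp (CFC.sqrt (Z + α • dZ)) ((X + α • dX) * (Z + α • dZ)) -
        mu (X + α • dX) (Z + α • dZ) • (1 : Matrix (Fin n) (Fin n) ℝ)) ≤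
      γ * mu (X + α • dX) (Z + α • dZ) := by
  have hZs : Z.IsSymm := by
    have := isSymm_conj h.symmS Matrix.isSymm_one
    rwa [mul_one, h.sq] at this
  have hXa : (X + α • dX).IsSymm := h.symmX.add (hdX.smul α)
  have hZa : (Z + α • dZ).IsSymm := hZs.add (hdZ.smul α)
  have hXpd : (X + α • dX).PosDef := by
    refine h.posDef_of_conj hXa (t := μ) ?_
    have e : S * (X + α • dX) * S - μ • (1 : Matrix (Fin n) (Fin n) ℝ) =
        (S * X * S - μ • (1 : Matrix (Fin n) (Fin n) ℝ)) + α • (S * dX * S) := by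
      simp only [mul_add, add_mul, Matrix.mul_smul, Matrix.smul_mul]
      abel
    rw [e]
    refine (fnorm_add_le _ _).trans_lt ?_
    rw [fnorm_smul_of_nonneg hα]
    have := h.close
    linarith
  have hZpd : (Z + α • dZ).PosDef := by
    refine h.posDef_of_conj' hZa (t := 1) ?_
    have hTZ : T * Z * T = 1 := by
      rw [← h.sq, ← mul_assoc, h.inv_mul, one_mul, h.mul_inv]
    have e : T * (Z + α • dZ) * T - (1 : ℝ) • (1 : Matrix (Fin n) (Fin n) ℝ) =
        α • (T * dZ * T) := by
      simp only [mul_add, add_mul, Matrix.mul_smul, Matrix.smul_mul, hTZ]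
      module
    rw [e, fnorm_smul_of_nonneg hα]
    exact h2
  refine ⟨hXpd, hZpd, ?_⟩
  have hdet := isUnit_det_sqrt hZpd
  have g1 := Matrix.mul_nonsing_inv _ hdet
  have g2 := Matrix.nonsing_inv_mul _ hdet
  have g3 := sqrt_mul_sqrt hZpd
  rw [symmOp_eq (isSymm_sqrt _) hXa g1 g3 rfl]
  refine (fnorm_symm_conj_le (isSymm_sqrt _) hXa g1 g2 g3 h.mul_inv h.inv_mul _).trans ?_
  rw [h.symm_part_step hdX hdZ hN, h.mu_step hn hmu hN]
  have hip : ip dX dZ = ip (S * dX * S) (T * dZ * T) := (h.ip_conj _ _).symm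
  rw [hip]
  have hclose := h.close
  have hH := fnorm_half_anticomm_le (S * dX * S) (T * dZ * T)
  generalize S * X * S = X' at *
  generalize S * dX * S = A at *
  generalize T * dZ * T = D at *
  have hδ : |ip A D / n| * n ≤ fnorm A * fnorm D := by
    have h3 : (n : ℝ) ≠ 0 := by positivity
    rw [abs_div, Nat.abs_cast, div_mul_cancel₀ _ h3]
    exact abs_ip_le A D
  generalize ip A D / n = δ at *
  -- The old deviation shrinks by `1 - α`, but `μ` only by `1 - α (1 - σ)` up to second order,
  -- leaving slack `γ α σ μ`. The second-order terms cost `2 q` for the matrix and `q` for `-γ δ`,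
  -- whence the factor `3` in `h3`.
  have e : (1 - α) • X' + (α * (σ * μ)) • (1 : Matrix (Fin n) (Fin n) ℝ) +
      α ^ 2 • ((1 / 2 : ℝ) • (A * D + D * A)) -
        ((1 - α * (1 - σ)) * μ + α ^ 2 * δ) • (1 : Matrix (Fin n) (Fin n) ℝ) =
      (1 - α) • (X' - μ • (1 : Matrix (Fin n) (Fin n) ℝ)) +
        α ^ 2 • ((1 / 2 : ℝ) • (A * D + D * A) - δ • (1 : Matrix (Fin n) (Fin n) ℝ)) := by
    module
  rw [e]
  refine (fnorm_add_le _ _).trans ?_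
  rw [fnorm_smul_of_nonneg (sub_nonneg.2 hα1), fnorm_smul_of_nonneg (sq_nonneg α)]
  have k1 := mul_le_mul_of_nonneg_left hclose (sub_nonneg.2 hα1)
  have k2 := fnorm_sub_le ((1 / 2 : ℝ) • (A * D + D * A)) (δ • (1 : Matrix (Fin n) (Fin n) ℝ))
  rw [fnorm_smul δ, fnorm_one] at k2
  have k3 := mul_le_mul_of_nonneg_left (sqrt_natCast_le hn) (abs_nonneg δ)
  have hn1 : (1 : ℝ) ≤ n := by exact_mod_cast hn
  have k4 : |δ| ≤ fnorm A * fnorm D :=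
    (le_mul_of_one_le_right (abs_nonneg δ) hn1).trans hδ
  have k5 : -(γ * δ) ≤ fnorm A * fnorm D := by
    have := mul_le_of_le_one_left (abs_nonneg δ) hγ1.le
    have := mul_le_mul_of_nonneg_left (neg_abs_le δ) hγ.le
    linarith
  generalize fnorm A * fnorm D = q at *
  have k6 : α ^ 2 * fnorm ((1 / 2 : ℝ) • (A * D + D * A) - δ • (1 : Matrix (Fin n) (Fin n) ℝ)) ≤
      α ^ 2 * (2 * q) := by
    refine mul_le_mul_of_nonneg_left ?_ (sq_nonneg α)
    linarith
  have k7 := mul_le_mul_of_nonneg_left h3 hα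
  have k8 := mul_le_mul_of_nonneg_left k5 (sq_nonneg α)
  linarith

end StepLength

/-! ### Admissibility of a step-length of order `n⁻⁴` -/

section Admissible

variable {P : SDP m n} {ρ Kstar Ky K₁ K₂ : ℝ} {y₀ : Fin m → ℝ}
  {Xs : Matrix (Fin n) (Fin n) ℝ} {ys : Fin m → ℝ} {Zs : Matrix (Fin n) (Fin n) ℝ}

theorem Instance.vnorm_bbar_le (hρ : 0 < ρ) (hKstar : 0 < Kstar)
    (I : Instance P ρ Kstar Ky K₁ K₂ y₀ Xs ys Zs) :
    vnorm (P.bbar ρ) ≤ K₂ * (ρ + Kstar) * n := by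
  have e : P.bbar ρ = P.op (ρ • 1 - Xs) := by rw [SDP.bbar, op_sub, I.op_Xs]
  have h1 := fnorm_sub_le (ρ • 1) Xs
  rw [fnorm_smul_of_nonneg hρ.le, fnorm_one] at h1
  have h2 := mul_le_mul_of_nonneg_left (sqrt_natCast_le I.n_pos) (add_pos hρ hKstar).le
  have h3 := I.Xs_le
  rw [e, mul_assoc]
  refine (I.adjBounds.vnorm_op_le _).trans (mul_le_mul_of_nonneg_left ?_ I.adjBounds.le)
  linarith

theorem Instance.fnorm_Cbar_le (hρ : 0 < ρ) (hKstar : 0 < Kstar) (hKy : 0 < Ky)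
    (I : Instance P ρ Kstar Ky K₁ K₂ y₀ Xs ys Zs) :
    fnorm (P.Cbar ρ y₀) ≤ (K₂ * (Ky + Kstar) + ρ + Kstar) * n := by
  have e : P.Cbar ρ y₀ = P.adj (y₀ - ys) + ρ • 1 - Zs := by
    rw [SDP.Cbar, adj_sub, ← I.adj_ys]; abel
  have hsq := sqrt_natCast_le I.n_pos
  have h1 := fnorm_sub_le (P.adj (y₀ - ys) + ρ • 1) Zs
  have h2 := fnorm_add_le (P.adj (y₀ - ys)) (ρ • 1)
  rw [fnorm_smul_of_nonneg hρ.le, fnorm_one] at h2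
  have h3 : fnorm (P.adj (y₀ - ys)) ≤ K₂ * ((Ky + Kstar) * n) := by
    refine (I.adjBounds.upper _).trans (mul_le_mul_of_nonneg_left ?_ I.adjBounds.le)
    have h4 := vnorm_sub_le y₀ ys
    have h5 := I.y₀_le
    have h6 := I.ys_le
    have h7 := mul_le_mul_of_nonneg_left hsq (add_pos hKy hKstar).le
    linarith
  have h4 := I.Zs_le
  have h5 := mul_le_mul_of_nonneg_left hsq (add_pos hρ hKstar).le
  rw [e]
  linarith

/-- The residuals after a step. -/
theorem residuals_step {i θ μ σ α δ μa : ℝ} (hθ : θ = μ * i)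
    (hμa : μa = (1 - α * (1 - σ)) * μ + α ^ 2 * δ) {X dX Z dZ Ξ Ct Ed : Matrix (Fin n) (Fin n) ℝ}
    {y dy lam bt εp : Fin m → ℝ}
    (h1 : P.op X + μ • (y - lam) = P.b + θ • (P.bbar ρ + bt))
    (h2 : P.adj y + Z - μ • (X - Ξ) = P.C + θ • (P.Cbar ρ y₀ + Ct))
    (h3 : -(μ • dX) + P.adj dy + dZ =
      (P.C + (σ * θ) • P.Cbar ρ y₀) - P.adj y - Z + (σ * μ) • (X - Ξ) + Ed)
    (h4 : P.op dX + μ • dy =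
      -P.op X - (σ * μ) • (y - lam) + (P.b + (σ * θ) • P.bbar ρ) + εp) :
    P.op (X + α • dX) + μa • (y + α • dy - lam) = P.b + (μa * i) • P.bbar ρ +
      (((1 - α) * θ) • bt + α • εp +
        ((α ^ 2 * δ) • (y - lam - i • P.bbar ρ) + (α * (μa - μ)) • dy)) ∧
    P.adj (y + α • dy) + (Z + α • dZ) - μa • (X + α • dX - Ξ) = P.C + (μa * i) • P.Cbar ρ y₀ +
      (((1 - α) * θ) • Ct + α • Ed +
        (-((α ^ 2 * δ) • (X - Ξ + i • P.Cbar ρ y₀)) - (α * (μa - μ)) • dX)) := by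
  -- The old equations with weight `1 - α` and the Newton equations with weight `α` give the new
  -- ones to first order. The rest stems from the term `α² δ` of the new `μ` and from the product of
  -- the changes of `μ` and of the point.
  subst hθ hμa
  constructor
  · rw [op_add, op_smul]
    linear_combination (norm := module) (1 - α) • h1 + α • h4
  · rw [adj_add, adj_smul]
    linear_combination (norm := module) (1 - α) • h2 + α • h3

theorem eventually_mul_le (a : ℝ) {b : ℝ} (hb : 0 < b) :
    ∀ᶠ κ in nhdsWithin (0 : ℝ) (Set.Ioi 0), κ * a ≤ b := by
  have h : Filter.Tendsto (fun κ : ℝ => κ * a) (nhdsWithin 0 (Set.Ioi 0)) (nhds 0) := by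
    have : Filter.Tendsto (fun κ : ℝ => κ * a) (nhds 0) (nhds (0 * a)) :=
      (continuous_id.mul continuous_const).tendsto 0
    rw [zero_mul] at this
    exact this.mono_left nhdsWithin_le_nhds
  exact (h.eventually (gt_mem_nhds hb)).mono fun _ h => h.le

/-- The step-length `κ / n⁴` is admissible. -/
theorem exists_admissible (par : Params) {ρ Kstar Ky K₁ K₂ c₀ c₁ c : ℝ} (hρ : 0 < ρ)
    (hKstar : 0 < Kstar) (hKy : 0 < Ky) (hK₁ : 0 < K₁) (hK₂ : 0 < K₂) (hc₀ : 0 < c₀)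
    (hc₁ : 0 < c₁) (hc : 0 < c) :
    ∃ κ : ℝ, 0 < κ ∧ κ ≤ 1 ∧ ∀ {m n : ℕ} {P : SDP m n} {y₀ ys : Fin m → ℝ}
      {Xs Zs : Matrix (Fin n) (Fin n) ℝ}, Instance P ρ Kstar Ky K₁ K₂ y₀ Xs ys Zs →
      ∀ {s : State m n}, 0 < s.μ → s.μ ≤ ρ ^ 2 →
      P.Nbhd par ρ y₀ s.μ s.Ξ s.lam s.X s.y s.Z →
      fnorm s.X ≤ c₁ * n → vnorm s.y ≤ c₁ * n → fnorm s.Ξ ≤ c₀ * n → vnorm s.lam ≤ c₀ * n →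
      ∀ {σ : ℝ}, par.σmin ≤ σ → σ ≤ par.σmax →
      ∀ {Ed Eμ dX dZ : Matrix (Fin n) (Fin n) ℝ} {εp dy : Fin m → ℝ}, dX.IsSymm → dZ.IsSymm →
      P.Newton ρ y₀ s σ Ed εp Eμ dX dy dZ → P.Accurate par ρ s.μ Ed εp Eμ →
      fnorm (CFC.sqrt s.Z * dX * CFC.sqrt s.Z) ≤ c * (n : ℝ) ^ 2 * s.μ →
      fnorm ((CFC.sqrt s.Z)⁻¹ * dZ * (CFC.sqrt s.Z)⁻¹) ≤ c * (n : ℝ) ^ 2 →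
      fnorm dX ≤ c * (n : ℝ) ^ 2 → vnorm dy ≤ c * (n : ℝ) ^ 2 →
      κ / (n : ℝ) ^ 4 ∈ P.admissible par ρ y₀ s dX dy dZ := by
  have hγ := par.γμ_pos
  have hγ1 := par.γμ_lt
  have hσm := par.σmin_pos
  have hKN := par.KN_pos
  have hγS := par.γS_pos
  obtain ⟨i, hi⟩ : ∃ i, i = (ρ ^ 2)⁻¹ := ⟨_, rfl⟩
  have hipos : 0 < i := by rw [hi]; positivity
  obtain ⟨bb, hbb⟩ : ∃ bb, bb = K₂ * (ρ + Kstar) + (K₂ * (Ky + Kstar) + ρ + Kstar) := ⟨_, rfl⟩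
  have hbbpos : 0 < bb := by rw [hbb]; positivity
  -- `α κ E μ` will bound the second-order part `(v, V)` of the new residuals.
  obtain ⟨E, hE⟩ : ∃ E, E = c ^ 2 * (2 * (c₁ + c₀) + bb * i) + 4 * c := ⟨_, rfl⟩
  have hEpos : 0 < E := by rw [hE]; positivity
  -- The first two conditions control the change of `μ`, the third positive definiteness, the fourth
  -- centrality, and the last two the two residual norms. There the slack is `ασ` relative to the
  -- target, of which the inexactness uses `α σ_min / 4`; this leaves `3/4 σ_min`.
  obtain ⟨κ, hκ⟩ := ((((eventually_mul_le 1 (b := 1 / 4) (by norm_num)).and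
    (eventually_mul_le (c ^ 2) (b := 1 / 4) (by norm_num))).and
    ((eventually_mul_le (2 * c) (sub_pos.2 hγ1)).and
    (eventually_mul_le (3 * c ^ 2) (mul_pos hγ hσm)))).and
    (((eventually_mul_le (E + par.KN * i * c ^ 2) (b := 3 / 4 * par.σmin * (par.KN * i))
      (by positivity)).and
    (eventually_mul_le ((1 / K₁ + 1) * E + par.γS * ρ * i * c ^ 2)
      (b := 3 / 4 * par.σmin * (par.γS * ρ * i)) (by positivity))).and
    self_mem_nhdsWithin)).exists
  obtain ⟨⟨⟨k1, k2⟩, k3, k4⟩, ⟨k5, k6⟩, hκ0⟩ := hκ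
  rw [mul_one] at k1
  replace hκ0 : 0 < κ := hκ0
  refine ⟨κ, hκ0, by linarith, ?_⟩
  intro m n P y₀ ys Xs Zs I s hμ hμ1 hN hXb hyb hΞb hlamb σ hσ hσ' Ed Eμ dX dZ εp dy hdX hdZ hNew
    hacc hA hD hdXn hdyn
  have hn := I.n_pos
  have hn1 : (1 : ℝ) ≤ n := by exact_mod_cast hn
  have hn4 : (0 : ℝ) < (n : ℝ) ^ 4 := by positivity
  have hn4' : (1 : ℝ) ≤ (n : ℝ) ^ 4 := one_le_pow₀ hn1
  have hn24 : (n : ℝ) ^ 2 ≤ (n : ℝ) ^ 4 := pow_le_pow_right₀ hn1 (by norm_num)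
  obtain ⟨α, hα⟩ : ∃ α, α = κ / (n : ℝ) ^ 4 := ⟨_, rfl⟩
  have hα0 : 0 < α := by rw [hα]; positivity
  have hακ : α * (n : ℝ) ^ 4 = κ := by rw [hα]; field_simp
  have hα14 : α ≤ 1 / 4 := by
    have := mul_le_mul_of_nonneg_left hn4' hα0.le
    linarith
  have hσ0 : 0 < σ := hσm.trans_le hσ
  have hσ2 : σ ≤ 1 / 2 := hσ'.trans par.σmax_le
  rw [← hα]
  have hsc := hN.scaling
  have hnewt := hNew.2.2
  rw [fnorm_eq_zero.1 hacc.1, add_zero] at hnewt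
  have hmua := hsc.mu_step hn rfl hnewt α
  obtain ⟨δ, hδ⟩ : ∃ δ, δ = ip dX dZ / n := ⟨_, rfl⟩
  obtain ⟨μ, hμdef⟩ : ∃ μ, μ = s.μ := ⟨_, rfl⟩
  obtain ⟨μa, hμa⟩ : ∃ μa, μa = mu (s.X + α • dX) (s.Z + α • dZ) := ⟨_, rfl⟩
  have hAD : fnorm (CFC.sqrt s.Z * dX * CFC.sqrt s.Z) *
      fnorm ((CFC.sqrt s.Z)⁻¹ * dZ * (CFC.sqrt s.Z)⁻¹) ≤ c ^ 2 * (n : ℝ) ^ 4 * μ := by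
    refine (mul_le_mul hA hD (fnorm_nonneg _) (by positivity)).trans (le_of_eq ?_)
    rw [hμdef]; ring
  have hδn : |δ| * n ≤ c ^ 2 * (n : ℝ) ^ 4 * μ := by
    have h3 : (n : ℝ) ≠ 0 := by positivity
    rw [hδ, abs_div, Nat.abs_cast, div_mul_cancel₀ _ h3, ← hsc.ip_conj]
    exact (abs_ip_le _ _).trans hAD
  have hδb : |δ| ≤ c ^ 2 * (n : ℝ) ^ 4 * μ := (le_mul_of_one_le_right (abs_nonneg δ) hn1).trans hδn
  have hcent := hsc.step_centrality hn rfl hγ hγ1 hdX hdZ hnewt hα0.le (by linarith)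
    (by
      have h1 := mul_le_mul_of_nonneg_left hA hα0.le
      have h2 : α * (c * n ^ 2 * s.μ) ≤ κ * c * s.μ := by
        rw [← hακ]
        have := mul_le_mul_of_nonneg_left hn24 (by positivity : 0 ≤ α * c * s.μ)
        linarith
      have h3 := mul_le_mul_of_nonneg_right k3 hμ.le
      have h4 : 0 < κ * c * s.μ := by positivity
      change _ < (1 - par.γμ) * s.μ
      linarith)
    (by
      have h1 := mul_le_mul_of_nonneg_left hD hα0.le
      have h2 : α * (c * n ^ 2) ≤ κ * c := by
        rw [← hακ]
        have := mul_le_mul_of_nonneg_left hn24 (by positivity : 0 ≤ α * c)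
        linarith
      linarith)
    (by
      have h1 := mul_le_mul_of_nonneg_left hAD hα0.le
      have h2 : α * (c ^ 2 * n ^ 4 * μ) = κ * c ^ 2 * μ := by rw [← hακ]; ring
      have hμ' : 0 ≤ μ := by rw [hμdef]; exact hμ.le
      have h3 := mul_le_mul_of_nonneg_right k4 hμ'
      have h4 := mul_le_mul_of_nonneg_left (mul_le_mul_of_nonneg_right hσ hμ') hγ.le
      change _ ≤ par.γμ * (σ * s.μ)
      rw [← hμdef]
      linarith)
  rw [← hδ] at hmua
  change mu (s.X + α • dX) (s.Z + α • dZ) = (1 - α * (1 - σ)) * s.μ + α ^ 2 * δ at hmua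
  obtain ⟨⟨bt, Ct, e1, e2, e3, e4⟩, -⟩ := hN
  obtain ⟨f1, f2, -⟩ := hNew
  obtain ⟨-, a1, a2⟩ := hacc
  obtain ⟨θ, hθdef⟩ : ∃ θ, θ = μ * i := ⟨_, rfl⟩
  rw [mu0_eq hn] at e1 e2 f1 f2 a1 a2
  rw [← hμdef] at e1 e2 f1 f2 a1 a2 hμ hμ1 hmua
  rw [← hμa] at hmua
  have hθ1 : μ / ρ ^ 2 = θ := by rw [hθdef, hi]; rfl
  have hθ2 : σ * μ / ρ ^ 2 = σ * θ := by rw [← hθ1]; ring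
  rw [hθ1] at e1 e2
  rw [hθ2] at f1 f2
  have hθ0 : 0 < θ := by rw [hθdef]; positivity
  replace a1 : pnorm εp Ed ≤ par.σmin / 4 * (par.KN * θ) := by
    refine a1.trans (le_of_eq ?_)
    rw [← hθ1]; field_simp
  replace a2 : P.snorm εp Ed ≤ par.σmin / 4 * (par.γS * ρ * θ) := by
    refine a2.trans (le_of_eq ?_)
    rw [← hθ1]; field_simp
  obtain ⟨r1, r2⟩ := residuals_step (α := α) hθdef hmua e1 e2 f1 f2
  obtain ⟨v, hv⟩ : ∃ v, v = (α ^ 2 * δ) • (s.y - s.lam - i • P.bbar ρ) + (α * (μa - μ)) • dy :=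
    ⟨_, rfl⟩
  obtain ⟨V, hV⟩ : ∃ V, V = -((α ^ 2 * δ) • (s.X - s.Ξ + i • P.Cbar ρ y₀)) - (α * (μa - μ)) • dX :=
    ⟨_, rfl⟩
  rw [← hv] at r1
  rw [← hV] at r2
  have hαδ : α ^ 2 * |δ| ≤ α * (κ * c ^ 2 * μ) := by
    have h1 := mul_le_mul_of_nonneg_left hδb (sq_nonneg α)
    have h2 : α ^ 2 * (c ^ 2 * n ^ 4 * μ) = α * (κ * c ^ 2 * μ) := by rw [← hακ]; ring
    linarith
  have hκc := mul_le_mul_of_nonneg_right k2 hμ.le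
  have hαδ' : α ^ 2 * |δ| ≤ α * (1 / 4 * μ) :=
    hαδ.trans (mul_le_mul_of_nonneg_left hκc hα0.le)
  have hδ1 : α ^ 2 * δ ≤ α ^ 2 * |δ| := mul_le_mul_of_nonneg_left (le_abs_self δ) (sq_nonneg α)
  have hδ2 : -(α ^ 2 * |δ|) ≤ α ^ 2 * δ := by
    have := mul_le_mul_of_nonneg_left (neg_abs_le δ) (sq_nonneg α)
    linarith
  have hαμ : 0 < α * μ := by positivity
  have hσαμ := mul_le_mul_of_nonneg_right hσ2 hαμ.le
  have hσαμ0 : 0 < σ * (α * μ) := by positivity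
  have hα14μ := mul_le_mul_of_nonneg_right hα14 hμ.le
  have hμa0 : 0 < μa := by rw [hmua]; linarith
  -- `σ ≤ 1/2` gives a first-order decrease of at least `α μ / 2`, and the second-order term takes
  -- back at most `α μ / 4`.
  have hμadec : μa ≤ (1 - 1 / 100 * α) * μ := by rw [hmua]; linarith
  have hμd : |μa - μ| ≤ 2 * (α * μ) := by
    rw [abs_le]
    constructor <;> · rw [hmua]; linarith
  have hvV : pnorm v V ≤ α * (κ * E * μ) := by
    refine (pnorm_le_add v V).trans ?_
    have hab : |α ^ 2 * δ| = α ^ 2 * |δ| := by rw [abs_mul, abs_of_nonneg (sq_nonneg α)]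
    have hab' : |α * (μa - μ)| = α * |μa - μ| := by rw [abs_mul, abs_of_pos hα0]
    have g1 : vnorm v ≤ α ^ 2 * |δ| * vnorm (s.y - s.lam - i • P.bbar ρ) +
        α * |μa - μ| * vnorm dy := by
      rw [hv, ← hab, ← hab', ← vnorm_smul, ← vnorm_smul]
      exact vnorm_add_le _ _
    have g2 : fnorm V ≤ α ^ 2 * |δ| * fnorm (s.X - s.Ξ + i • P.Cbar ρ y₀) +
        α * |μa - μ| * fnorm dX := by
      rw [hV, ← hab, ← hab', ← fnorm_smul, ← fnorm_smul, ← fnorm_neg (_ • (_ + _))]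
      exact fnorm_sub_le _ _
    have g3 := vnorm_sub_le (s.y - s.lam) (i • P.bbar ρ)
    have g4 := vnorm_sub_le s.y s.lam
    have g5 := fnorm_add_le (s.X - s.Ξ) (i • P.Cbar ρ y₀)
    have g6 := fnorm_sub_le s.X s.Ξ
    rw [vnorm_smul_of_nonneg hipos.le] at g3
    rw [fnorm_smul_of_nonneg hipos.le] at g5
    have g7 := mul_le_mul_of_nonneg_left (I.vnorm_bbar_le hρ hKstar) hipos.le
    have g8 := mul_le_mul_of_nonneg_left (I.fnorm_Cbar_le hρ hKstar hKy) hipos.le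
    have g9 : vnorm (s.y - s.lam - i • P.bbar ρ) + fnorm (s.X - s.Ξ + i • P.Cbar ρ y₀) ≤
        (2 * (c₁ + c₀) + bb * i) * n := by
      rw [hbb]; linarith
    have g10 : |δ| * (vnorm (s.y - s.lam - i • P.bbar ρ) +
        fnorm (s.X - s.Ξ + i • P.Cbar ρ y₀)) ≤
        c ^ 2 * (n : ℝ) ^ 4 * μ * (2 * (c₁ + c₀) + bb * i) := by
      have h1 := mul_le_mul_of_nonneg_left g9 (abs_nonneg δ)
      have h2 := mul_le_mul_of_nonneg_right hδn
        (by positivity : 0 ≤ 2 * (c₁ + c₀) + bb * i)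
      linarith
    have g11 : |μa - μ| * (vnorm dy + fnorm dX) ≤ 2 * (α * μ) * (2 * c * (n : ℝ) ^ 4) := by
      have h1 : vnorm dy + fnorm dX ≤ 2 * c * (n : ℝ) ^ 4 := by
        have := mul_le_mul_of_nonneg_left hn24 hc.le
        linarith
      exact mul_le_mul hμd h1 (add_nonneg (vnorm_nonneg _) (fnorm_nonneg _)) (by positivity)
    have g12 := mul_le_mul_of_nonneg_left g10 (sq_nonneg α)
    have g13 := mul_le_mul_of_nonneg_left g11 hα0.le
    have g14 : α * (κ * E * μ) = α ^ 2 * (c ^ 2 * (n : ℝ) ^ 4 * μ * (2 * (c₁ + c₀) + bb * i)) +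
        α * (2 * (α * μ) * (2 * c * (n : ℝ) ^ 4)) := by
      rw [← hακ, hE]; ring
    rw [g14]
    linarith
  have hslack : ∀ {k q : ℝ}, 0 ≤ k → κ * (q + k * i * c ^ 2) ≤ 3 / 4 * par.σmin * (k * i) →
      (1 - α) * θ * k + α * (par.σmin / 4 * (k * θ)) + α * (κ * q * μ) ≤ μa * i * k := by
    intro k q hk0 hk
    have h1 := mul_le_mul_of_nonneg_left hk hαμ.le
    have h2 := mul_le_mul_of_nonneg_right hσ (by positivity : 0 ≤ α * θ * k)
    have h3 := mul_le_mul_of_nonneg_right (hαδ.trans' (neg_le.1 hδ2))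
      (by positivity : 0 ≤ i * k)
    rw [hmua]
    rw [hθdef] at *
    linarith
  have hαc : 0 ≤ (1 - α) * θ := by
    have : 0 ≤ 1 - α := by linarith
    positivity
  have hta : 0 < μa * i := by positivity
  set w := ((1 - α) * θ) • bt + α • εp + v with hw
  set W := ((1 - α) * θ) • Ct + α • Ed + V with hW
  have hpn : pnorm w W ≤ μa * i * par.KN := by
    refine (pnorm_add_le _ _ _ _).trans ((add_le_add_left (pnorm_add_le _ _ _ _) _).trans ?_)
    rw [pnorm_smul, pnorm_smul, abs_of_nonneg hαc, abs_of_pos hα0]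
    have h1 := mul_le_mul_of_nonneg_left e3 hαc
    have h2 := mul_le_mul_of_nonneg_left a1 hα0.le
    have h3 := hslack hKN.le k5
    linarith
  have hsn : P.snorm w W ≤ μa * i * (par.γS * ρ) := by
    refine (I.adjBounds.snorm_add_le _ _ _ _).trans
      ((add_le_add_left (I.adjBounds.snorm_add_le _ _ _ _) _).trans ?_)
    have h0 := I.adjBounds.snorm_smul_le hαc bt Ct
    have h0' := I.adjBounds.snorm_smul_le hα0.le εp Ed
    have h1 := mul_le_mul_of_nonneg_left e4 hαc
    have h2 := mul_le_mul_of_nonneg_left a2 hα0.le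
    have h3 := hslack (k := par.γS * ρ) (q := (1 / K₁ + 1) * E) (by positivity) k6
    have h4 := I.adjBounds.snorm_le_pnorm v V
    have h5 := mul_le_mul_of_nonneg_left hvV (by positivity : 0 ≤ 1 / K₁ + 1)
    linarith
  have hμai : μa / ρ ^ 2 = μa * i := by rw [hi]; rfl
  refine ⟨hα0, by linarith, ?_, ?_⟩
  · rw [← hμa, ← hμdef]; exact hμadec
  · rw [← hμa] at hcent ⊢
    -- The new perturbation is the residual divided by the new ratio `μ / μ₀`.
    refine ⟨⟨(μa * i)⁻¹ • w, (μa * i)⁻¹ • W, ?_, ?_, ?_, ?_⟩, hcent⟩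
    · rw [mu0_eq hn, hμai, r1, smul_add, smul_inv_smul₀ hta.ne', add_assoc]
    · rw [mu0_eq hn, hμai, r2, smul_add, smul_inv_smul₀ hta.ne', add_assoc]
    · rw [pnorm_smul, abs_of_pos (inv_pos.2 hta), inv_mul_le_iff₀ hta]
      exact hpn
    · refine (I.adjBounds.snorm_smul_le (inv_pos.2 hta).le _ _).trans ?_
      rw [inv_mul_le_iff₀ hta]
      exact hsn

end Admissible

/-! ### Runs of the algorithm -/

section Run

/-- The properties of a state that are preserved by the iteration. -/
structure Invariant (P : SDP m n) (par : Params) (ρ : ℝ) (y₀ : Fin m → ℝ) (c₀ : ℝ)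
    (s : State m n) : Prop where
  pos : 0 < s.μ
  le : s.μ ≤ ρ ^ 2
  symm : s.Ξ.IsSymm
  Ξ_le : fnorm s.Ξ ≤ c₀ * n
  lam_le : vnorm s.lam ≤ c₀ * n
  nbhd : P.Nbhd par ρ y₀ s.μ s.Ξ s.lam s.X s.y s.Z

variable {P : SDP m n} {ρ Kstar Ky K₁ K₂ : ℝ} {y₀ : Fin m → ℝ}
  {Xs : Matrix (Fin n) (Fin n) ℝ} {ys : Fin m → ℝ} {Zs : Matrix (Fin n) (Fin n) ℝ}

theorem Instance.of_assumptions {KA1 KA2 Kr1 Kr2 : ℝ} (hn : 0 < n) (h1 : P.Assumption1 Kstar)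
    (h2 : P.Assumption2 KA1 KA2 Kr1 Kr2) (hKA1 : 0 < KA1) (hKA2 : 0 < KA2)
    (hy₀ : vnorm y₀ ≤ Ky * √(n : ℝ)) :
    ∃ Xs ys Zs, Instance P ρ Kstar Ky KA1 KA2 y₀ Xs ys Zs := by
  obtain ⟨hS, X, y, Z, hO, hle⟩ := h1
  refine ⟨X, y, Z, hn, adjBounds_of_assumption2 hKA1 hKA2 h2, hO.1.1.1, hO.2.1.1, hO.1.1.2,
    hO.2.1.2, ip_eq_zero_of_isOptimal hS hO, ?_, ?_, ?_, hy₀⟩ <;>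
  · refine (Real.le_sqrt_of_sq_le ?_).trans hle
    linarith [sq_nonneg (fnorm X), sq_nonneg (vnorm y), sq_nonneg (fnorm Z)]

theorem ip_pos {X Z : Matrix (Fin n) (Fin n) ℝ} (hn : 0 < n) (hX : X.PosDef) (hZ : Z.PosDef) :
    0 < ip X Z := by
  have : Nonempty (Fin n) := ⟨⟨0, hn⟩⟩
  have h := (posDef_conj (isSymm_sqrt Z) (isUnit_det_sqrt hZ) hX).trace_pos
  rwa [mul_assoc, Matrix.trace_mul_comm, mul_assoc, sqrt_mul_sqrt hZ] at h

theorem mu_pos {X Z : Matrix (Fin n) (Fin n) ℝ} (hn : 0 < n) (hX : X.PosDef) (hZ : Z.PosDef) :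
    0 < mu X Z := by
  rw [mu_eq_ip]
  have := ip_pos hn hX hZ
  positivity

theorem Instance.nbhd_start (par : Params) (hρ : 0 < ρ)
    (I : Instance P ρ Kstar Ky K₁ K₂ y₀ Xs ys Zs) :
    P.Nbhd par ρ y₀ (ρ ^ 2) (ρ • 1) y₀ (ρ • 1) y₀ (ρ • 1) := by
  have hpd : (ρ • (1 : Matrix (Fin n) (Fin n) ℝ)).PosDef := Matrix.PosDef.one.smul hρ
  refine ⟨⟨0, 0, ?_, ?_, ?_, ?_⟩, hpd, hpd, ?_⟩
  · rw [mu0_eq I.n_pos, div_self (by positivity), SDP.bbar]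
    module
  · rw [mu0_eq I.n_pos, div_self (by positivity), SDP.Cbar]
    module
  · refine (pnorm_le_add _ _).trans ?_
    rw [vnorm_eq_zero.2 rfl, fnorm_eq_zero.2 rfl, add_zero]
    exact par.KN_pos.le
  · refine (I.adjBounds.snorm_le_pnorm _ _).trans ?_
    have h0 : pnorm (0 : Fin m → ℝ) (0 : Matrix (Fin n) (Fin n) ℝ) = 0 := by
      rw [pnorm, vnorm_eq_zero.2 rfl, fnorm_eq_zero.2 rfl]; simp
    rw [h0, mul_zero]
    exact (mul_pos par.γS_pos hρ).le
  · have hdet := isUnit_det_sqrt hpd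
    rw [symmOp_eq (isSymm_sqrt _) (isSymm_of_posDef hpd) (Matrix.mul_nonsing_inv _ hdet)
      (sqrt_mul_sqrt hpd) rfl, Matrix.mul_smul, mul_one, Matrix.smul_mul, sqrt_mul_sqrt hpd,
      smul_smul, ← sq, sub_self, fnorm_eq_zero.2 rfl]
    exact (mul_pos par.γμ_pos (by positivity)).le

theorem Instance.invariant_start (par : Params) {c₀ : ℝ} (hρ : 0 < ρ) (hρc : ρ ≤ c₀)
    (hKyc : Ky ≤ c₀) (I : Instance P ρ Kstar Ky K₁ K₂ y₀ Xs ys Zs) :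
    Invariant P par ρ y₀ c₀ (start n ρ y₀) := by
  have hμ : (start n ρ y₀ : State m n).μ = ρ ^ 2 := mu0_eq I.n_pos ρ
  have hsq := sqrt_natCast_le I.n_pos
  have hc₀ : 0 ≤ c₀ := hρ.le.trans hρc
  refine ⟨by rw [hμ]; positivity, hμ.le, Matrix.isSymm_one.smul _, ?_, ?_, ?_⟩
  · change fnorm (ρ • (1 : Matrix (Fin n) (Fin n) ℝ)) ≤ _
    rw [fnorm_smul_of_nonneg hρ.le, fnorm_one]
    exact mul_le_mul hρc hsq (Real.sqrt_nonneg _) hc₀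
  · change vnorm y₀ ≤ _
    exact I.y₀_le.trans (mul_le_mul hKyc hsq (Real.sqrt_nonneg _) hc₀)
  · rw [hμ]; exact I.nbhd_start par hρ

/-- A point that passes the update test lies in the neighbourhood defined by itself. -/
theorem Instance.nbhd_of_updateTest {par : Params} (hρ : 0 < ρ)
    (I : Instance P ρ Kstar Ky K₁ K₂ y₀ Xs ys Zs) {X Z Ξ : Matrix (Fin n) (Fin n) ℝ}
    {y lam : Fin m → ℝ} (hN : P.Nbhd par ρ y₀ (mu X Z) Ξ lam X y Z)
    (h : P.UpdateTest par ρ y₀ X y Z) : P.Nbhd par ρ y₀ (mu X Z) X y X y Z := by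
  obtain ⟨-, hX, hZ, hc⟩ := hN
  obtain ⟨h1, h2⟩ := h
  have hθ : 0 < mu X Z / mu0 n ρ := by
    rw [mu0_eq I.n_pos]
    have := mu_pos I.n_pos hX hZ
    positivity
  generalize hθd : mu X Z / mu0 n ρ = θ at h1 h2 hθ
  -- The perturbation is the normalized residual; the dual part changes sign because the test uses
  -- the opposite sign convention there.
  refine ⟨⟨θ⁻¹ • (P.op X - (P.b + θ • P.bbar ρ)),
    θ⁻¹ • (-((P.C + θ • P.Cbar ρ y₀) - P.adj y - Z)), ?_, ?_, ?_, ?_⟩, hX, hZ, hc⟩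
  · rw [hθd, smul_add, smul_inv_smul₀ hθ.ne']; module
  · rw [hθd, smul_add, smul_inv_smul₀ hθ.ne']; module
  · rw [pnorm_smul, abs_of_pos (inv_pos.2 hθ), pnorm_neg_right, inv_mul_le_iff₀ hθ, mul_comm]
    exact h1
  · refine (I.adjBounds.snorm_smul_le (inv_pos.2 hθ).le _ _).trans ?_
    rw [inv_mul_le_iff₀ hθ, mul_comm θ]
    exact (I.adjBounds.snorm_neg_right_le _ _).trans h2

/-- Every iteration preserves the invariant and reduces `μ` by a factor `1 - Ω(n⁻⁴)`. -/
theorem exists_step_decrease (par : Params) {ρ Kstar Ky K₁ K₂ : ℝ} (hρ : 0 < ρ)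
    (hKstar : 0 < Kstar) (hKy : 0 < Ky) (hK₁ : 0 < K₁) (hK₂ : 0 < K₂) :
    ∃ c₀ κ : ℝ, ρ ≤ c₀ ∧ Ky ≤ c₀ ∧ 0 < κ ∧ κ ≤ 1 ∧ ∀ {m n : ℕ} {P : SDP m n} {y₀ ys : Fin m → ℝ}
      {Xs Zs : Matrix (Fin n) (Fin n) ℝ}, Instance P ρ Kstar Ky K₁ K₂ y₀ Xs ys Zs →
      ∀ {s s' : State m n}, Invariant P par ρ y₀ c₀ s → P.Step par ρ y₀ s s' →
        Invariant P par ρ y₀ c₀ s' ∧ s'.μ ≤ (1 - 1 / 100 * (κ / (n : ℝ) ^ 4)) * s.μ := by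
  obtain ⟨cp, hcp, hprox⟩ := exists_proximal_bound par K₂ hρ hKstar hKy hK₁
  -- One constant that serves for the initial proximal estimates and for all later ones.
  obtain ⟨c₀, hc₀def⟩ : ∃ c₀, c₀ = cp + ρ + Ky := ⟨_, rfl⟩
  have hc₀ : 0 < c₀ := by rw [hc₀def]; positivity
  obtain ⟨c₁, hc₁, hiter⟩ := exists_iterate_bound par hρ hKstar hKy hK₁ hK₂ hc₀
  obtain ⟨c, hc, hnewton⟩ := exists_newton_bound par Ky K₂ hρ hKstar hK₁ hc₁
  obtain ⟨κ, hκ, hκ1, hadm⟩ := exists_admissible par hρ hKstar hKy hK₁ hK₂ hc₀ hc₁ hc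
  refine ⟨c₀, κ, by linarith, by linarith, hκ, hκ1, ?_⟩
  intro m n P y₀ ys Xs Zs I s s' hs hstep
  obtain ⟨σ, α, Ed, εp, Eμ, dX, dy, dZ, hσ, hσ', hdX, hdZ, hNew, hacc, hα, hX', hy', hZ', hup,
    hnup⟩ := hstep
  obtain ⟨b1, b2, -, b4, b5⟩ := hiter I hs.pos hs.le rfl hs.symm hs.Ξ_le hs.lam_le hs.nbhd
  obtain ⟨d1, d2, d3, d4⟩ :=
    hnewton I hs.pos hs.le hs.symm hs.nbhd b1 b2 b4 b5 hσ hσ' hdX hdZ hNew hacc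
  have hmem := hadm I hs.pos hs.le hs.nbhd b1 b2 hs.Ξ_le hs.lam_le hσ hσ' hdX hdZ hNew hacc d1 d2
    d3 d4
  -- Maximality of the step-length taken: `α ≥ κ / n⁴`.
  have hle := hα.2 hmem
  obtain ⟨hα0, -, hdec, hN⟩ := hα.1
  rw [← hX', ← hy', ← hZ'] at hN
  rw [← hX', ← hZ'] at hdec
  change P.Nbhd par ρ y₀ s'.μ _ _ _ _ _ at hN
  change s'.μ ≤ _ at hdec
  have hpos : 0 < s'.μ := mu_pos I.n_pos hN.2.1 hN.2.2.1
  have hdec' : s'.μ ≤ (1 - 1 / 100 * (κ / (n : ℝ) ^ 4)) * s.μ :=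
    hdec.trans (mul_le_mul_of_nonneg_right (by linarith) hs.pos.le)
  have hle' : s'.μ ≤ ρ ^ 2 := by
    have := mul_pos hα0 hs.pos
    linarith [hs.le]
  refine ⟨?_, hdec'⟩
  by_cases ht : P.UpdateTest par ρ y₀ s'.X s'.y s'.Z
  · obtain ⟨u1, u2⟩ := hup ht
    have hN' := I.nbhd_of_updateTest hρ hN ht
    obtain ⟨p1, p2⟩ := hprox I hpos hle' rfl hN'
    have hcc : cp * n ≤ c₀ * n := mul_le_mul_of_nonneg_right (by linarith) (by positivity)
    exact ⟨hpos, hle', by rw [u1]; exact isSymm_of_posDef hN.2.1, by rw [u1]; exact p1.trans hcc,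
      by rw [u2]; exact p2.trans hcc, by rw [u1, u2]; exact hN'⟩
  · obtain ⟨u1, u2⟩ := hnup ht
    exact ⟨hpos, hle', by rw [u1]; exact hs.symm, by rw [u1]; exact hs.Ξ_le,
      by rw [u2]; exact hs.lam_le, by rw [u1, u2]; exact hN⟩

end Run

/-- A geometric decrease at rate `1 - t` reaches `ε` within `O(t⁻¹ log (1 / ε))` iterations. -/
theorem exists_iteration_bound {ρ κ ε₀ : ℝ} (hρ : 0 < ρ) (hκ : 0 < κ) (hε₀ : 0 < ε₀)
    (hε₀' : ε₀ < 1) :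
    ∃ c : ℝ, 0 < c ∧ ∀ {n : ℕ}, 0 < n → ∀ {ε : ℝ}, 0 < ε → ε ≤ ε₀ →
      ∃ k₀ : ℕ, (k₀ : ℝ) ≤ c * (n : ℝ) ^ 4 * |Real.log (1 / ε)| ∧ ∀ k : ℕ, k₀ ≤ k →
        Real.exp (-(1 / 100 * (κ / (n : ℝ) ^ 4) * k)) * ρ ^ 2 ≤ ε := by
  obtain ⟨R, hR⟩ : ∃ R, R = |Real.log (ρ ^ 2)| := ⟨_, rfl⟩
  have hR0 : 0 ≤ R := by rw [hR]; positivity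
  obtain ⟨L₀, hL₀⟩ : ∃ L₀, L₀ = Real.log (1 / ε₀) := ⟨_, rfl⟩
  have hL₀pos : 0 < L₀ := by
    rw [hL₀]; exact Real.log_pos (by rw [lt_div_iff₀ hε₀]; linarith)
  -- `R ≤ (R / L₀) L` absorbs the starting value, and `1 ≤ n⁴ L / L₀` absorbs the unit lost in
  -- rounding up.
  refine ⟨100 / κ * (1 + R / L₀) + 1 / L₀, by positivity, ?_⟩
  intro n hn ε hε hεε₀
  have hn4 : (0 : ℝ) < (n : ℝ) ^ 4 := by positivity
  have hn4' : (1 : ℝ) ≤ (n : ℝ) ^ 4 := one_le_pow₀ (by exact_mod_cast hn)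
  obtain ⟨L, hL⟩ : ∃ L, L = Real.log (1 / ε) := ⟨_, rfl⟩
  have hLL₀ : L₀ ≤ L := by
    rw [hL, hL₀]
    exact Real.log_le_log (by positivity) (one_div_le_one_div_of_le hε hεε₀)
  have hLpos : 0 < L := hL₀pos.trans_le hLL₀
  rw [← hL, abs_of_pos hLpos]
  refine ⟨⌈100 * (n : ℝ) ^ 4 / κ * (L + R)⌉₊, ?_, fun k hk => ?_⟩
  · refine (Nat.ceil_lt_add_one (by positivity)).le.trans ?_
    have h1 : R ≤ R / L₀ * L := by
      rw [div_mul_eq_mul_div, le_div_iff₀ hL₀pos]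
      exact mul_le_mul_of_nonneg_left hLL₀ hR0
    have h2 : 1 ≤ 1 / L₀ * (n : ℝ) ^ 4 * L := by
      have h3 : 1 ≤ 1 / L₀ * L := by
        rw [one_div, ← div_eq_inv_mul, le_div_iff₀ hL₀pos, one_mul]; exact hLL₀
      have := mul_le_mul hn4' h3 zero_le_one hn4.le
      linarith
    have h4 := mul_le_mul_of_nonneg_left h1 (by positivity : 0 ≤ 100 * (n : ℝ) ^ 4 / κ)
    have h5 : (100 / κ * (1 + R / L₀) + 1 / L₀) * (n : ℝ) ^ 4 * L =
        100 * (n : ℝ) ^ 4 / κ * L + 100 * (n : ℝ) ^ 4 / κ * (R / L₀ * L) +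
          1 / L₀ * (n : ℝ) ^ 4 * L := by ring
    rw [h5]
    linarith
  · have h1 : 100 * (n : ℝ) ^ 4 / κ * (L + R) ≤ k := (Nat.le_ceil _).trans (by exact_mod_cast hk)
    have h2 : L + R ≤ 1 / 100 * (κ / (n : ℝ) ^ 4) * k := by
      have h3 := mul_le_mul_of_nonneg_left h1
        (by positivity : 0 ≤ 1 / 100 * (κ / (n : ℝ) ^ 4))
      have h4 : 1 / 100 * (κ / (n : ℝ) ^ 4) * (100 * (n : ℝ) ^ 4 / κ * (L + R)) = L + R := by
        field_simp
      linarith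
    have h3 : ρ ^ 2 ≤ Real.exp R := by
      rw [← Real.log_le_iff_le_exp (by positivity), hR]
      exact le_abs_self _
    calc Real.exp (-(1 / 100 * (κ / (n : ℝ) ^ 4) * k)) * ρ ^ 2
        ≤ Real.exp (-(L + R)) * Real.exp R := by gcongr
      _ = Real.exp (-L) := by rw [← Real.exp_add]; congr 1; ring
      _ = ε := by rw [hL, one_div, Real.log_inv, neg_neg, Real.exp_log hε]

end IPPMM

/-! ### The complexity bound -/

theorem theorem4p2
    (par : IPPMM.Params) (Kstar KA1 KA2 Kr1 Kr2 ρ Ky K ω ε₀ : ℝ)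
    (hKstar : 0 < Kstar) (hKA1 : 0 < KA1) (hKA2 : 0 < KA2) (hKr1 : 0 < Kr1) (hKr2 : 0 < Kr2)
    (hρ : 0 < ρ) (hKy : 0 < Ky) (hK : 0 < K) (hω : 0 < ω) (hε₀ : 0 < ε₀) (hε₀' : ε₀ < 1) :
    ∃ c : ℝ, 0 < c ∧
      ∀ (m n : ℕ), m < n → ∀ P : IPPMM.SDP m n,
        P.Assumption1 Kstar → P.Assumption2 KA1 KA2 Kr1 Kr2 →
      ∀ y₀ : Fin m → ℝ, IPPMM.vnorm y₀ ≤ Ky * √(n : ℝ) →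
      ∀ ε : ℝ, 0 < ε → ε ≤ ε₀ → IPPMM.mu0 n ρ ≤ K / ε ^ ω →
      ∀ (N : ℕ∞) (w : ℕ → IPPMM.State m n), P.IsRun par ρ y₀ N w →
        ∃ k₀ : ℕ, (k₀ : ℝ) ≤ c * (n : ℝ) ^ 4 * |Real.log (1 / ε)| ∧
          ∀ k : ℕ, k₀ ≤ k → (k : ℕ∞) ≤ N → (w k).μ ≤ ε := by
  obtain ⟨c₀, κ, hρc, hKyc, hκ, hκ1, hstep⟩ :=
    IPPMM.exists_step_decrease par hρ hKstar hKy hKA1 hKA2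
  obtain ⟨c, hc, hbound⟩ := IPPMM.exists_iteration_bound hρ hκ hε₀ hε₀'
  refine ⟨c, hc, ?_⟩
  intro m n hmn P hA1 hA2 y₀ hy₀ ε hε hεε₀ _ N w hrun
  have hn : 0 < n := (Nat.zero_le m).trans_lt hmn
  obtain ⟨Xs, ys, Zs, I⟩ :=
    IPPMM.Instance.of_assumptions (ρ := ρ) hn hA1 hA2 hKA1 hKA2 hy₀
  obtain ⟨k₀, hk₀, hexp⟩ := hbound hn hε hεε₀
  refine ⟨k₀, hk₀, fun k hk hkN => le_trans ?_ (hexp k hk)⟩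
  set t := 1 / 100 * (κ / (n : ℝ) ^ 4) with ht
  -- The induction stops at `N`, beyond which the sequence is arbitrary; `1 - t ≤ exp (-t)` gives
  -- the exponential form.
  have hinv : ∀ j : ℕ, (j : ℕ∞) ≤ N → IPPMM.Invariant P par ρ y₀ c₀ (w j) ∧
      (w j).μ ≤ Real.exp (-(t * j)) * ρ ^ 2 := by
    intro j
    induction j with
    | zero =>
      intro _
      rw [hrun.1]
      have h0 := I.invariant_start par hρ hρc hKyc
      exact ⟨h0, by simpa using h0.le⟩
    | succ j ih =>
      intro hj
      have hj' : (j : ℕ∞) < N := lt_of_lt_of_le (by exact_mod_cast Nat.lt_succ_self j) hj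
      obtain ⟨h1, h2⟩ := ih hj'.le
      obtain ⟨h3, h4⟩ := hstep I h1 (hrun.2 j hj')
      refine ⟨h3, h4.trans ?_⟩
      calc (1 - t) * (w j).μ ≤ Real.exp (-t) * (Real.exp (-(t * j)) * ρ ^ 2) :=
            mul_le_mul (Real.one_sub_le_exp_neg t) h2 h1.pos.le (Real.exp_pos _).le
        _ = Real.exp (-(t * (j + 1 : ℕ))) * ρ ^ 2 := by
            rw [← mul_assoc, ← Real.exp_add]
            congr 2
            push_cast
            ring
  exact (hinv k hkN).2
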